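/- Let $a>0$, $q=e^{-1/a}$, and for complex $k,x,y$ put $t=q^k=e^{-k/a}$, $X=q^x=e^{-x/a}$, $Y=q^y=e^{-y/a}$. The $\mu$-function of type $A_2$ is $$\mu(X,Y)=\prod_{A\in\{X,\,Y,\,XY\}}\ \prod_{j=0}^\infty\frac{(1-Aq^j)(1-A^{-1}q^{j+1})}{(1-tAq^j)(1-tA^{-1}q^{j+1})}.$$ Let $0<r\le 1$ and let $f(X,Y)$ be analytic in the domain $q^{r}<|X|,|Y|<q^{-r}$, i.e. in the strips $|\Re x|<r$, $|\Re y|<r$ (for instance, $f\in\mathbb C[X^{\pm1},Y^{\pm1}]$ and $r=1$). For $\Re k>0$, i.e. $|t|<1$, let $\mathrm{ct}(f\mu)$ be the coefficient of $X^0Y^0$ in the Laurent expansion of $f\mu$ on the torus $|X|=|Y|=1$. As a function of $t$, it extends to a meromorphic function on the disc $|t|<q^{-r}$, i.e. to $\Re k>-r$; this extension is denoted by $\mathrm{ct}(f\mu)$ too. Put $$\varrho_0=\prod_{i=0}^\infty\frac{(1-t^{-1}q^i)(1-tq^{i+1})}{(1-q^{i+1})(1-t^2q^{i+1})},\qquad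 \varrho=\prod_{i=0}^\infty\frac{(1-t^{-1}q^i)(1-tq^{i+1})^2(1-t^{-2}q^i)}{(1-q^{i+1})^2(1-t^2q^{i+1})(1-t^3q^{i+1})},$$ $$\zeta^1_0(q^z)=\varrho_0\prod_{j=0}^\infty\frac{(1-q^{-z+j+1})(1-t^{-1}q^{z+j})}{(1-tq^{z+j})(1-t^2q^{-z+j+1})},\qquad \zeta^2_0(q^z)=\varrho_0t^{-1}\prod_{j=1}^\infty\frac{(1-q^{z+j})(1-t^{-1}q^{-z+j})}{(1-tq^{-z+j})(1-t^2q^{z+j})},$$ $$\varpi_1(1,1)=t^{-1}\,\frac{1-t^3q}{1-tq},\qquad \varpi_2(1,1)=1,$$ $$Int_0(f)=\frac1{(2\pi\imath a)^2}\int_{-\imath\pi a}^{\imath\pi a}\int_{-\imath\pi a}^{\imath\pi a}f(q^x,q^y)\,\mu(q^x,q^y)\,dx\,dy,$$ $$J_\varepsilon(f)=\frac1{2\pi\imath a}\int_{\varepsilon-\imath\pi a}^{\varepsilon+\imath\pi a}\bigl(f(t^{-1},q^y)+f(q^y,t^{-1})\bigr)\zeta^1_0(q^y)\,dy+\frac1{2\pi\imath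 a}\int_{\varepsilon-\imath\pi a}^{\varepsilon+\imath\pi a}f(t^{-1}q^{-y},q^y)\,\zeta^2_0(q^y)\,dy.$$ Let $-r<\Re k<0$. (i) If $0>\Re k>-\tfrac12$ and $t^3q\ne1$ (so that $\varrho$ is finite), then $$\mathrm{ct}(f\mu)=Int_0(f)+J_0(f)+\varrho\,f(t^{-1},t^{-1}).$$ (ii) If $-\tfrac12>\Re k>-1$ and $t^3q^2\ne1$, then $$\mathrm{ct}(f\mu)=Int_0(f)+J_0(f)+\varrho\Bigl(f(t^{-1},t^{-1})+\varpi_1(1,1)f(tq,t^{-2}q^{-1})+\varpi_2(1,1)\bigl(f(t^2q,t^{-1})+f(t^{-1},t^2q)\bigr)\Bigr).$$ (iii) If $\Re k=-\tfrac12$ and $t^2q\ne1$, then the term with $\varpi_1(1,1)$ must be omitted: $$\mathrm{ct}(f\mu)=Int_0(f)+J+\varrho\Bigl(f(t^{-1},t^{-1})+\varpi_2(1,1)\bigl(f(t^2q,t^{-1})+f(t^{-1},t^2q)\bigr)\Bigr).$$ Here the integrands of $J_0(f)$ can have poles on the line $\Re y=0$. The formula holds with $J=J_\varepsilon(f)$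 for any $0<\varepsilon<\tfrac12$ (the contour passes to the right of these poles), and also with $J=J_0(f)$ whenever the two integrals in $J_0(f)$ converge absolutely. -/

import Mathlib

noncomputable section

open Complex

namespace A2

/-- `q ^ x` for `q = exp (-1 / a)`, `a > 0`, and complex `x`. -/
def qpow (a : ℝ) (x : ℂ) : ℂ := Complex.exp (-x / (a : ℂ))

/-- The infinite product `∏_{j ≥ 0} (1 - z q ^ j)`. -/
def poch (q z : ℂ) : ℂ := ∏' j : ℕ, (1 - z * q ^ j)

/-- The factor of `μ` for a positive root `α` with `A = X_α`: the product of
`(1 - B) / (1 - t B)` over the `B = X_{[α, j]} = A q ^ j`, `j ≥ 0`, and the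
`B = X_{[-α, j]} = A⁻¹ q ^ j`, `j ≥ 1`. -/
def muRoot (q t A : ℂ) : ℂ :=
  poch q A * poch q (q * A⁻¹) / (poch q (t * A) * poch q (t * q * A⁻¹))

/-- The `μ`-function of type `A₂`, with `X = X_{α₁}`, `Y = X_{α₂}`; the positive roots are
`α₁`, `α₂`, `α₁ + α₂`. -/
def mu (q t X Y : ℂ) : ℂ := muRoot q t X * muRoot q t Y * muRoot q t (X * Y)

/-- `ϱ₀`, the common factor of the residues of `μ` along the one-dimensional residual tori. -/
def rho0 (q t : ℂ) : ℂ :=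
  poch q t⁻¹ * poch q (t * q) / (poch q q * poch q (t ^ 2 * q))

/-- `ϱ = μ_•(t⁻¹, t⁻¹)`: the value of `μ` at `X = Y = t⁻¹` after the deletion of the two vanishing
binomials `1 - t X` and `1 - t Y` of the denominator. -/
def rho (q t : ℂ) : ℂ :=
  poch q t⁻¹ * poch q (t * q) ^ 2 * poch q (t ^ 2)⁻¹ /
    (poch q q ^ 2 * poch q (t ^ 2 * q) * poch q (t ^ 3 * q))

/-- `ϖ₁(m, n)`, for `m, n ≥ 1`: the value `μ_•(t q ^ m, t q ^ n)` of `μ` with the vanishing binomials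
of its denominator deleted, divided by `ϱ`. -/
def varpi1 (q t : ℂ) (m n : ℕ) : ℂ :=
  t ^ (3 - 2 * ((m : ℤ) + (n : ℤ))) *
    (∏ j ∈ Finset.Icc 1 (m - 1), (1 - t ^ 2 * q ^ j) / (1 - q ^ j)) *
    (∏ j ∈ Finset.Icc 1 (n - 1), (1 - t ^ 2 * q ^ j) / (1 - q ^ j)) *
    ∏ j ∈ Finset.Icc 1 (m + n - 1), (1 - t ^ 3 * q ^ j) / (1 - t * q ^ j)

/-- `ϖ₂(m, n)`, for `n ≥ m ≥ 1`: the value `μ_•(t⁻¹ q ^ (m - n), t ^ 2 q ^ n)` of `μ` with the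
vanishing binomials of its denominator deleted, divided by `ϱ`. -/
def varpi2 (q t : ℂ) (m n : ℕ) : ℂ :=
  t ^ (2 - 2 * (n : ℤ)) *
    (∏ j ∈ Finset.Icc 1 (m - 1),
      (1 - t ^ 2 * q ^ j) / (1 - q ^ j) *
        ((1 - q ^ (n - j)) / (1 - t ^ 2 * q ^ (n - j)))) *
    ∏ j ∈ Finset.Icc 1 (n - 1),
      (1 - t ^ 2 * q ^ j) / (1 - q ^ j) * ((1 - t ^ 3 * q ^ j) / (1 - t * q ^ j))

/-- `ζ¹₀` as a function of `Z = q ^ z`: the function `μ` restricted to `X = t⁻¹`, `Y = Z`,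
with the vanishing binomial `1 - t X` of the denominator deleted. -/
def zeta1 (q t Z : ℂ) : ℂ :=
  rho0 q t * (poch q (q * Z⁻¹) * poch q (t⁻¹ * Z) /
    (poch q (t * Z) * poch q (t ^ 2 * q * Z⁻¹)))

/-- `ζ²₀` as a function of `Z = q ^ z`: the function `μ` restricted to `X = t⁻¹ Z⁻¹`, `Y = Z`,
with the vanishing binomial `1 - t X Y` of the denominator deleted. -/
def zeta2 (q t Z : ℂ) : ℂ :=
  rho0 q t * t⁻¹ * (poch q (q * Z) * poch q (t⁻¹ * q * Z⁻¹) /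
    (poch q (t * q * Z⁻¹) * poch q (t ^ 2 * q * Z)))

/-- The contour integral of `F` along the segment from `v - π a i` to `v + π a i`. -/
def lineInt (a v : ℝ) (F : ℂ → ℂ) : ℂ :=
  ∫ s in (-(Real.pi * a))..(Real.pi * a), F ((v : ℂ) + (s : ℂ) * I) * I

/-- `Int₀(f)`, the normalized two-dimensional imaginary integral of `f μ`. -/
def int0 (a : ℝ) (t : ℂ) (f : ℂ × ℂ → ℂ) : ℂ :=
  1 / (2 * (Real.pi : ℂ) * I * (a : ℂ)) ^ 2 *
    lineInt a 0 fun y => lineInt a 0 fun x =>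
      f (qpow a x, qpow a y) * mu (qpow a 1) t (qpow a x) (qpow a y)

/-- The integrand of the first one-dimensional integral. -/
def integrand1 (a : ℝ) (t : ℂ) (f : ℂ × ℂ → ℂ) (y : ℂ) : ℂ :=
  (f (t⁻¹, qpow a y) + f (qpow a y, t⁻¹)) * zeta1 (qpow a 1) t (qpow a y)

/-- The integrand of the second one-dimensional integral. -/
def integrand2 (a : ℝ) (t : ℂ) (f : ℂ × ℂ → ℂ) (y : ℂ) : ℂ :=
  f (t⁻¹ * qpow a (-y), qpow a y) * zeta2 (qpow a 1) t (qpow a y)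

/-- The sum of the two normalized one-dimensional integrals, along the contour `Re y = v`. -/
def int1 (a v : ℝ) (t : ℂ) (f : ℂ × ℂ → ℂ) : ℂ :=
  1 / (2 * (Real.pi : ℂ) * I * (a : ℂ)) * lineInt a v (integrand1 a t f) +
    1 / (2 * (Real.pi : ℂ) * I * (a : ℂ)) * lineInt a v (integrand2 a t f)

/-- The domain of `(X, Y) = (q ^ x, q ^ y)` for `|Re x| < r`, `|Re y| < r`. -/
def annulus (a r : ℝ) : Set (ℂ × ℂ) :=
  {p | Real.exp (-(r / a)) < ‖p.1‖ ∧ ‖p.1‖ < Real.exp (r / a) ∧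
    Real.exp (-(r / a)) < ‖p.2‖ ∧ ‖p.2‖ < Real.exp (r / a)}

/-- `c` is the constant term, i.e. the coefficient of `X ^ 0 Y ^ 0`, of the (absolutely
convergent) Laurent expansion of `g` on the torus `|X| = |Y| = 1`. -/
def IsConstantTerm (g : ℂ × ℂ → ℂ) (c : ℂ) : Prop :=
  ∃ b : ℤ × ℤ → ℂ,
    (∀ X Y : ℂ, ‖X‖ = 1 → ‖Y‖ = 1 →
      HasSum (fun n : ℤ × ℤ => b n * X ^ n.1 * Y ^ n.2) (g (X, Y))) ∧
    b (0, 0) = c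

/-- `C` is the function `t ↦ ct(f μ)` on the disc `|t| < q ^ (-r)`, that is, for `t = q ^ k`, for
`Re k > -r`: it is the constant term of the Laurent series of `f μ` for `|t| < 1`, i.e. for
`Re k > 0`, continued meromorphically in `t`. The normal form fixes the values of `C` at all of
its regular points by continuity. -/
def IsCt (a r : ℝ) (f : ℂ × ℂ → ℂ) (C : ℂ → ℂ) : Prop :=
  MeromorphicNFOn C {t : ℂ | ‖t‖ < Real.exp (r / a)} ∧
    ∀ t : ℂ, ‖t‖ < 1 →
      IsConstantTerm (fun p : ℂ × ℂ => f p * mu (qpow a 1) t p.1 p.2) (C t)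

end A2

end

/-!
For `|t| < 1` the constant term of `f μ` is its average over the unit torus
(`isConstantTerm_torusAvg`), and a constant term is always that average
(`eq_circleAverage_of_isConstantTerm`). In the coordinates `X = q ^ x`, `Y = q ^ y` the integrals
`Int₀` and `J_ε` are averages over circles (`int0_eq`, `int1_eq`), so the whole argument takes place
on circles: `Re y = ε` becomes `|Y| = σ` with `σ = |q| ^ ε`.

The continuation is found by moving contours. Over a torus of radius `ρ` slightly smaller than `1`
the average is the same for `|t| < 1`, but it stays analytic in `t` until `|t| ρ = 1`. For `|t| > 1`
the contours are brought back to the unit torus, across the poles of `μ` of absolute value `|t|⁻¹`.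
The residues are the one-dimensional integrals of `ζ¹₀` and `ζ²₀`, and moving the contour of `ζ¹₀`
in turn gives the term `ϱ f(t⁻¹, t⁻¹)` (`torusAvg_eq_add_lineAvg`). The one delicate point is that
in the integral over `X` the poles `t⁻¹` and `(t Y)⁻¹` collide at `Y = 1`; there `μ` has the factor
`1 - Y`, and a partial fraction separates the two poles (`circleAverage_mul_mu_fst`).

The resulting formula is meromorphic in `t` until a pole of the one-dimensional integrands reaches
`|Y| = 1`, which happens for `|t|² |q| = 1`: the pole `t² q` of `ζ¹₀` leaves the unit disc and the
pole `(t² q)⁻¹` of `ζ²₀` enters it. Near that circle the one-dimensional integrals are taken over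
`|Y| = σ` with `σ < 1`, where the integrands are regular. Comparing them with the
integrals over `|Y| = 1` before and after the crossing yields the terms with `ϖ₂` (`ctNear_eq_ctMid`) and with
`ϖ₁` (`ctFar_eq_ctMid`). On the line itself, absolute convergence forces the poles on `|Y| = 1` to be
removable, since `1 / (z - c)` is not integrable near `c`
(`circleAverage_div_sub_eq_of_circleIntegrable`).

The formulas glue to one meromorphic function (`ctCont`), whose normal form is the continuation
(`exists_continuation`); by the identity theorem it is the only one
(`MeromorphicNFOn.eqOn_of_eqOn_ball`).
-/

open Complex Metric Set Filter Topology Real MeasureTheory A2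

/-! ### The `q`-Pochhammer product -/

lemma multipliable_poch {q : ℂ} (hq : ‖q‖ < 1) (z : ℂ) :
    Multipliable fun j : ℕ => 1 - z * q ^ j := by
  simp_rw [sub_eq_add_neg]
  apply multipliable_one_add_of_summable
  simp_rw [norm_neg, norm_mul, norm_pow]
  exact (summable_geometric_of_lt_one (norm_nonneg q) hq).mul_left _

lemma poch_eq_one_sub_mul {q : ℂ} (hq : ‖q‖ < 1) (z : ℂ) :
    poch q z = (1 - z) * poch q (q * z) := by
  unfold poch
  have h := multipliable_poch hq (q * z)
  have h' : Multipliable fun j : ℕ => 1 - z * q ^ (j + 1) := by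
    refine h.congr fun j => ?_
    ring
  rw [tprod_eq_zero_mul' (f := fun j : ℕ => 1 - z * q ^ j) h', pow_zero, mul_one]
  congr 1
  refine tprod_congr fun j => ?_
  ring

lemma differentiable_poch {q : ℂ} (hq : ‖q‖ < 1) : Differentiable ℂ (poch q) := by
  intro z
  have hs : Summable fun j : ℕ => (‖z‖ + 1) * ‖q‖ ^ j :=
    (summable_geometric_of_lt_one (norm_nonneg q) hq).mul_left _
  have h := hs.hasProdLocallyUniformlyOn_nat_one_add (K := ball (0 : ℂ) (‖z‖ + 1))
    (f := fun j z => -(z * q ^ j)) isOpen_ball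
    (Eventually.of_forall fun j w hw => by
      rw [norm_neg, norm_mul, norm_pow]
      gcongr
      exact (mem_ball_zero_iff.1 hw).le)
    (fun j => by fun_prop)
  have hd := h.differentiableOn (Eventually.of_forall fun s => by
    refine DifferentiableOn.fun_finsetProd fun j _ => ?_
    fun_prop) isOpen_ball
  have hz : z ∈ ball (0 : ℂ) (‖z‖ + 1) := by simp
  have := hd.differentiableAt (isOpen_ball.mem_nhds hz)
  unfold poch
  simpa only [← sub_eq_add_neg] using this

lemma poch_ne_zero {q z : ℂ} (hq : ‖q‖ < 1) (hz : ∀ j : ℕ, z * q ^ j ≠ 1) : poch q z ≠ 0 := by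
  unfold poch
  simp_rw [sub_eq_add_neg]
  refine tprod_one_add_ne_zero_of_summable (fun j h => hz j ?_) ?_
  · linear_combination -h
  · simp_rw [norm_neg, norm_mul, norm_pow]
    exact (summable_geometric_of_lt_one (norm_nonneg q) hq).mul_left _

lemma poch_ne_zero_of_norm_lt {q z : ℂ} (hq : ‖q‖ < 1) (hz : ‖z‖ < 1) : poch q z ≠ 0 := by
  refine poch_ne_zero hq fun j h => ?_
  have h1 : ‖z * q ^ j‖ = 1 := by rw [h, norm_one]
  rw [norm_mul, norm_pow] at h1
  have h2 : ‖q‖ ^ j ≤ 1 := pow_le_one₀ (norm_nonneg q) hq.le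
  nlinarith [norm_nonneg z, norm_nonneg q]

/-! ### Circle averages: change of radius and residues -/

lemma circleIntegrable_of_continuousAt {g : ℂ → ℂ} {ρ : ℝ} (h0 : 0 ≤ ρ)
    (hg : ∀ z, ‖z‖ = ρ → ContinuousAt g z) : CircleIntegrable g 0 ρ :=
  ContinuousOn.circleIntegrable h0 fun z hz =>
    (hg z (mem_sphere_zero_iff_norm.1 hz)).continuousWithinAt

lemma circleAverage_congr_of_norm {g h : ℂ → ℂ} {ρ : ℝ} (h0 : 0 ≤ ρ)
    (hgh : ∀ z, ‖z‖ = ρ → g z = h z) : circleAverage g 0 ρ = circleAverage h 0 ρ :=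
  circleAverage_congr_sphere fun z hz => hgh z (by
    rwa [abs_of_nonneg h0, mem_sphere_zero_iff_norm] at hz)

/-- Cauchy's theorem on an annulus: the average of a holomorphic function over a circle does not
depend on the radius. -/
lemma circleAverage_eq_of_differentiableAt {g : ℂ → ℂ} {ρ₁ ρ₂ : ℝ} (h0 : 0 < ρ₁) (hle : ρ₁ ≤ ρ₂)
    (hd : ∀ z, ρ₁ ≤ ‖z‖ → ‖z‖ ≤ ρ₂ → DifferentiableAt ℂ g z) :
    circleAverage g 0 ρ₁ = circleAverage g 0 ρ₂ := by
  rw [circleAverage_eq_circleIntegral h0.ne', circleAverage_eq_circleIntegral (h0.trans_le hle).ne']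
  congr 1
  refine (circleIntegral_sub_center_inv_smul_eq_of_differentiable_on_annulus_off_countable h0 hle
    countable_empty ?_ ?_).symm
  · intro z hz
    simp only [Set.mem_sdiff, mem_closedBall_zero_iff, mem_ball_zero_iff, not_lt] at hz
    exact (hd z hz.2 hz.1).continuousAt.continuousWithinAt
  · intro z hz
    simp only [Set.mem_sdiff, mem_closedBall_zero_iff, mem_ball_zero_iff, not_le] at hz
    exact hd z hz.1.2.le hz.1.1.le

lemma circleAverage_inv_one_sub_mul_of_lt {w : ℂ} {ρ : ℝ} (h0 : 0 < ρ) (h : ρ * ‖w‖ < 1) :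
    circleAverage (fun z => (1 - w * z)⁻¹) 0 ρ = 1 := by
  have hne : ∀ z : ℂ, ‖z‖ ≤ ρ → 1 - w * z ≠ 0 := fun z hz h' => by
    have : ‖w * z‖ = 1 := by rw [← sub_eq_zero.1 h', norm_one]
    rw [norm_mul] at this
    nlinarith [norm_nonneg w]
  have := circleAverage_of_differentiable_on_off_countable (f := fun z => (1 - w * z)⁻¹) (c := 0)
    (R := ρ) countable_empty (fun z hz => ?_) (fun z hz => ?_)
  · simpa using this
  · rw [mem_closedBall_zero_iff, abs_of_pos h0] at hz
    exact ContinuousAt.continuousWithinAt (ContinuousAt.inv₀ (by fun_prop) (hne z hz))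
  · simp only [Set.sdiff_empty, mem_ball_zero_iff, abs_of_pos h0] at hz
    exact DifferentiableAt.fun_inv (by fun_prop) (hne z hz.le)

lemma circleAverage_inv_one_sub_mul_of_gt {w : ℂ} {ρ : ℝ} (h0 : 0 < ρ) (h : 1 < ρ * ‖w‖) :
    circleAverage (fun z => (1 - w * z)⁻¹) 0 ρ = 0 := by
  have hw : w ≠ 0 := by rintro rfl; simp at h; linarith
  have hw' : 0 < ‖w‖ := norm_pos_iff.2 hw
  have hne : ∀ z : ℂ, ‖z‖ = ρ → 1 - w * z ≠ 0 := fun z hz h' => by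
    have : ‖w * z‖ = 1 := by rw [← sub_eq_zero.1 h', norm_one]
    rw [norm_mul, hz] at this
    linarith
  have hne' : ∀ z : ℂ, ‖z‖ = ρ → z - w⁻¹ ≠ 0 := fun z hz h' => by
    apply hne z hz
    rw [sub_eq_zero.1 h', mul_inv_cancel₀ hw, sub_self]
  have key := DiffContOnCl.circleAverage_smul_div (f := fun _ => (1 : ℂ)) (c := 0) (R := ρ)
    (w := w⁻¹) diffContOnCl_const (by
      rw [mem_ball_zero_iff, norm_inv, abs_of_pos h0, inv_lt_iff_one_lt_mul₀ hw']
      exact h)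
  have : circleAverage (fun z => (1 - w * z)⁻¹) 0 ρ =
      circleAverage (fun z => 1 - ((z - 0) / (z - w⁻¹)) • (1 : ℂ)) 0 ρ := by
    refine circleAverage_congr_of_norm h0.le fun z hz => ?_
    have h1 := hne z hz
    have h2 := hne' z hz
    have e : 1 - w * z = -w * (z - w⁻¹) := by field_simp; ring
    rw [sub_zero, smul_eq_mul, mul_one, e]
    obtain ⟨d, rfl⟩ : ∃ d, z = d + w⁻¹ := ⟨z - w⁻¹, by ring⟩
    rw [add_sub_cancel_right] at h2 ⊢
    field_simp
    ring
  rw [this, circleAverage_fun_sub, key, circleAverage_const, sub_self]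
  · exact circleIntegrable_const _ _ _
  · refine circleIntegrable_of_continuousAt h0.le fun z hz => ?_
    have h3 := hne' z hz
    fun_prop (disch := assumption)

/-- The residue theorem for a simple pole at `w⁻¹` between two circles. -/
lemma circleAverage_div_one_sub_mul {g : ℂ → ℂ} {w : ℂ} {ρ₁ ρ₂ : ℝ} (h0 : 0 < ρ₁)
    (h1 : ρ₁ * ‖w‖ < 1) (h2 : 1 < ρ₂ * ‖w‖)
    (hd : ∀ z, ρ₁ ≤ ‖z‖ → ‖z‖ ≤ ρ₂ → DifferentiableAt ℂ g z) :
    circleAverage (fun z => g z / (1 - w * z)) 0 ρ₁ =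
      circleAverage (fun z => g z / (1 - w * z)) 0 ρ₂ + g w⁻¹ := by
  have hw : w ≠ 0 := by rintro rfl; simp at h2; linarith
  have hw' : 0 < ‖w‖ := norm_pos_iff.2 hw
  have h12 : ρ₁ < ρ₂ := lt_of_mul_lt_mul_right (h1.trans h2) hw'.le
  have h02 : 0 < ρ₂ := h0.trans h12
  have hc1 : ρ₁ < ‖w⁻¹‖ := by rw [norm_inv, lt_inv_comm₀ h0 hw']; field_simp; linarith
  have hc2 : ‖w⁻¹‖ < ρ₂ := by rw [norm_inv, inv_lt_iff_one_lt_mul₀ hw']; exact h2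
  have hne : ∀ z : ℂ, ‖z‖ ≠ ‖w⁻¹‖ → 1 - w * z ≠ 0 := fun z hz h' => by
    apply hz
    rw [show z = w⁻¹ by field_simp; linear_combination -h']
  have hds : ∀ z, ρ₁ ≤ ‖z‖ → ‖z‖ ≤ ρ₂ → DifferentiableAt ℂ (dslope g w⁻¹) z := by
    intro z hz1 hz2
    by_cases hz : z = w⁻¹
    · have hU : {z : ℂ | ρ₁ < ‖z‖ ∧ ‖z‖ < ρ₂} ∈ 𝓝 w⁻¹ :=
        ((isOpen_lt continuous_const continuous_norm).inter
          (isOpen_lt continuous_norm continuous_const)).mem_nhds ⟨hc1, hc2⟩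
      rw [hz]
      exact ((Complex.differentiableOn_dslope hU).2 fun z hz =>
        (hd z hz.1.le hz.2.le).differentiableWithinAt).differentiableAt hU
    · exact (differentiableAt_dslope_of_ne hz).2 (hd z hz1 hz2)
  -- `g z = g w⁻¹ + (z - w⁻¹) dslope g w⁻¹ z` splits off the holomorphic part of the quotient
  have key : ∀ ρ, ρ₁ ≤ ρ → ρ ≤ ρ₂ → ρ ≠ ‖w⁻¹‖ →
      circleAverage (fun z => g z / (1 - w * z)) 0 ρ =
        circleAverage (fun z => -w⁻¹ * dslope g w⁻¹ z) 0 ρ +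
          g w⁻¹ * circleAverage (fun z => (1 - w * z)⁻¹) 0 ρ := by
    intro ρ hρ1 hρ2 hρ
    have hρ0 : 0 < ρ := h0.trans_le hρ1
    have e : circleAverage (fun z => g z / (1 - w * z)) 0 ρ =
        circleAverage (fun z => -w⁻¹ * dslope g w⁻¹ z + g w⁻¹ • (1 - w * z)⁻¹) 0 ρ := by
      refine circleAverage_congr_of_norm hρ0.le fun z hz => ?_
      have hz' : ‖z‖ ≠ ‖w⁻¹‖ := hz ▸ hρ
      have hne1 := hne z hz'
      have hzc : z ≠ w⁻¹ := fun h => hz' (by rw [h])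
      have hzc' := sub_ne_zero.2 hzc
      rw [dslope_of_ne _ hzc, slope_def_field, smul_eq_mul]
      have : 1 - w * z = -w * (z - w⁻¹) := by field_simp; ring
      rw [this]
      field_simp
      ring
    rw [e, circleAverage_fun_add, circleAverage_fun_smul, smul_eq_mul]
    · exact circleIntegrable_of_continuousAt hρ0.le fun z hz =>
        continuousAt_const.mul (hds z (hz ▸ hρ1) (hz ▸ hρ2)).continuousAt
    · exact circleIntegrable_of_continuousAt hρ0.le fun z hz =>
        have h3 := hne z (hz ▸ hρ)
        by fun_prop (disch := assumption)
  rw [key ρ₁ le_rfl h12.le hc1.ne, key ρ₂ h12.le le_rfl hc2.ne',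
    circleAverage_inv_one_sub_mul_of_lt h0 h1, circleAverage_inv_one_sub_mul_of_gt h02 h2,
    circleAverage_eq_of_differentiableAt h0 h12.le fun z hz1 hz2 => (hds z hz1 hz2).const_mul _]
  ring

/-- The residue theorem for a simple pole at `c` between two circles, with the pole written
as a zero of `1 - c / z`. -/
lemma circleAverage_div_one_sub_mul_inv {g : ℂ → ℂ} {c : ℂ} {ρ₁ ρ₂ : ℝ} (h0 : 0 < ρ₁)
    (h1 : ρ₁ < ‖c‖) (h2 : ‖c‖ < ρ₂)
    (hd : ∀ z, ρ₁ ≤ ‖z‖ → ‖z‖ ≤ ρ₂ → DifferentiableAt ℂ g z) :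
    circleAverage (fun z => g z / (1 - c * z⁻¹)) 0 ρ₂ =
      circleAverage (fun z => g z / (1 - c * z⁻¹)) 0 ρ₁ + g c := by
  have hc0 : 0 < ‖c‖ := h0.trans h1
  have hc : c ≠ 0 := norm_pos_iff.1 hc0
  -- `1 / (1 - c / z) = 1 - 1 / (1 - z / c)`
  have key : ∀ ρ, ρ₁ ≤ ρ → ρ ≤ ρ₂ → ρ ≠ ‖c‖ →
      circleAverage (fun z => g z / (1 - c * z⁻¹)) 0 ρ =
        circleAverage g 0 ρ - circleAverage (fun z => g z / (1 - c⁻¹ * z)) 0 ρ := by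
    intro ρ hρ1 hρ2 hρ
    have hρ0 : 0 < ρ := h0.trans_le hρ1
    have hne : ∀ z : ℂ, ‖z‖ = ρ → 1 - c⁻¹ * z ≠ 0 := fun z hz h' => by
      apply hρ
      rw [← hz, show z = c by field_simp at h'; linear_combination -h']
    rw [← circleAverage_fun_sub]
    · refine circleAverage_congr_of_norm hρ0.le fun z hz => ?_
      have hz0 : z ≠ 0 := by rintro rfl; simp at hz; linarith
      have hne1 := hne z hz
      have hzc : z - c ≠ 0 := by
        intro h
        apply hne1
        rw [sub_eq_zero.1 h]
        field_simp
        ring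
      have hcz : c - z ≠ 0 := by rwa [← neg_sub, neg_ne_zero]
      field_simp
      ring
    · exact circleIntegrable_of_continuousAt hρ0.le fun z hz =>
        (hd z (hz ▸ hρ1) (hz ▸ hρ2)).continuousAt
    · exact circleIntegrable_of_continuousAt hρ0.le fun z hz =>
        (hd z (hz ▸ hρ1) (hz ▸ hρ2)).continuousAt.div (by fun_prop) (hne z hz)
  have h12 := h1.trans h2
  rw [key ρ₁ le_rfl h12.le h1.ne, key ρ₂ h12.le le_rfl h2.ne',
    circleAverage_eq_of_differentiableAt h0 h12.le hd,
    circleAverage_div_one_sub_mul (w := c⁻¹) (ρ₂ := ρ₂) h0 (by rw [norm_inv]; field_simp; linarith)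
      (by rw [norm_inv]; field_simp; linarith) hd, inv_inv]
  ring

/-! ### Circle averages depending on parameters -/

lemma continuousOn_circleAverage {X : Type*} [TopologicalSpace X] [FirstCountableTopology X]
    {S : Set X} {F : X → ℂ → ℂ} {ρ : ℝ} (h0 : 0 ≤ ρ)
    (hF : ContinuousOn (Function.uncurry F) (S ×ˢ sphere 0 ρ)) :
    ContinuousOn (fun x => circleAverage (F x) 0 ρ) S := by
  rw [continuousOn_iff_continuous_domRestrict]
  unfold circleAverage
  have : Continuous (Function.uncurry fun (x : S) (θ : ℝ) => F x (circleMap 0 ρ θ)) := by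
    have h1 : Continuous fun p : S × ℝ => ((p.1 : X), circleMap 0 ρ p.2) := by fun_prop
    exact hF.comp_continuous h1 fun p => ⟨p.1.2, circleMap_mem_sphere _ h0 _⟩
  exact (intervalIntegral.continuous_parametric_intervalIntegral_of_continuous' this 0
    (2 * π)).const_smul _

/-- Holomorphy under the integral sign; the derivative is dominated by Cauchy's estimate. -/
lemma differentiableOn_circleAverage {U : Set ℂ} (hU : IsOpen U) {F : ℂ → ℂ → ℂ} {ρ : ℝ}
    (h0 : 0 ≤ ρ) (hF : ContinuousOn (Function.uncurry F) (U ×ˢ sphere 0 ρ))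
    (hd : ∀ z, ‖z‖ = ρ → DifferentiableOn ℂ (fun t => F t z) U) :
    DifferentiableOn ℂ (fun t => circleAverage (F t) 0 ρ) U := by
  intro t ht
  apply DifferentiableAt.differentiableWithinAt
  obtain ⟨ε, hε, hεU⟩ := Metric.nhds_basis_closedBall.mem_iff.1 (hU.mem_nhds ht)
  have hcm : ∀ θ, circleMap 0 ρ θ ∈ sphere (0 : ℂ) ρ := circleMap_mem_sphere _ h0
  have hcn : ∀ θ, ‖circleMap 0 ρ θ‖ = ρ := fun θ => mem_sphere_zero_iff_norm.1 (hcm θ)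
  have hcont : ∀ s ∈ U, Continuous fun θ => F s (circleMap 0 ρ θ) := fun s hs =>
    hF.comp_continuous (f := fun θ : ℝ => (s, circleMap 0 ρ θ)) (by fun_prop)
      fun θ => ⟨hs, hcm θ⟩
  obtain ⟨M, hM⟩ := (((isCompact_closedBall t ε).prod (isCompact_sphere (0 : ℂ) ρ)).bddAbove_image
    (hF.mono (prod_mono hεU le_rfl)).norm)
  have hM' : ∀ s ∈ closedBall t ε, ∀ θ, ‖F s (circleMap 0 ρ θ)‖ ≤ M := fun s hs θ =>
    hM ⟨(s, circleMap 0 ρ θ), ⟨hs, hcm θ⟩, rfl⟩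
  have hder : ∀ θ : ℝ, ∀ s ∈ U, HasDerivAt (fun t => F t (circleMap 0 ρ θ))
      (deriv (fun t => F t (circleMap 0 ρ θ)) s) s := fun θ s hs =>
    ((hd _ (hcn θ)).differentiableAt (hU.mem_nhds hs)).hasDerivAt
  have key := intervalIntegral.hasDerivAt_integral_of_dominated_loc_of_deriv_le (𝕜 := ℂ)
    (μ := volume) (a := 0) (b := 2 * π)
    (F := fun t θ => F t (circleMap 0 ρ θ)) (x₀ := t) (s := ball t (ε / 2))
    (F' := fun s θ => deriv (fun t => F t (circleMap 0 ρ θ)) s) (bound := fun _ => M / (ε / 2))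
    (ball_mem_nhds _ (half_pos hε))
    ((hU.eventually_mem ht).mono fun s hs => (hcont s hs).aestronglyMeasurable)
    ((hcont t ht).intervalIntegrable _ _) ?_ ?_ (by simp) ?_
  · unfold circleAverage
    have := key.2.differentiableAt
    fun_prop
  · -- the derivative is a pointwise limit of continuous difference quotients
    let u : ℕ → ℂ := fun n => t + (ε / (n + 2) : ℝ)
    have hpos : ∀ n : ℕ, 0 < ε / ((n : ℝ) + 2) := fun n => by positivity
    have hu : ∀ n, u n ∈ U := fun n => hεU (by
      simp only [u, mem_closedBall, dist_self_add_left, norm_real, Real.norm_eq_abs]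
      rw [abs_of_pos (hpos n)]
      apply div_le_self hε.le
      have : (0 : ℝ) ≤ n := n.cast_nonneg
      linarith)
    have hut : Tendsto u atTop (𝓝[≠] t) := by
      refine tendsto_nhdsWithin_iff.2 ⟨?_, Eventually.of_forall fun n => ?_⟩
      · have h1 : Tendsto (fun n : ℕ => ε / ((n : ℝ) + 2)) atTop (𝓝 0) :=
          tendsto_const_nhds.div_atTop
            (tendsto_atTop_add_const_right _ _ tendsto_natCast_atTop_atTop)
        have h2 := (continuous_ofReal.tendsto 0).comp h1
        simpa [u] using h2.const_add t
      · have := (hpos n).ne'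
        simp only [u, mem_compl_iff, mem_singleton_iff, add_eq_left, ofReal_eq_zero]
        exact this
    refine aestronglyMeasurable_of_tendsto_ae atTop
      (f := fun n θ => slope (fun t => F t (circleMap 0 ρ θ)) t (u n)) (fun n => ?_)
      (ae_of_all _ fun θ => ?_)
    · have h1 := hcont _ (hu n)
      have h2 := hcont t ht
      have : Continuous fun θ => slope (fun t => F t (circleMap 0 ρ θ)) t (u n) := by
        simp only [slope_def_module]
        exact (h1.sub h2).const_smul (u n - t)⁻¹
      exact this.aestronglyMeasurable
    · exact (hasDerivAt_iff_tendsto_slope.1 (hder θ t ht)).comp hut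
  · refine ae_of_all _ fun θ _ s hs => ?_
    have hsub : closedBall s (ε / 2) ⊆ closedBall t ε := by
      apply closedBall_subset_closedBall'
      linarith [mem_ball.1 hs]
    refine Complex.norm_deriv_le_of_forall_mem_sphere_norm_le (half_pos hε) ?_ fun w hw =>
      hM' w (hsub (sphere_subset_closedBall hw)) θ
    exact ((hd _ (hcn θ)).mono ((closure_ball_subset_closedBall.trans hsub).trans
      hεU)).diffContOnCl
  · refine ae_of_all _ fun θ _ s hs => hder θ s (hεU ?_)
    exact (ball_subset_ball (half_le_self hε.le)).trans ball_subset_closedBall hs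

lemma circleAverage_circleAverage_swap {F : ℂ → ℂ → ℂ} {ρ₁ ρ₂ : ℝ} (h1 : 0 ≤ ρ₁) (h2 : 0 ≤ ρ₂)
    (hF : ContinuousOn (Function.uncurry F) (sphere 0 ρ₁ ×ˢ sphere 0 ρ₂)) :
    circleAverage (fun x => circleAverage (fun y => F x y) 0 ρ₂) 0 ρ₁ =
      circleAverage (fun y => circleAverage (fun x => F x y) 0 ρ₁) 0 ρ₂ := by
  unfold circleAverage
  simp only [intervalIntegral.integral_smul]
  rw [smul_comm]
  congr 2
  apply intervalIntegral_intervalIntegral_swap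
  have : Continuous (Function.uncurry fun θ φ : ℝ => F (circleMap 0 ρ₁ θ) (circleMap 0 ρ₂ φ)) :=
    hF.comp_continuous (f := fun p : ℝ × ℝ => (circleMap 0 ρ₁ p.1, circleMap 0 ρ₂ p.2))
      (by fun_prop) fun p => ⟨circleMap_mem_sphere _ h1 _, circleMap_mem_sphere _ h2 _⟩
  exact (this.continuousOn.integrableOn_compact
    (isCompact_uIcc.prod isCompact_uIcc)).mono_set (prod_mono uIoc_subset_uIcc uIoc_subset_uIcc)

/-! ### The factors of `μ` and of the residues -/

/-- `muRoot` without the binomial `1 - t A` of its denominator. -/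
noncomputable def muRed (q t A : ℂ) : ℂ :=
  poch q A * poch q (q * A⁻¹) / (poch q (q * (t * A)) * poch q (t * q * A⁻¹))

lemma muRoot_eq_muRed_div {q : ℂ} (hq : ‖q‖ < 1) (t A : ℂ) :
    muRoot q t A = muRed q t A / (1 - t * A) := by
  rw [muRoot, muRed, poch_eq_one_sub_mul hq (t * A), div_div]
  congr 1
  ring

/-- The ratio `ζ¹₀ / ϱ₀`. -/
noncomputable def core1 (q t Z : ℂ) : ℂ :=
  poch q (q * Z⁻¹) * poch q (t⁻¹ * Z) / (poch q (t * Z) * poch q (t ^ 2 * q * Z⁻¹))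

/-- The ratio `t ζ²₀ / ϱ₀`. -/
noncomputable def core2 (q t Z : ℂ) : ℂ :=
  poch q (q * Z) * poch q (t⁻¹ * q * Z⁻¹) / (poch q (t * q * Z⁻¹) * poch q (t ^ 2 * q * Z))

/-- `core1` without the binomial `1 - t Z` of its denominator. -/
noncomputable def core1Red (q t Z : ℂ) : ℂ :=
  poch q (q * Z⁻¹) * poch q (t⁻¹ * Z) / (poch q (q * (t * Z)) * poch q (t ^ 2 * q * Z⁻¹))

lemma core1_eq_core1Red_div {q : ℂ} (hq : ‖q‖ < 1) (t Z : ℂ) :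
    core1 q t Z = core1Red q t Z / (1 - t * Z) := by
  rw [core1, core1Red, poch_eq_one_sub_mul hq (t * Z), div_div]
  congr 1
  ring

/-- `core1` without the binomial `1 - t² q / Z` of its denominator. -/
noncomputable def core1Red' (q t Z : ℂ) : ℂ :=
  poch q (q * Z⁻¹) * poch q (t⁻¹ * Z) / (poch q (t * Z) * poch q (q * (t ^ 2 * q * Z⁻¹)))

lemma core1_eq_core1Red'_div {q : ℂ} (hq : ‖q‖ < 1) (t Z : ℂ) :
    core1 q t Z = core1Red' q t Z / (1 - t ^ 2 * q * Z⁻¹) := by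
  rw [core1, core1Red', poch_eq_one_sub_mul hq (t ^ 2 * q * Z⁻¹), div_div]
  congr 1
  ring

/-- `core2` without the binomial `1 - t² q Z` of its denominator. -/
noncomputable def core2Red (q t Z : ℂ) : ℂ :=
  poch q (q * Z) * poch q (t⁻¹ * q * Z⁻¹) /
    (poch q (t * q * Z⁻¹) * poch q (q * (t ^ 2 * q * Z)))

lemma core2_eq_core2Red_div {q : ℂ} (hq : ‖q‖ < 1) (t Z : ℂ) :
    core2 q t Z = core2Red q t Z / (1 - t ^ 2 * q * Z) := by
  rw [core2, core2Red, poch_eq_one_sub_mul hq (t ^ 2 * q * Z), div_div]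
  congr 1
  ring

lemma poch_ne_zero_of_ne_one {q z : ℂ} (hq : ‖q‖ < 1) (h1 : z ≠ 1) (h : ‖q * z‖ < 1) :
    poch q z ≠ 0 := by
  rw [poch_eq_one_sub_mul hq]
  exact mul_ne_zero (sub_ne_zero.2 h1.symm) (poch_ne_zero_of_norm_lt hq h)

section Differentiability

variable {q t A Z : ℂ}

lemma differentiableAt_muRoot (hq : ‖q‖ < 1) (hA : A ≠ 0) (h1 : t * A ≠ 1)
    (h2 : ‖q * (t * A)‖ < 1) (h3 : ‖t * q * A⁻¹‖ < 1) :
    DifferentiableAt ℂ (fun p : ℂ × ℂ => muRoot q p.1 p.2) (t, A) := by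
  have n1 := poch_ne_zero_of_ne_one hq h1 h2
  have n2 := poch_ne_zero_of_norm_lt hq h3
  have n3 := mul_ne_zero n1 n2
  have hp := differentiable_poch hq
  unfold muRoot
  generalize poch q = p at *
  fun_prop (disch := assumption)

lemma differentiableAt_muRed (hq : ‖q‖ < 1) (hA : A ≠ 0)
    (h2 : ‖q * (t * A)‖ < 1) (h3 : ‖t * q * A⁻¹‖ < 1) : DifferentiableAt ℂ (muRed q t) A := by
  have n1 := poch_ne_zero_of_norm_lt hq h2
  have n2 := poch_ne_zero_of_norm_lt hq h3
  have n3 := mul_ne_zero n1 n2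
  have hp := differentiable_poch hq
  unfold muRed
  generalize poch q = p at *
  fun_prop (disch := assumption)

lemma differentiableAt_core1 (hq : ‖q‖ < 1) (ht : t ≠ 0) (hZ : Z ≠ 0) (h1 : t * Z ≠ 1)
    (h2 : ‖q * (t * Z)‖ < 1) (h3 : t ^ 2 * q * Z⁻¹ ≠ 1) (h4 : ‖q * (t ^ 2 * q * Z⁻¹)‖ < 1) :
    DifferentiableAt ℂ (fun p : ℂ × ℂ => core1 q p.1 p.2) (t, Z) := by
  have n1 := poch_ne_zero_of_ne_one hq h1 h2
  have n2 := poch_ne_zero_of_ne_one hq h3 h4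
  have n3 := mul_ne_zero n1 n2
  have hp := differentiable_poch hq
  unfold core1
  generalize poch q = p at *
  fun_prop (disch := assumption)

lemma differentiableAt_core1Red (hq : ‖q‖ < 1) (hZ : Z ≠ 0)
    (h2 : ‖q * (t * Z)‖ < 1) (h3 : t ^ 2 * q * Z⁻¹ ≠ 1) (h4 : ‖q * (t ^ 2 * q * Z⁻¹)‖ < 1) :
    DifferentiableAt ℂ (core1Red q t) Z := by
  have n1 := poch_ne_zero_of_norm_lt hq h2
  have n2 := poch_ne_zero_of_ne_one hq h3 h4
  have n3 := mul_ne_zero n1 n2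
  have hp := differentiable_poch hq
  unfold core1Red
  generalize poch q = p at *
  fun_prop (disch := assumption)

lemma differentiableAt_core1Red' (hq : ‖q‖ < 1) (hZ : Z ≠ 0) (h1 : t * Z ≠ 1)
    (h2 : ‖q * (t * Z)‖ < 1) (h4 : ‖q * (t ^ 2 * q * Z⁻¹)‖ < 1) :
    DifferentiableAt ℂ (core1Red' q t) Z := by
  have n1 := poch_ne_zero_of_ne_one hq h1 h2
  have n2 := poch_ne_zero_of_norm_lt hq h4
  have n3 := mul_ne_zero n1 n2
  have hp := differentiable_poch hq
  unfold core1Red'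
  generalize poch q = p at *
  fun_prop (disch := assumption)

lemma differentiableAt_core2 (hq : ‖q‖ < 1) (ht : t ≠ 0) (hZ : Z ≠ 0)
    (h2 : ‖t * q * Z⁻¹‖ < 1) (h3 : t ^ 2 * q * Z ≠ 1) (h4 : ‖q * (t ^ 2 * q * Z)‖ < 1) :
    DifferentiableAt ℂ (fun p : ℂ × ℂ => core2 q p.1 p.2) (t, Z) := by
  have n1 := poch_ne_zero_of_norm_lt hq h2
  have n2 := poch_ne_zero_of_ne_one hq h3 h4
  have n3 := mul_ne_zero n1 n2
  have hp := differentiable_poch hq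
  unfold core2
  generalize poch q = p at *
  fun_prop (disch := assumption)

lemma differentiableAt_core2Red (hq : ‖q‖ < 1) (hZ : Z ≠ 0)
    (h2 : ‖t * q * Z⁻¹‖ < 1) (h4 : ‖q * (t ^ 2 * q * Z)‖ < 1) :
    DifferentiableAt ℂ (core2Red q t) Z := by
  have n1 := poch_ne_zero_of_norm_lt hq h2
  have n2 := poch_ne_zero_of_norm_lt hq h4
  have n3 := mul_ne_zero n1 n2
  have hp := differentiable_poch hq
  unfold core2Red
  generalize poch q = p at *
  fun_prop (disch := assumption)

end Differentiability

/-! ### Residues of `μ`, `ζ¹₀` and `ζ²₀` -/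

section Residues

variable {q t : ℂ}

lemma muRed_inv (ht : t ≠ 0) : muRed q t t⁻¹ = rho0 q t := by
  rw [muRed, rho0, inv_inv, mul_inv_cancel₀ ht, mul_one]
  ring_nf

/-- The value of `μ`, with the binomial `1 - t Y` of its denominator deleted, at `X = Z`,
`Y = t⁻¹`: this is `ζ¹₀`. -/
lemma residue_root_inv {Z : ℂ} (hq : ‖q‖ < 1) (ht : t ≠ 0) (hZ : Z ≠ 0) (hZ1 : ‖Z‖ < 1)
    (hZ2 : ‖t * q * Z⁻¹‖ < 1) :
    muRoot q t Z * muRed q t t⁻¹ * muRoot q t (Z * t⁻¹) = zeta1 q t Z := by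
  have n1 := poch_ne_zero_of_norm_lt hq hZ1
  have n2 := poch_ne_zero_of_norm_lt hq hZ2
  rw [muRed_inv ht, zeta1, muRoot, muRoot]
  have e1 : t * (Z * t⁻¹) = Z := by field_simp
  have e2 : q * (Z * t⁻¹)⁻¹ = t * q * Z⁻¹ := by field_simp
  have e3 : t * q * (Z * t⁻¹)⁻¹ = t ^ 2 * q * Z⁻¹ := by field_simp
  have e4 : Z * t⁻¹ = t⁻¹ * Z := by ring
  rw [e1, e2, e3, e4]
  generalize poch q (t * q * Z⁻¹) = p at *
  field_simp

/-- The value at `X = t⁻¹` of `μ` with the binomial `1 - Y` of the numerator and the binomials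
`1 - t X`, `1 - t X Y` of the denominator deleted. For `X = t⁻¹` the binomials `1 - Y` and
`1 - t X Y` are equal, so that this is again `ζ¹₀`. -/
lemma residue_fst {Y : ℂ} (hq : ‖q‖ < 1) (ht : t ≠ 0) (hY : Y ≠ 0) (hY1 : ‖q * Y‖ < 1)
    (hY2 : ‖t * q * Y⁻¹‖ < 1) :
    muRed q t t⁻¹ * (poch q (q * Y) * poch q (q * Y⁻¹) /
      (poch q (t * Y) * poch q (t * q * Y⁻¹))) * muRed q t (t⁻¹ * Y) = zeta1 q t Y := by
  have n1 := poch_ne_zero_of_norm_lt hq hY1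
  have n2 := poch_ne_zero_of_norm_lt hq hY2
  rw [muRed_inv ht, zeta1, muRed]
  have e1 : q * (t * (t⁻¹ * Y)) = q * Y := by field_simp
  have e2 : q * (t⁻¹ * Y)⁻¹ = t * q * Y⁻¹ := by field_simp
  have e3 : t * q * (t⁻¹ * Y)⁻¹ = t ^ 2 * q * Y⁻¹ := by field_simp
  rw [e1, e2, e3]
  generalize poch q (t * q * Y⁻¹) = p at *
  generalize poch q (q * Y) = p' at *
  field_simp

/-- The value at `X = (t Y)⁻¹` of `Y μ`, with the same binomials `1 - Y`, `1 - t X`, `1 - t X Y`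
deleted. -/
lemma residue_sum {Y : ℂ} (hq : ‖q‖ < 1) (ht : t ≠ 0) (hY : Y ≠ 0) (hY1 : ‖q * Y⁻¹‖ < 1)
    (hY2 : ‖q * (t * Y)‖ < 1) (hY3 : t * Y ≠ 1) :
    Y * (muRed q t (t * Y)⁻¹ * (poch q (q * Y) * poch q (q * Y⁻¹) /
      (poch q (t * Y) * poch q (t * q * Y⁻¹))) * muRed q t ((t * Y)⁻¹ * Y)) = -zeta2 q t Y := by
  have n1 := poch_ne_zero_of_norm_lt hq hY1
  have n2 := poch_ne_zero_of_norm_lt hq hY2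
  have n3 : 1 - t * Y ≠ 0 := sub_ne_zero.2 hY3.symm
  have e0 : (t * Y)⁻¹ * Y = t⁻¹ := by field_simp
  rw [e0, muRed_inv ht, zeta2, muRed, poch_eq_one_sub_mul hq (t * Y)⁻¹,
    poch_eq_one_sub_mul hq (t * Y)]
  have e1 : q * (t * (t * Y)⁻¹) = q * Y⁻¹ := by field_simp
  have e2 : q * (t * Y)⁻¹⁻¹ = q * (t * Y) := by field_simp
  have e3 : t * q * (t * Y)⁻¹⁻¹ = t ^ 2 * q * Y := by field_simp
  have e4 : q * (t * Y)⁻¹ = t⁻¹ * q * Y⁻¹ := by field_simp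
  rw [e1, e2, e3, e4]
  have e5 : 1 - (t * Y)⁻¹ = -(1 - t * Y) * (t * Y)⁻¹ := by field_simp; ring
  rw [e5]
  generalize poch q (q * Y⁻¹) = p at *
  generalize poch q (q * (t * Y)) = p' at *
  generalize 1 - t * Y = d at *
  field_simp

/-- The value of `ζ¹₀`, with its vanishing binomial deleted, at the pole `Z = t⁻¹`. -/
lemma residue_zeta1_inv (ht : t ≠ 0) : rho0 q t * core1Red q t t⁻¹ = rho q t := by
  rw [rho0, core1Red, rho, inv_inv, mul_inv_cancel₀ ht, mul_one]
  have e1 : t⁻¹ * t⁻¹ = (t ^ 2)⁻¹ := by rw [← mul_inv, sq]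
  have e2 : t ^ 2 * q * t = t ^ 3 * q := by ring
  rw [e1, e2, mul_comm q t, div_mul_div_comm]
  congr 1 <;> ring

/-- The value of `ζ¹₀`, with its vanishing binomial deleted, at the pole `Z = t² q`. -/
lemma residue_zeta1 (hq0 : q ≠ 0) (hq : ‖q‖ < 1) (ht : t ≠ 0) (h : ‖t * q‖ < 1) :
    rho0 q t * core1Red' q t (t ^ 2 * q) = rho q t * varpi2 q t 1 1 := by
  have n1 := poch_ne_zero_of_norm_lt hq h
  rw [rho0, core1Red', rho, varpi2]
  have e1 : q * (t ^ 2 * q)⁻¹ = (t ^ 2)⁻¹ := by field_simp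
  have e2 : t⁻¹ * (t ^ 2 * q) = t * q := by field_simp
  have e3 : t * (t ^ 2 * q) = t ^ 3 * q := by ring
  have e4 : q * (t ^ 2 * q * (t ^ 2 * q)⁻¹) = q := by field_simp
  rw [e1, e2, e3, e4, div_mul_div_comm]
  simp
  congr 1 <;> ring

/-- The value of `ζ²₀`, with its vanishing binomial deleted, at the pole `Z = (t² q)⁻¹`. The
hypothesis `t ^ 3 * q ≠ 1` is needed, as otherwise `ϱ = 0` by the convention for division by
zero. -/
lemma residue_zeta2 (hq0 : q ≠ 0) (hq : ‖q‖ < 1) (ht : t ≠ 0) (h : ‖t * q‖ < 1)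
    (h3 : t ^ 3 * q ≠ 1) :
    rho0 q t * t⁻¹ * core2Red q t (t ^ 2 * q)⁻¹ = rho q t * varpi1 q t 1 1 := by
  have n1 := poch_ne_zero_of_norm_lt hq h
  have n2 : 1 - t * q ≠ 0 := fun h' => by
    rw [← sub_eq_zero.1 h', norm_one] at h
    exact lt_irrefl _ h
  have n3 : 1 - t ^ 3 * q ≠ 0 := sub_ne_zero.2 h3.symm
  have n4 : poch q (q * (t * q)) ≠ 0 := by
    rw [poch_eq_one_sub_mul hq] at n1
    exact right_ne_zero_of_mul n1
  rw [rho0, core2Red, rho, varpi1]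
  have e1 : q * (t ^ 2 * q)⁻¹ = (t ^ 2)⁻¹ := by field_simp
  have e2 : t⁻¹ * q * (t ^ 2 * q)⁻¹⁻¹ = q * (t * q) := by field_simp
  have e3 : t * q * (t ^ 2 * q)⁻¹⁻¹ = q * (t ^ 3 * q) := by field_simp
  have e4 : q * (t ^ 2 * q * (t ^ 2 * q)⁻¹) = q := by field_simp
  rw [e1, e2, e3, e4, poch_eq_one_sub_mul hq (t * q), poch_eq_one_sub_mul hq (t ^ 3 * q)]
  have e5 : (3 : ℤ) - 2 * ((1 : ℕ) + (1 : ℕ) : ℤ) = -1 := by norm_num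
  rw [e5, zpow_neg_one]
  simp
  field_simp

end Residues

lemma zeta1_eq (q t Z : ℂ) : zeta1 q t Z = rho0 q t * core1 q t Z := rfl

lemma zeta2_eq (q t Z : ℂ) : zeta2 q t Z = rho0 q t * t⁻¹ * core2 q t Z := rfl

/-! ### Moving one contour of `f μ` across the poles of `μ` -/

/-- A range of parameters in which `muRoot q` is holomorphic at `(t, A)`: in its denominator only
the first binomial `1 - t A` can come close to zero. -/
structure RegularAt (q t A : ℂ) : Prop where
  ne_zero : A ≠ 0
  ne_one : t * A ≠ 1
  lt_one : ‖q * (t * A)‖ < 1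
  lt_one_inv : ‖t * q * A⁻¹‖ < 1

lemma RegularAt.of_norm {q t A : ℂ} (h0 : 0 < ‖A‖) (h1 : ‖t‖ * ‖A‖ ≠ 1)
    (h2 : ‖t‖ * ‖q‖ * ‖A‖ < 1) (h3 : ‖t‖ * ‖q‖ < ‖A‖) : RegularAt q t A where
  ne_zero := norm_pos_iff.1 h0
  ne_one h := h1 (by rw [← norm_mul, h, norm_one])
  lt_one := by rw [norm_mul, norm_mul]; linarith
  lt_one_inv := by
    rw [norm_mul, norm_mul, norm_inv, ← div_eq_mul_inv, div_lt_one h0]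
    exact h3

lemma RegularAt.differentiableAt {q t A : ℂ} (h : RegularAt q t A) (hq : ‖q‖ < 1) :
    DifferentiableAt ℂ (fun p : ℂ × ℂ => muRoot q p.1 p.2) (t, A) :=
  differentiableAt_muRoot hq h.ne_zero h.ne_one h.lt_one h.lt_one_inv

lemma differentiableAt_mul_mu {f : ℂ × ℂ → ℂ} {q t X Y : ℂ} (hq : ‖q‖ < 1)
    (hf : DifferentiableAt ℂ f (X, Y)) (hX : RegularAt q t X) (hY : RegularAt q t Y)
    (hXY : RegularAt q t (X * Y)) :
    DifferentiableAt ℂ (fun p : ℂ × ℂ × ℂ => f (p.2.1, p.2.2) * mu q p.1 p.2.1 p.2.2)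
      (t, X, Y) := by
  unfold mu
  have h1 : DifferentiableAt ℂ (fun p : ℂ × ℂ × ℂ => f (p.2.1, p.2.2)) (t, X, Y) :=
    DifferentiableAt.comp (t, X, Y) (g := f) (f := fun p : ℂ × ℂ × ℂ => (p.2.1, p.2.2)) hf
      (by fun_prop)
  have h2 : DifferentiableAt ℂ (fun p : ℂ × ℂ × ℂ => muRoot q p.1 p.2.1) (t, X, Y) :=
    DifferentiableAt.comp (t, X, Y) (g := fun p : ℂ × ℂ => muRoot q p.1 p.2)
      (f := fun p : ℂ × ℂ × ℂ => (p.1, p.2.1)) (hX.differentiableAt hq) (by fun_prop)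
  have h3 : DifferentiableAt ℂ (fun p : ℂ × ℂ × ℂ => muRoot q p.1 p.2.2) (t, X, Y) :=
    DifferentiableAt.comp (t, X, Y) (g := fun p : ℂ × ℂ => muRoot q p.1 p.2)
      (f := fun p : ℂ × ℂ × ℂ => (p.1, p.2.2)) (hY.differentiableAt hq) (by fun_prop)
  have h4 : DifferentiableAt ℂ (fun p : ℂ × ℂ × ℂ => muRoot q p.1 (p.2.1 * p.2.2)) (t, X, Y) :=
    DifferentiableAt.comp (t, X, Y) (g := fun p : ℂ × ℂ => muRoot q p.1 p.2)
      (f := fun p : ℂ × ℂ × ℂ => (p.1, p.2.1 * p.2.2)) (hXY.differentiableAt hq) (by fun_prop)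
  exact h1.mul ((h2.mul h3).mul h4)

/-- `f` is holomorphic in the domain `R⁻¹ < |X|, |Y| < R`. -/
def HolomorphicOnAnnuli (R : ℝ) (f : ℂ × ℂ → ℂ) : Prop :=
  ∀ X Y : ℂ, R⁻¹ < ‖X‖ → ‖X‖ < R → R⁻¹ < ‖Y‖ → ‖Y‖ < R → DifferentiableAt ℂ f (X, Y)

lemma HolomorphicOnAnnuli.comp {R : ℝ} {f : ℂ × ℂ → ℂ} (hf : HolomorphicOnAnnuli R f)
    {E : Type*} [NormedAddCommGroup E] [NormedSpace ℂ E] {g h : E → ℂ} {x : E}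
    (hg : DifferentiableAt ℂ g x) (hh : DifferentiableAt ℂ h x)
    (h1 : R⁻¹ < ‖g x‖) (h2 : ‖g x‖ < R) (h3 : R⁻¹ < ‖h x‖) (h4 : ‖h x‖ < R) :
    DifferentiableAt ℂ (fun x => f (g x, h x)) x :=
  DifferentiableAt.comp x (g := f) (hf _ _ h1 h2 h3 h4) (hg.prodMk hh)

section Crossing

variable {f : ℂ × ℂ → ℂ} {q t : ℂ} {R ρ : ℝ}

/-- Moving the contour of `Y` from `|Y| = ρ` to `|Y| = 1`, for `|X| = ρ`, across the only pole
`t⁻¹` in between. -/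
lemma circleAverage_mul_mu_snd (hq : ‖q‖ < 1) (hf : HolomorphicOnAnnuli R f)
    (hρ0 : 0 < ρ) (hρ1 : ρ < 1) (hR : R⁻¹ < ρ) (hR1 : 1 < R) (ht1 : 1 < ‖t‖) (ht2 : ‖t‖ * ρ < 1)
    (ht3 : ‖t‖ * ‖q‖ < ρ ^ 2) {X : ℂ} (hX : ‖X‖ = ρ) :
    circleAverage (fun Y => f (X, Y) * mu q t X Y) 0 ρ =
      circleAverage (fun Y => f (X, Y) * mu q t X Y) 0 1 + f (X, t⁻¹) * zeta1 q t X := by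
  have ht : t ≠ 0 := norm_pos_iff.1 (by linarith)
  have htq : ‖t‖ * ‖q‖ < ρ := by nlinarith
  have htq0 : 0 ≤ ‖t‖ * ‖q‖ := by positivity
  have hX0 : X ≠ 0 := norm_pos_iff.1 (by linarith)
  have hrX : RegularAt q t X := .of_norm (by linarith) (by rw [hX]; exact ht2.ne)
    (by rw [hX]; nlinarith) (by linarith)
  let g : ℂ → ℂ := fun Y => f (X, Y) * (muRoot q t X * muRed q t Y * muRoot q t (X * Y))
  have e : ∀ Y, f (X, Y) * mu q t X Y = g Y / (1 - t * Y) := fun Y => by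
    simp only [g]
    rw [mu, muRoot_eq_muRed_div hq t Y]
    ring
  simp_rw [e]
  rw [circleAverage_div_one_sub_mul (g := g) (ρ₂ := 1) hρ0 (by linarith) (by linarith)]
  · congr 1
    simp only [g]
    rw [residue_root_inv hq ht hX0 (by linarith) hrX.lt_one_inv]
  · intro Y hY1 hY2
    have hY0 : Y ≠ 0 := norm_pos_iff.1 (by linarith)
    have hXY : ‖X * Y‖ = ρ * ‖Y‖ := by rw [norm_mul, hX]
    have hXYle : ‖X * Y‖ ≤ ρ := by rw [hXY]; nlinarith
    have hXYge : ρ ^ 2 ≤ ‖X * Y‖ := by rw [hXY]; nlinarith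
    have hrXY : RegularAt q t (X * Y) := .of_norm (by nlinarith) (by nlinarith)
      (by nlinarith) (by linarith)
    have h1 : DifferentiableAt ℂ (fun Y => f (X, Y)) Y := hf.comp (by fun_prop) (by fun_prop)
      (by linarith) (by linarith) (by linarith) (by linarith)
    have h2 : DifferentiableAt ℂ (muRed q t) Y := differentiableAt_muRed hq hY0
      (by rw [norm_mul, norm_mul]; nlinarith)
      (by
        rw [norm_mul, norm_mul, norm_inv, ← div_eq_mul_inv, div_lt_one (by linarith)]
        linarith)
    have h3 : DifferentiableAt ℂ (fun Y => muRoot q t (X * Y)) Y :=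
      DifferentiableAt.comp Y (g := fun p : ℂ × ℂ => muRoot q p.1 p.2) (f := fun Y => (t, X * Y))
        (hrXY.differentiableAt hq) (by fun_prop)
    exact h1.mul ((h2.const_mul _).mul h3)

/-- Moving the contour of `f(X, t⁻¹) ζ¹₀(X)` from `|X| = ρ` to `|X| = 1`, across the only pole
`t⁻¹` in between. -/
lemma circleAverage_mul_zeta1 (hq : ‖q‖ < 1) (hf : HolomorphicOnAnnuli R f)
    (hρ0 : 0 < ρ) (hR : R⁻¹ < ρ) (hR1 : 1 < R) (ht1 : 1 < ‖t‖)
    (ht2 : ‖t‖ * ρ < 1) (ht3 : ‖t‖ ^ 2 * ‖q‖ < ρ) :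
    circleAverage (fun X => f (X, t⁻¹) * zeta1 q t X) 0 ρ =
      circleAverage (fun X => f (X, t⁻¹) * zeta1 q t X) 0 1 + rho q t * f (t⁻¹, t⁻¹) := by
  have htp : 0 < ‖t‖ := by linarith
  have ht : t ≠ 0 := norm_pos_iff.1 htp
  have hti : ρ < ‖t⁻¹‖ := by rw [norm_inv, lt_inv_comm₀ hρ0 htp]; field_simp; linarith
  have hti' : ‖t⁻¹‖ < 1 := by rw [norm_inv]; exact inv_lt_one_of_one_lt₀ ht1
  have htq : ‖t‖ * ‖q‖ ≤ ‖t‖ ^ 2 * ‖q‖ := by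
    have := norm_nonneg q
    gcongr
    nlinarith
  let g : ℂ → ℂ := fun X => f (X, t⁻¹) * (rho0 q t * core1Red q t X)
  have e : ∀ X, f (X, t⁻¹) * zeta1 q t X = g X / (1 - t * X) := fun X => by
    simp only [g]
    rw [zeta1_eq, core1_eq_core1Red_div hq t X]
    ring
  simp_rw [e]
  have hρ1 : ρ < 1 := hti.trans hti'
  rw [circleAverage_div_one_sub_mul (g := g) (ρ₂ := 1) hρ0 (by linarith) (by linarith)]
  · congr 1
    simp only [g]
    rw [residue_zeta1_inv ht, mul_comm]
  · intro X hX1 hX2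
    have hX0 : X ≠ 0 := norm_pos_iff.1 (by linarith)
    have h0 : ‖t ^ 2 * q * X⁻¹‖ < 1 := by
      rw [norm_mul, norm_mul, norm_inv, norm_pow, ← div_eq_mul_inv, div_lt_one (by linarith)]
      linarith
    have h1 : DifferentiableAt ℂ (fun X => f (X, t⁻¹)) X := hf.comp (by fun_prop) (by fun_prop)
      (by linarith) (by linarith) (by linarith) (by linarith)
    have h2 : DifferentiableAt ℂ (core1Red q t) X := differentiableAt_core1Red hq hX0
      (by rw [norm_mul, norm_mul]; nlinarith [mul_nonneg htp.le (norm_nonneg q)])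
      (fun h => by rw [h, norm_one] at h0; exact lt_irrefl _ h0)
      (by rw [norm_mul]; nlinarith [norm_nonneg q, norm_nonneg (t ^ 2 * q * X⁻¹)])
    exact h1.mul (h2.const_mul _)

/-- Moving the contour of `X` from `|X| = ρ` to `|X| = 1`, for `|Y| = 1`. The two poles `t⁻¹` and
`(t Y)⁻¹` collide for `Y = 1`, where the numerator of `μ` vanishes; they are separated by
`(1 - Y) / ((1 - t X) (1 - t X Y)) = 1 / (1 - t X) - Y / (1 - t X Y)`. -/
lemma circleAverage_mul_mu_fst (hq : ‖q‖ < 1) (hf : HolomorphicOnAnnuli R f)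
    (hρ0 : 0 < ρ) (hR : R⁻¹ < ρ) (hR1 : 1 < R) (ht1 : 1 < ‖t‖) (ht2 : ‖t‖ * ρ < 1)
    (ht3 : ‖t‖ * ‖q‖ < ρ) {Y : ℂ} (hY : ‖Y‖ = 1) :
    circleAverage (fun X => f (X, Y) * mu q t X Y) 0 ρ =
      circleAverage (fun X => f (X, Y) * mu q t X Y) 0 1 + f (t⁻¹, Y) * zeta1 q t Y +
        f (t⁻¹ * Y⁻¹, Y) * zeta2 q t Y := by
  have htp : 0 < ‖t‖ := by linarith
  have ht : t ≠ 0 := norm_pos_iff.1 htp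
  have htq0 : 0 ≤ ‖t‖ * ‖q‖ := by positivity
  have hρ1 : ρ < 1 := by nlinarith
  have hY0 : Y ≠ 0 := norm_pos_iff.1 (by linarith)
  have htY : ‖t * Y‖ = ‖t‖ := by rw [norm_mul, hY, mul_one]
  have htY1 : t * Y ≠ 1 := fun h => by rw [h, norm_one] at htY; linarith
  -- the integrand without the binomials `1 - Y`, `1 - t X` and `1 - t X Y`
  let B : ℂ → ℂ := fun X => f (X, Y) * (muRed q t X * (poch q (q * Y) * poch q (q * Y⁻¹) /
      (poch q (t * Y) * poch q (t * q * Y⁻¹))) * muRed q t (X * Y))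
  have hB : ∀ X, ρ ≤ ‖X‖ → ‖X‖ ≤ 1 → DifferentiableAt ℂ B X := by
    intro X hX1 hX2
    have hX0 : X ≠ 0 := norm_pos_iff.1 (by linarith)
    have hXY : ‖X * Y‖ = ‖X‖ := by rw [norm_mul, hY, mul_one]
    have h1 : DifferentiableAt ℂ (fun X => f (X, Y)) X := hf.comp (by fun_prop) (by fun_prop)
      (by linarith) (by linarith) (by linarith [inv_lt_one_of_one_lt₀ hR1]) (by linarith)
    have hr : ∀ A, ‖A‖ = ‖X‖ → DifferentiableAt ℂ (muRed q t) A := fun A hA =>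
      differentiableAt_muRed hq (norm_pos_iff.1 (by linarith))
        (by rw [norm_mul, norm_mul, hA]; nlinarith)
        (by
          rw [norm_mul, norm_mul, norm_inv, ← div_eq_mul_inv, div_lt_one (by linarith)]
          linarith)
    have h3 : DifferentiableAt ℂ (fun X => muRed q t (X * Y)) X :=
      DifferentiableAt.comp X (g := muRed q t) (hr _ hXY) (by fun_prop)
    exact h1.mul (((hr X rfl).mul_const _).mul h3)
  have key : ∀ X, ‖t‖ * ‖X‖ ≠ 1 → f (X, Y) * mu q t X Y =
      B X / (1 - t * X) - Y * B X / (1 - t * Y * X) := by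
    intro X hX
    have h1 : 1 - t * X ≠ 0 := fun h => hX (by rw [← norm_mul, ← sub_eq_zero.1 h, norm_one])
    have h2 : 1 - t * Y * X ≠ 0 := fun h => hX (by rw [← htY, ← norm_mul, ← sub_eq_zero.1 h,
      norm_one])
    have h3 : 1 - t * (X * Y) ≠ 0 := by rwa [show t * (X * Y) = t * Y * X by ring]
    simp only [B]
    rw [mu, muRoot_eq_muRed_div hq t X, muRoot_eq_muRed_div hq t (X * Y)]
    have h4 : muRoot q t Y = (1 - Y) * (poch q (q * Y) * poch q (q * Y⁻¹) /
        (poch q (t * Y) * poch q (t * q * Y⁻¹))) := by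
      rw [muRoot, poch_eq_one_sub_mul hq Y]
      ring
    rw [h4]
    generalize poch q (q * Y) * poch q (q * Y⁻¹) /
      (poch q (t * Y) * poch q (t * q * Y⁻¹)) = D
    have hab : 1 - Y = (1 - t * Y * X) - Y * (1 - t * X) := by ring
    rw [show 1 - t * (X * Y) = 1 - t * Y * X by ring, hab]
    generalize 1 - t * X = a at *
    generalize 1 - t * Y * X = b at *
    field_simp
  have hYB : ∀ X, ρ ≤ ‖X‖ → ‖X‖ ≤ 1 → DifferentiableAt ℂ (fun X => Y * B X) X :=
    fun X h1 h2 => (hB X h1 h2).const_mul Y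
  have split : ∀ σ, ρ ≤ σ → σ ≤ 1 → ‖t‖ * σ ≠ 1 →
      circleAverage (fun X => f (X, Y) * mu q t X Y) 0 σ =
        circleAverage (fun X => B X / (1 - t * X)) 0 σ -
          circleAverage (fun X => Y * B X / (1 - t * Y * X)) 0 σ := by
    intro σ hσ1 hσ2 hσ
    have hσ0 : 0 ≤ σ := by linarith
    rw [← circleAverage_fun_sub]
    · exact circleAverage_congr_of_norm hσ0 fun X hX => key X (by rwa [hX])
    · refine circleIntegrable_of_continuousAt hσ0 fun X hX => ?_
      refine (hB X (by linarith) (by linarith)).continuousAt.div (by fun_prop) fun h => hσ ?_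
      rw [← hX, ← norm_mul, ← sub_eq_zero.1 h, norm_one]
    · refine circleIntegrable_of_continuousAt hσ0 fun X hX => ?_
      refine (hYB X (by linarith) (by linarith)).continuousAt.div (by fun_prop) fun h => hσ ?_
      rw [← hX, ← htY, ← norm_mul, ← sub_eq_zero.1 h, norm_one]
  rw [split ρ le_rfl hρ1.le ht2.ne, split 1 hρ1.le le_rfl (by rw [mul_one]; exact ht1.ne'),
    circleAverage_div_one_sub_mul (g := B) (ρ₂ := 1) hρ0 (by linarith) (by linarith) hB,
    circleAverage_div_one_sub_mul (g := fun X => Y * B X) (ρ₂ := 1) hρ0 (by rw [htY]; linarith)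
      (by rw [htY]; linarith) hYB]
  have r1 : B t⁻¹ = f (t⁻¹, Y) * zeta1 q t Y := by
    simp only [B]
    rw [residue_fst hq ht hY0 (by rw [norm_mul, hY]; linarith)
      (by rw [norm_mul, norm_mul, norm_inv, hY]; linarith)]
  have r2 : Y * B (t * Y)⁻¹ = -(f (t⁻¹ * Y⁻¹, Y) * zeta2 q t Y) := by
    simp only [B]
    rw [mul_left_comm, residue_sum hq ht hY0 (by rw [norm_mul, norm_inv, hY]; linarith)
      (by rw [norm_mul, htY]; nlinarith) htY1, mul_inv, mul_neg]
  rw [r1, r2]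
  ring

end Crossing

/-! ### Averages over tori -/

section Parameters

variable {U : Set ℂ} {ρ₁ ρ₂ : ℝ}

lemma differentiableOn_circleAverage_of_prod (hU : IsOpen U) {F : ℂ × ℂ → ℂ} (h1 : 0 ≤ ρ₁)
    (hF : ∀ t ∈ U, ∀ z, ‖z‖ = ρ₁ → DifferentiableAt ℂ F (t, z)) :
    DifferentiableOn ℂ (fun t => circleAverage (fun z => F (t, z)) 0 ρ₁) U := by
  refine differentiableOn_circleAverage hU h1 ?_ fun z hz t ht => ?_
  · rintro ⟨t, z⟩ ⟨ht, hz⟩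
    exact (hF t ht z (mem_sphere_zero_iff_norm.1 hz)).continuousAt.continuousWithinAt
  · exact (DifferentiableAt.comp t (g := F) (f := fun t => (t, z)) (hF t ht z hz)
      (by fun_prop)).differentiableWithinAt

lemma differentiableOn_circleAverage_circleAverage (hU : IsOpen U) {F : ℂ × ℂ × ℂ → ℂ}
    (h1 : 0 ≤ ρ₁) (h2 : 0 ≤ ρ₂)
    (hF : ∀ t ∈ U, ∀ x y, ‖x‖ = ρ₁ → ‖y‖ = ρ₂ → DifferentiableAt ℂ F (t, x, y)) :
    DifferentiableOn ℂ
      (fun t => circleAverage (fun y => circleAverage (fun x => F (t, x, y)) 0 ρ₁) 0 ρ₂) U := by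
  refine differentiableOn_circleAverage hU h2 ?_ fun y hy => ?_
  · refine continuousOn_circleAverage (X := ℂ × ℂ) (F := fun p x => F (p.1, x, p.2)) h1 ?_
    rintro ⟨⟨t, y⟩, x⟩ ⟨⟨ht, hy⟩, hx⟩
    have := (hF t ht x y (mem_sphere_zero_iff_norm.1 hx)
      (mem_sphere_zero_iff_norm.1 hy)).continuousAt
    exact (ContinuousAt.comp (g := F) (f := fun p : (ℂ × ℂ) × ℂ => (p.1.1, p.2, p.1.2))
      (x := ((t, y), x)) this (by fun_prop)).continuousWithinAt
  · refine differentiableOn_circleAverage_of_prod (F := fun p => F (p.1, p.2, y)) hU h1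
      fun t ht x hx => ?_
    exact DifferentiableAt.comp (t, x) (g := F) (f := fun p : ℂ × ℂ => (p.1, p.2, y))
      (hF t ht x y hx hy) (by fun_prop)

lemma circleAverage_swap_of_continuousAt {F : ℂ → ℂ → ℂ} (h1 : 0 ≤ ρ₁) (h2 : 0 ≤ ρ₂)
    (hF : ∀ x y, ‖x‖ = ρ₁ → ‖y‖ = ρ₂ → ContinuousAt (Function.uncurry F) (x, y)) :
    circleAverage (fun x => circleAverage (fun y => F x y) 0 ρ₂) 0 ρ₁ =
      circleAverage (fun y => circleAverage (fun x => F x y) 0 ρ₁) 0 ρ₂ := by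
  refine circleAverage_circleAverage_swap h1 h2 ?_
  rintro ⟨x, y⟩ ⟨hx, hy⟩
  exact (hF x y (mem_sphere_zero_iff_norm.1 hx)
    (mem_sphere_zero_iff_norm.1 hy)).continuousWithinAt

lemma circleIntegrable_circleAverage_of_continuousAt {F : ℂ → ℂ → ℂ} (h1 : 0 ≤ ρ₁) (h2 : 0 ≤ ρ₂)
    (hF : ∀ x y, ‖x‖ = ρ₁ → ‖y‖ = ρ₂ → ContinuousAt (Function.uncurry F) (x, y)) :
    CircleIntegrable (fun x => circleAverage (fun y => F x y) 0 ρ₂) 0 ρ₁ := by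
  refine ContinuousOn.circleIntegrable h1 (continuousOn_circleAverage h2 ?_)
  rintro ⟨x, y⟩ ⟨hx, hy⟩
  exact (hF x y (mem_sphere_zero_iff_norm.1 hx)
    (mem_sphere_zero_iff_norm.1 hy)).continuousWithinAt

/-- On a product of annuli, the average of a holomorphic function over a torus does not depend on
the radii. -/
lemma circleAverage_circleAverage_eq {F : ℂ → ℂ → ℂ} {r s σ₁ σ₂ τ₁ τ₂ : ℝ} (hr : 0 < r)
    (hF : ∀ x y, r ≤ ‖x‖ → ‖x‖ ≤ s → r ≤ ‖y‖ → ‖y‖ ≤ s →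
      DifferentiableAt ℂ (Function.uncurry F) (x, y))
    (h1 : r ≤ σ₁) (h1' : σ₁ ≤ s) (h2 : r ≤ σ₂) (h2' : σ₂ ≤ s)
    (h3 : r ≤ τ₁) (h3' : τ₁ ≤ s) (h4 : r ≤ τ₂) (h4' : τ₂ ≤ s) :
    circleAverage (fun y => circleAverage (fun x => F x y) 0 σ₁) 0 σ₂ =
      circleAverage (fun y => circleAverage (fun x => F x y) 0 τ₁) 0 τ₂ := by
  have one : ∀ {g : ℂ → ℂ} {σ τ : ℝ},
      (∀ z, r ≤ ‖z‖ → ‖z‖ ≤ s → DifferentiableAt ℂ g z) → r ≤ σ → σ ≤ s → r ≤ τ → τ ≤ s →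
      circleAverage g 0 σ = circleAverage g 0 τ := by
    intro g σ τ hg a1 a2 a3 a4
    rcases le_total σ τ with h | h
    · exact circleAverage_eq_of_differentiableAt (hr.trans_le a1) h
        fun z b1 b2 => hg z (a1.trans b1) (b2.trans a4)
    · exact (circleAverage_eq_of_differentiableAt (hr.trans_le a3) h
        fun z b1 b2 => hg z (a3.trans b1) (b2.trans a2)).symm
  have hx : ∀ x y, r ≤ ‖x‖ → ‖x‖ ≤ s → r ≤ ‖y‖ → ‖y‖ ≤ s →
      DifferentiableAt ℂ (fun x => F x y) x := fun x y a1 a2 a3 a4 =>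
    DifferentiableAt.comp x (g := Function.uncurry F) (f := fun x => (x, y))
      (hF x y a1 a2 a3 a4) (by fun_prop)
  have hy : ∀ x y, r ≤ ‖x‖ → ‖x‖ ≤ s → r ≤ ‖y‖ → ‖y‖ ≤ s →
      DifferentiableAt ℂ (fun y => F x y) y := fun x y a1 a2 a3 a4 =>
    DifferentiableAt.comp y (g := Function.uncurry F) (f := fun y => (x, y))
      (hF x y a1 a2 a3 a4) (by fun_prop)
  have swap : ∀ {σ τ : ℝ}, r ≤ σ → σ ≤ s → r ≤ τ → τ ≤ s →
      circleAverage (fun x => circleAverage (fun y => F x y) 0 τ) 0 σ =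
        circleAverage (fun y => circleAverage (fun x => F x y) 0 σ) 0 τ := fun a1 a2 a3 a4 =>
    circleAverage_swap_of_continuousAt (hr.le.trans a1) (hr.le.trans a3) fun x y b1 b2 =>
      (hF x y (b1 ▸ a1) (b1 ▸ a2) (b2 ▸ a3) (b2 ▸ a4)).continuousAt
  calc circleAverage (fun y => circleAverage (fun x => F x y) 0 σ₁) 0 σ₂
      = circleAverage (fun y => circleAverage (fun x => F x y) 0 τ₁) 0 σ₂ :=
        circleAverage_congr_of_norm (hr.le.trans h2) fun y b =>
          one (fun x a1 a2 => hx x y a1 a2 (b ▸ h2) (b ▸ h2')) h1 h1' h3 h3'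
    _ = circleAverage (fun x => circleAverage (fun y => F x y) 0 σ₂) 0 τ₁ :=
        (swap h3 h3' h2 h2').symm
    _ = circleAverage (fun x => circleAverage (fun y => F x y) 0 τ₂) 0 τ₁ :=
        circleAverage_congr_of_norm (hr.le.trans h3) fun x b =>
          one (fun y a1 a2 => hy x y (b ▸ h3) (b ▸ h3') a1 a2) h2 h2' h4 h4'
    _ = circleAverage (fun y => circleAverage (fun x => F x y) 0 τ₁) 0 τ₂ := swap h3 h3' h4 h4'

end Parameters

/-! ### The integrals as functions of `t` -/

section Integrals

variable (f : ℂ × ℂ → ℂ) (q : ℂ)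

/-- The average of `f μ` over the torus `|X| = |Y| = ρ`. -/
noncomputable def torusAvg (ρ : ℝ) (t : ℂ) : ℂ :=
  circleAverage (fun Y => circleAverage (fun X => f (X, Y) * mu q t X Y) 0 ρ) 0 ρ

/-- The average over `|Y| = σ` that gives the first one-dimensional integral, up to `ϱ₀`. -/
noncomputable def lineAvg1 (σ : ℝ) (t : ℂ) : ℂ :=
  circleAverage (fun Y => (f (t⁻¹, Y) + f (Y, t⁻¹)) * core1 q t Y) 0 σ

/-- The average over `|Y| = σ` that gives the second one-dimensional integral, up to `ϱ₀ t⁻¹`. -/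
noncomputable def lineAvg2 (σ : ℝ) (t : ℂ) : ℂ :=
  circleAverage (fun Y => f (t⁻¹ * Y⁻¹, Y) * core2 q t Y) 0 σ

/-- The sum of the one-dimensional integrals, over `|Y| = σ`. -/
noncomputable def lineAvg (σ : ℝ) (t : ℂ) : ℂ :=
  rho0 q t * lineAvg1 f q σ t + rho0 q t * t⁻¹ * lineAvg2 f q σ t

end Integrals

section Regularity

variable {f : ℂ × ℂ → ℂ} {q t : ℂ} {R : ℝ}

lemma differentiableAt_torus (hq : ‖q‖ < 1) (hf : HolomorphicOnAnnuli R f) {X Y : ℂ}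
    (hR : 1 < R) (hX : R⁻¹ < ‖X‖) (hX1 : ‖X‖ ≤ 1) (hY : R⁻¹ < ‖Y‖) (hY1 : ‖Y‖ ≤ 1)
    (hXY : ‖t‖ * ‖q‖ < ‖X‖ * ‖Y‖)
    (h1 : ‖t‖ * ‖X‖ ≠ 1) (h2 : ‖t‖ * ‖Y‖ ≠ 1) (h3 : ‖t‖ * (‖X‖ * ‖Y‖) ≠ 1) :
    DifferentiableAt ℂ (fun p : ℂ × ℂ × ℂ => f (p.2.1, p.2.2) * mu q p.1 p.2.1 p.2.2)
      (t, X, Y) := by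
  have hR0 : 0 < R⁻¹ := by positivity
  have hX0 : 0 < ‖X‖ := by linarith
  have hY0 : 0 < ‖Y‖ := by linarith
  have htq : 0 ≤ ‖t‖ * ‖q‖ := by positivity
  have hXY1 : ‖X‖ * ‖Y‖ ≤ ‖X‖ := by nlinarith
  have hXY2 : ‖X‖ * ‖Y‖ ≤ ‖Y‖ := by nlinarith
  refine differentiableAt_mul_mu hq (hf X Y hX (by linarith) hY (by linarith))
    (.of_norm hX0 h1 ?_ ?_) (.of_norm hY0 h2 ?_ ?_) (.of_norm ?_ ?_ ?_ ?_) <;>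
  try rw [norm_mul]
  · nlinarith
  · linarith
  · nlinarith
  · linarith
  · positivity
  · exact h3
  · have : 0 ≤ ‖X‖ * ‖Y‖ := by positivity
    nlinarith
  · exact hXY

lemma norm_inv_mem_of_norm {R : ℝ} {t : ℂ} (h1 : 1 < ‖t‖) (h2 : ‖t‖ < R) :
    R⁻¹ < ‖t⁻¹‖ ∧ ‖t⁻¹‖ < 1 := by
  rw [norm_inv]
  exact ⟨inv_strictAnti₀ (by linarith) h2, inv_lt_one_of_one_lt₀ h1⟩

lemma differentiableAt_integrand1 (hq : ‖q‖ < 1) (hf : HolomorphicOnAnnuli R f) {Z : ℂ}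
    (h1 : 1 < ‖t‖) (h2 : ‖t‖ < R) (h3 : R⁻¹ < ‖Z‖) (h4 : ‖Z‖ < R)
    (h5 : t * Z ≠ 1) (h6 : ‖t‖ * ‖q‖ * ‖Z‖ < 1) (h7 : t ^ 2 * q * Z⁻¹ ≠ 1)
    (h8 : (‖t‖ * ‖q‖) ^ 2 < ‖Z‖) :
    DifferentiableAt ℂ (fun p : ℂ × ℂ => (f (p.1⁻¹, p.2) + f (p.2, p.1⁻¹)) * core1 q p.1 p.2)
      (t, Z) := by
  have ht : t ≠ 0 := norm_pos_iff.1 (by linarith)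
  have hR0 : 0 < R := by linarith
  have hZ' : 0 < ‖Z‖ := lt_trans (by positivity) h3
  have hZ : Z ≠ 0 := norm_pos_iff.1 hZ'
  obtain ⟨i1, i2⟩ := norm_inv_mem_of_norm h1 h2
  have d1 : DifferentiableAt ℂ (fun p : ℂ × ℂ => p.1⁻¹) (t, Z) := by
    fun_prop (disch := assumption)
  have a1 : DifferentiableAt ℂ (fun p : ℂ × ℂ => f (p.1⁻¹, p.2)) (t, Z) :=
    hf.comp d1 (by fun_prop) i1 (by simp only; linarith) h3 h4
  have a2 : DifferentiableAt ℂ (fun p : ℂ × ℂ => f (p.2, p.1⁻¹)) (t, Z) :=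
    hf.comp (by fun_prop) d1 h3 h4 i1 (by simp only; linarith)
  refine (a1.add a2).mul (differentiableAt_core1 hq ht hZ h5 ?_ h7 ?_)
  · rw [norm_mul, norm_mul]
    linarith
  · rw [norm_mul, norm_mul, norm_mul, norm_inv, norm_pow, ← div_eq_mul_inv, ← mul_div_assoc,
      div_lt_one hZ']
    linarith

lemma differentiableAt_integrand2 (hq : ‖q‖ < 1) (hf : HolomorphicOnAnnuli R f) {Z : ℂ}
    (ht : t ≠ 0) (h1 : R⁻¹ < ‖t⁻¹ * Z⁻¹‖) (h2 : ‖t⁻¹ * Z⁻¹‖ < R) (hZ : Z ≠ 0)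
    (h3 : R⁻¹ < ‖Z‖) (h4 : ‖Z‖ < R)
    (h5 : ‖t‖ * ‖q‖ < ‖Z‖) (h6 : t ^ 2 * q * Z ≠ 1) (h7 : (‖t‖ * ‖q‖) ^ 2 * ‖Z‖ < 1) :
    DifferentiableAt ℂ (fun p : ℂ × ℂ => f (p.1⁻¹ * p.2⁻¹, p.2) * core2 q p.1 p.2) (t, Z) := by
  have hZ' : 0 < ‖Z‖ := norm_pos_iff.2 hZ
  have a1 : DifferentiableAt ℂ (fun p : ℂ × ℂ => f (p.1⁻¹ * p.2⁻¹, p.2)) (t, Z) :=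
    hf.comp (by fun_prop (disch := assumption)) (by fun_prop) h1 h2 h3 h4
  refine a1.mul (differentiableAt_core2 hq ht hZ ?_ h6 ?_)
  · rw [norm_mul, norm_mul, norm_inv, ← div_eq_mul_inv, div_lt_one hZ']
    linarith
  · rw [norm_mul, norm_mul, norm_mul, norm_pow]
    linarith

end Regularity

/-! ### Continuation of the constant term across `|t| = 1` -/

section Crossing

variable {f : ℂ × ℂ → ℂ} {q t : ℂ} {R ρ : ℝ}

/-- The continuation of the constant term to `|t| > 1`, close to `|t| = 1`. On the torus of radius
`ρ < |t|⁻¹` no pole of `μ` is met when `t` crosses the unit circle; the contours are then moved back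
to the unit torus, first that of `Y` and then that of `X`, and the residues are collected. -/
theorem torusAvg_eq_add_lineAvg (hq : ‖q‖ < 1) (hf : HolomorphicOnAnnuli R f)
    (hρ0 : 0 < ρ) (hR : R⁻¹ < ρ) (hR1 : 1 < R) (ht1 : 1 < ‖t‖) (ht2 : ‖t‖ * ρ < 1)
    (ht3 : ‖t‖ * ‖q‖ < ρ ^ 2) (ht4 : ‖t‖ ^ 2 * ‖q‖ < ρ) :
    torusAvg f q ρ t =
      torusAvg f q 1 t + lineAvg f q 1 t + rho q t * f (t⁻¹, t⁻¹) := by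
  have htp : 0 < ‖t‖ := by linarith
  have ht : t ≠ 0 := norm_pos_iff.1 htp
  have hρ1 : ρ < 1 := by nlinarith
  have htq : ‖t‖ * ‖q‖ < ρ := by nlinarith
  have hR2 : R⁻¹ < 1 := inv_lt_one_of_one_lt₀ hR1
  have htR : ‖t‖ < R := by
    have h := mul_inv_cancel₀ (show R ≠ 0 by linarith)
    have h' : 0 ≤ R⁻¹ := inv_nonneg.2 (by linarith)
    have : ‖t‖ * R⁻¹ < R * R⁻¹ := by nlinarith
    exact lt_of_mul_lt_mul_right this h'
  have hd : ∀ X Y, (‖X‖ = ρ ∨ ‖X‖ = 1) → (‖Y‖ = ρ ∨ ‖Y‖ = 1) →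
      DifferentiableAt ℂ (fun p : ℂ × ℂ => f (p.1, p.2) * mu q t p.1 p.2) (X, Y) := by
    intro X Y hX hY
    have := differentiableAt_torus (t := t) (X := X) (Y := Y) hq hf hR1
      (by rcases hX with h | h <;> rw [h] <;> linarith)
      (by rcases hX with h | h <;> rw [h]; linarith)
      (by rcases hY with h | h <;> rw [h] <;> linarith)
      (by rcases hY with h | h <;> rw [h]; linarith)
      (by rcases hX with h | h <;> rcases hY with h' | h' <;> rw [h, h'] <;> nlinarith)
      (by rcases hX with h | h <;> rw [h] <;> linarith)
      (by rcases hY with h | h <;> rw [h] <;> linarith)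
      (by rcases hX with h | h <;> rcases hY with h' | h' <;> rw [h, h'] <;> nlinarith)
    exact DifferentiableAt.comp (X, Y)
      (g := fun p : ℂ × ℂ × ℂ => f (p.2.1, p.2.2) * mu q p.1 p.2.1 p.2.2)
      (f := fun p : ℂ × ℂ => (t, p.1, p.2)) this (by fun_prop)
  have hc1 : ∀ X Y, (‖X‖ = ρ ∨ ‖X‖ = 1) → (‖Y‖ = ρ ∨ ‖Y‖ = 1) →
      ContinuousAt (Function.uncurry fun X Y => f (X, Y) * mu q t X Y) (X, Y) :=
    fun X Y hX hY => (hd X Y hX hY).continuousAt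
  have hc2 : ∀ Y X, (‖Y‖ = ρ ∨ ‖Y‖ = 1) → (‖X‖ = ρ ∨ ‖X‖ = 1) →
      ContinuousAt (Function.uncurry fun Y X => f (X, Y) * mu q t X Y) (Y, X) :=
    fun Y X hY hX => ContinuousAt.comp (x := (Y, X))
      (g := Function.uncurry fun X Y => f (X, Y) * mu q t X Y) (f := Prod.swap)
      (hc1 X Y hX hY) continuous_swap.continuousAt
  -- the one-dimensional integrands are regular on the circles `|Z| = ρ` and `|Z| = 1`
  have hζ1 : ∀ Z, (‖Z‖ = ρ ∨ ‖Z‖ = 1) → DifferentiableAt ℂ (core1 q t) Z := by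
    intro Z hZ
    have hZ1 : ρ ≤ ‖Z‖ ∧ ‖Z‖ ≤ 1 := by rcases hZ with h | h <;> rw [h] <;> constructor <;> linarith
    have h1 : ‖t * Z‖ ≠ 1 := by rw [norm_mul]; rcases hZ with h | h <;> rw [h] <;> linarith
    have h2 : ‖t ^ 2 * q * Z⁻¹‖ < 1 := by
      rw [norm_mul, norm_mul, norm_inv, norm_pow, ← div_eq_mul_inv, div_lt_one (by linarith)]
      linarith
    refine DifferentiableAt.comp Z (g := fun p : ℂ × ℂ => core1 q p.1 p.2) (f := fun Z => (t, Z))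
      (differentiableAt_core1 hq ht (norm_pos_iff.1 (by linarith))
        (fun h => h1 (by rw [h, norm_one])) ?_
        (fun h => by rw [h, norm_one] at h2; exact lt_irrefl _ h2) ?_) (by fun_prop)
    · rw [norm_mul, norm_mul]
      nlinarith [mul_nonneg htp.le (norm_nonneg q)]
    · rw [norm_mul]
      nlinarith [norm_nonneg q, norm_nonneg (t ^ 2 * q * Z⁻¹)]
  obtain ⟨i1, i2⟩ := norm_inv_mem_of_norm ht1 htR
  have hf1 : ∀ Z, (‖Z‖ = ρ ∨ ‖Z‖ = 1) →
      ContinuousAt (fun Z => f (Z, t⁻¹) * zeta1 q t Z) Z := by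
    intro Z hZ
    have : DifferentiableAt ℂ (fun Z => f (Z, t⁻¹)) Z := hf.comp (by fun_prop) (by fun_prop)
      (by rcases hZ with h | h <;> rw [h] <;> linarith)
      (by rcases hZ with h | h <;> rw [h] <;> linarith) i1 (by linarith)
    exact (this.mul ((hζ1 Z hZ).const_mul _)).continuousAt
  have hf2 : ∀ Z, ‖Z‖ = 1 → ContinuousAt (fun Z => f (t⁻¹, Z) * zeta1 q t Z) Z := by
    intro Z hZ
    have : DifferentiableAt ℂ (fun Z => f (t⁻¹, Z)) Z := hf.comp (by fun_prop) (by fun_prop)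
      i1 (by linarith) (by linarith) (by linarith)
    exact (this.mul ((hζ1 Z (.inr hZ)).const_mul _)).continuousAt
  have hf3 : ∀ Z, ‖Z‖ = 1 → ContinuousAt (fun Z => f (t⁻¹ * Z⁻¹, Z) * zeta2 q t Z) Z := by
    intro Z hZ
    have hZ0 : Z ≠ 0 := norm_pos_iff.1 (by linarith)
    have hn : ‖t⁻¹ * Z⁻¹‖ = ‖t⁻¹‖ := by rw [norm_mul, norm_inv Z, hZ, inv_one, mul_one]
    have h1 : DifferentiableAt ℂ (fun Z => f (t⁻¹ * Z⁻¹, Z)) Z :=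
      hf.comp (by fun_prop (disch := assumption)) (by fun_prop) (by linarith) (by linarith)
        (by linarith) (by linarith)
    have h2 : ‖t ^ 2 * q * Z‖ < 1 := by
      rw [norm_mul, norm_mul, norm_pow, hZ]
      linarith
    have h3 : DifferentiableAt ℂ (core2 q t) Z :=
      DifferentiableAt.comp Z (g := fun p : ℂ × ℂ => core2 q p.1 p.2) (f := fun Z => (t, Z))
        (differentiableAt_core2 hq ht hZ0
          (by rw [norm_mul, norm_mul, norm_inv, hZ]; linarith)
          (fun h => by rw [h, norm_one] at h2; exact lt_irrefl _ h2)
          (by rw [norm_mul]; nlinarith [norm_nonneg q, norm_nonneg (t ^ 2 * q * Z)]))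
        (by fun_prop)
    exact (h1.mul (h3.const_mul _)).continuousAt
  have s1 : torusAvg f q ρ t =
      circleAverage (fun X => circleAverage (fun Y => f (X, Y) * mu q t X Y) 0 ρ) 0 ρ :=
    circleAverage_swap_of_continuousAt hρ0.le hρ0.le
      fun Y X hY hX => hc2 Y X (.inl hY) (.inl hX)
  have s2 : circleAverage (fun X => circleAverage (fun Y => f (X, Y) * mu q t X Y) 0 ρ) 0 ρ =
      circleAverage (fun X => circleAverage (fun Y => f (X, Y) * mu q t X Y) 0 1 +
        f (X, t⁻¹) * zeta1 q t X) 0 ρ :=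
    circleAverage_congr_of_norm hρ0.le fun X hX =>
      circleAverage_mul_mu_snd hq hf hρ0 hρ1 hR hR1 ht1 ht2 ht3 hX
  have s3 : circleAverage (fun X => circleAverage (fun Y => f (X, Y) * mu q t X Y) 0 1) 0 ρ =
      circleAverage (fun Y => circleAverage (fun X => f (X, Y) * mu q t X Y) 0 ρ) 0 1 :=
    circleAverage_swap_of_continuousAt hρ0.le zero_le_one
      fun X Y hX hY => hc1 X Y (.inl hX) (.inr hY)
  have s4 : circleAverage (fun Y => circleAverage (fun X => f (X, Y) * mu q t X Y) 0 ρ) 0 1 =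
      circleAverage (fun Y => circleAverage (fun X => f (X, Y) * mu q t X Y) 0 1 +
        f (t⁻¹, Y) * zeta1 q t Y + f (t⁻¹ * Y⁻¹, Y) * zeta2 q t Y) 0 1 :=
    circleAverage_congr_of_norm zero_le_one fun Y hY =>
      circleAverage_mul_mu_fst hq hf hρ0 hR hR1 ht1 ht2 htq hY
  have c1 : CircleIntegrable (fun Y => f (t⁻¹, Y) * zeta1 q t Y) 0 1 :=
    circleIntegrable_of_continuousAt zero_le_one hf2
  have c2 : CircleIntegrable (fun Y => f (Y, t⁻¹) * zeta1 q t Y) 0 1 :=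
    circleIntegrable_of_continuousAt zero_le_one fun Z hZ => hf1 Z (.inr hZ)
  have c3 : CircleIntegrable (fun Y => f (t⁻¹ * Y⁻¹, Y) * zeta2 q t Y) 0 1 :=
    circleIntegrable_of_continuousAt zero_le_one hf3
  have c4 : CircleIntegrable
      (fun Y => circleAverage (fun X => f (X, Y) * mu q t X Y) 0 1) 0 1 :=
    circleIntegrable_circleAverage_of_continuousAt zero_le_one zero_le_one
      fun Y X hY hX => hc2 Y X (.inr hY) (.inr hX)
  have c5 : CircleIntegrable
      (fun X => circleAverage (fun Y => f (X, Y) * mu q t X Y) 0 1) 0 ρ :=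
    circleIntegrable_circleAverage_of_continuousAt hρ0.le zero_le_one
      fun X Y hX hY => hc1 X Y (.inl hX) (.inr hY)
  have c14 : CircleIntegrable (fun Y => circleAverage (fun X => f (X, Y) * mu q t X Y) 0 1 +
      f (t⁻¹, Y) * zeta1 q t Y) 0 1 := c4.add c1
  have l1 : rho0 q t * lineAvg1 f q 1 t =
      circleAverage (fun Y => f (t⁻¹, Y) * zeta1 q t Y) 0 1 +
        circleAverage (fun Y => f (Y, t⁻¹) * zeta1 q t Y) 0 1 := by
    rw [← circleAverage_fun_add c1 c2, lineAvg1, ← smul_eq_mul, ← circleAverage_fun_smul]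
    congr 1
    funext Y
    rw [zeta1_eq, smul_eq_mul]
    ring
  have l2 : rho0 q t * t⁻¹ * lineAvg2 f q 1 t =
      circleAverage (fun Y => f (t⁻¹ * Y⁻¹, Y) * zeta2 q t Y) 0 1 := by
    rw [lineAvg2, ← smul_eq_mul, ← circleAverage_fun_smul]
    congr 1
    funext Y
    rw [zeta2_eq, smul_eq_mul]
    ring
  rw [s1, s2, circleAverage_fun_add c5 (circleIntegrable_of_continuousAt hρ0.le
      fun Z hZ => hf1 Z (.inl hZ)), s3, s4, circleAverage_fun_add c14 c3,
    circleAverage_fun_add c4 c1, circleAverage_mul_zeta1 hq hf hρ0 hR hR1 ht1 ht2 ht4,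
    lineAvg, l1, l2, torusAvg]
  ring

end Crossing

/-! ### Moving the one-dimensional contours across `|t|² |q| = 1` -/

section Shift

variable {f : ℂ × ℂ → ℂ} {q t : ℂ} {R σ : ℝ}

lemma inv_lt_of_one_lt_mul {σ T R : ℝ} (hσ0 : 0 < σ) (h1 : 1 < T * σ) (h2 : T < R) : R⁻¹ < σ := by
  have hR : 0 < R := by nlinarith
  rw [inv_lt_iff_one_lt_mul₀ hR]
  nlinarith

/-- The first integrand is regular for `σ ≤ |Z|`, up to `|Z| = 1` and slightly beyond, but for its
pole `t² q`. -/
lemma differentiableAt_core1Red'_mul (hq : ‖q‖ < 1) (hf : HolomorphicOnAnnuli R f)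
    (hσ0 : 0 < σ) (hσ1 : σ < 1) (h1 : 1 < ‖t‖ * σ) (h2 : ‖t‖ < R) (h3 : ‖t‖ * ‖q‖ < σ) {Z : ℂ}
    (hZ1 : σ ≤ ‖Z‖) (hZ2 : ‖t‖ * ‖Z‖ < R) (hZ3 : ‖t‖ * ‖q‖ * ‖Z‖ < 1) :
    DifferentiableAt ℂ (fun Y => (f (t⁻¹, Y) + f (Y, t⁻¹)) * core1Red' q t Y) Z := by
  have hR := inv_lt_of_one_lt_mul hσ0 h1 h2
  have ht1 : 1 < ‖t‖ := by nlinarith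
  have hZ0 : 0 < ‖Z‖ := by linarith
  have hZR : ‖Z‖ < R := by nlinarith
  obtain ⟨i1, i2⟩ := norm_inv_mem_of_norm ht1 h2
  have a1 : DifferentiableAt ℂ (fun Y => f (t⁻¹, Y)) Z := hf.comp (by fun_prop) (by fun_prop)
    i1 (by linarith) (by linarith) (by linarith)
  have a2 : DifferentiableAt ℂ (fun Y => f (Y, t⁻¹)) Z := hf.comp (by fun_prop) (by fun_prop)
    (by linarith) (by linarith) i1 (by linarith)
  have htq : 0 ≤ ‖t‖ * ‖q‖ := by positivity
  refine (a1.add a2).mul (differentiableAt_core1Red' hq (norm_pos_iff.1 hZ0) (fun h => ?_) ?_ ?_)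
  · have : ‖t‖ * ‖Z‖ = 1 := by rw [← norm_mul, h, norm_one]
    nlinarith
  · rw [norm_mul, norm_mul]
    nlinarith
  · rw [norm_mul, norm_mul, norm_mul, norm_inv, norm_pow, ← div_eq_mul_inv, ← mul_div_assoc,
      div_lt_one hZ0]
    nlinarith

lemma range_of_norm_le_one {Z : ℂ} (h2 : ‖t‖ < R) (h3 : ‖t‖ * ‖q‖ < 1) (hZ : ‖Z‖ ≤ 1) :
    ‖t‖ * ‖Z‖ < R ∧ ‖t‖ * ‖q‖ * ‖Z‖ < 1 := by
  have h1 := norm_nonneg t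
  have h4 : 0 ≤ ‖t‖ * ‖q‖ := by positivity
  constructor <;> nlinarith

lemma lineAvg1_one_eq_add (hq : ‖q‖ < 1) (hf : HolomorphicOnAnnuli R f)
    (hσ0 : 0 < σ) (h1 : 1 < ‖t‖ * σ) (h2 : ‖t‖ < R) (h3 : ‖t‖ * ‖q‖ < σ)
    (h4 : σ < ‖t‖ ^ 2 * ‖q‖) (h5 : ‖t‖ ^ 2 * ‖q‖ < 1) :
    lineAvg1 f q 1 t = lineAvg1 f q σ t +
      (f (t⁻¹, t ^ 2 * q) + f (t ^ 2 * q, t⁻¹)) * core1Red' q t (t ^ 2 * q) := by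
  unfold lineAvg1
  simp_rw [core1_eq_core1Red'_div hq, ← mul_div_assoc]
  have hn : ‖t ^ 2 * q‖ = ‖t‖ ^ 2 * ‖q‖ := by rw [norm_mul, norm_pow]
  exact circleAverage_div_one_sub_mul_inv
    (g := fun Y => (f (t⁻¹, Y) + f (Y, t⁻¹)) * core1Red' q t Y) hσ0 (by linarith) (by linarith)
    fun Z hZ1 hZ2 =>
      have hZ := range_of_norm_le_one (q := q) h2 (by linarith) hZ2
      differentiableAt_core1Red'_mul hq hf hσ0 (h4.trans h5) h1 h2 h3 hZ1 hZ.1 hZ.2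

lemma lineAvg1_one_eq (hq : ‖q‖ < 1) (hf : HolomorphicOnAnnuli R f)
    (hσ0 : 0 < σ) (hσ1 : σ < 1) (h1 : 1 < ‖t‖ * σ) (h2 : ‖t‖ < R) (h3 : ‖t‖ * ‖q‖ < σ)
    (h4 : 1 < ‖t‖ ^ 2 * ‖q‖) : lineAvg1 f q 1 t = lineAvg1 f q σ t := by
  unfold lineAvg1
  simp_rw [core1_eq_core1Red'_div hq, ← mul_div_assoc]
  refine (circleAverage_eq_of_differentiableAt hσ0 hσ1.le fun Z hZ1 hZ2 => ?_).symm
  have hZ0 : 0 < ‖Z‖ := by linarith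
  have hZ : Z ≠ 0 := norm_pos_iff.1 hZ0
  have hZr := range_of_norm_le_one (q := q) h2 (by linarith) hZ2
  refine DifferentiableAt.fun_div
    (differentiableAt_core1Red'_mul hq hf hσ0 hσ1 h1 h2 h3 hZ1 hZr.1 hZr.2)
    (by fun_prop (disch := assumption)) fun h => ?_
  have : ‖t ^ 2 * q * Z⁻¹‖ = 1 := by rw [← sub_eq_zero.1 h, norm_one]
  rw [norm_mul, norm_mul, norm_inv, norm_pow, ← div_eq_mul_inv, div_eq_iff hZ0.ne'] at this
  linarith

/-- The second integrand is regular for `σ ≤ |Z|`, up to `|Z| = 1` and slightly beyond, but for its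
pole `(t² q)⁻¹`. -/
lemma differentiableAt_core2Red_mul (hq : ‖q‖ < 1) (hf : HolomorphicOnAnnuli R f)
    (hσ0 : 0 < σ) (hσ1 : σ < 1) (h1 : 1 < ‖t‖ * σ) (h2 : ‖t‖ < R) (h3 : ‖t‖ * ‖q‖ < σ) {Z : ℂ}
    (hZ1 : σ ≤ ‖Z‖) (hZ2 : ‖t‖ * ‖Z‖ < R) (hZ3 : ‖t‖ * ‖q‖ * ‖Z‖ < 1) :
    DifferentiableAt ℂ (fun Y => f (t⁻¹ * Y⁻¹, Y) * core2Red q t Y) Z := by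
  have hR := inv_lt_of_one_lt_mul hσ0 h1 h2
  have ht1 : 1 < ‖t‖ := by nlinarith
  have hZ0 : 0 < ‖Z‖ := by linarith
  have hZ : Z ≠ 0 := norm_pos_iff.1 hZ0
  have hZR : ‖Z‖ < R := by nlinarith
  have htZ : 1 < ‖t * Z‖ := by rw [norm_mul]; nlinarith
  have htZ' : ‖t * Z‖ < R := by rwa [norm_mul]
  obtain ⟨i1, i2⟩ := norm_inv_mem_of_norm htZ htZ'
  rw [mul_inv] at i1 i2
  have a1 : DifferentiableAt ℂ (fun Y => f (t⁻¹ * Y⁻¹, Y)) Z :=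
    hf.comp (by fun_prop (disch := assumption)) (by fun_prop)
    i1 (by linarith) (by linarith) (by linarith)
  have htq : 0 ≤ ‖t‖ * ‖q‖ := by positivity
  refine a1.mul (differentiableAt_core2Red hq hZ ?_ ?_)
  · rw [norm_mul, norm_mul, norm_inv, ← div_eq_mul_inv, div_lt_one hZ0]
    linarith
  · rw [norm_mul, norm_mul, norm_mul, norm_pow, show ‖q‖ * (‖t‖ ^ 2 * ‖q‖ * ‖Z‖) =
      (‖t‖ * ‖q‖) * (‖t‖ * ‖q‖ * ‖Z‖) by ring]
    nlinarith

lemma lineAvg2_eq_one (hq : ‖q‖ < 1) (hf : HolomorphicOnAnnuli R f)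
    (hσ0 : 0 < σ) (hσ1 : σ < 1) (h1 : 1 < ‖t‖ * σ) (h2 : ‖t‖ < R) (h3 : ‖t‖ * ‖q‖ < σ)
    (h4 : ‖t‖ ^ 2 * ‖q‖ < 1) : lineAvg2 f q σ t = lineAvg2 f q 1 t := by
  unfold lineAvg2
  simp_rw [core2_eq_core2Red_div hq, ← mul_div_assoc]
  refine circleAverage_eq_of_differentiableAt hσ0 hσ1.le fun Z hZ1 hZ2 => ?_
  have hZr := range_of_norm_le_one (q := q) h2 (by linarith) hZ2
  refine DifferentiableAt.fun_div
    (differentiableAt_core2Red_mul hq hf hσ0 hσ1 h1 h2 h3 hZ1 hZr.1 hZr.2)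
    (by fun_prop) fun h => ?_
  have : ‖t ^ 2 * q * Z‖ = 1 := by rw [← sub_eq_zero.1 h, norm_one]
  rw [norm_mul, norm_mul, norm_pow] at this
  have : 0 ≤ ‖t‖ ^ 2 * ‖q‖ := by positivity
  nlinarith

lemma lineAvg2_eq_one_add (hq0 : q ≠ 0) (hq : ‖q‖ < 1) (hf : HolomorphicOnAnnuli R f)
    (hσ0 : 0 < σ) (hσ1 : σ < 1) (h1 : 1 < ‖t‖ * σ) (h2 : ‖t‖ < R) (h3 : ‖t‖ * ‖q‖ < σ)
    (h4 : 1 < ‖t‖ ^ 2 * ‖q‖) (h5 : ‖t‖ ^ 2 * ‖q‖ * σ < 1) :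
    lineAvg2 f q σ t = lineAvg2 f q 1 t +
      f (t * q, (t ^ 2)⁻¹ * q⁻¹) * core2Red q t (t ^ 2 * q)⁻¹ := by
  unfold lineAvg2
  simp_rw [core2_eq_core2Red_div hq, ← mul_div_assoc]
  have ht : t ≠ 0 := norm_pos_iff.1 (by nlinarith)
  have hn : ‖t ^ 2 * q‖ = ‖t‖ ^ 2 * ‖q‖ := by rw [norm_mul, norm_pow]
  have e : t⁻¹ * (t ^ 2 * q)⁻¹⁻¹ = t * q := by field_simp
  rw [circleAverage_div_one_sub_mul (g := fun Y => f (t⁻¹ * Y⁻¹, Y) * core2Red q t Y) (ρ₂ := 1)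
    hσ0 (by rw [hn]; linarith) (by rw [hn]; linarith)
    fun Z hZ1 hZ2 =>
      have hZ := range_of_norm_le_one (q := q) h2 (by linarith) hZ2
      differentiableAt_core2Red_mul hq hf hσ0 hσ1 h1 h2 h3 hZ1 hZ.1 hZ.2, e, mul_inv]

end Shift

/-! ### The constant term for `|t| > 1` -/

section Formulas

variable (f : ℂ × ℂ → ℂ) (q : ℂ)

/-- The formula for the constant term in the range `1 < |t|`, `|t|² |q| < 1`. -/
noncomputable def ctNear (t : ℂ) : ℂ :=
  torusAvg f q 1 t + lineAvg f q 1 t + rho q t * f (t⁻¹, t⁻¹)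

/-- The formula for the constant term close to the circle `|t|² |q| = 1`, with the one-dimensional
integrals over `|Y| = σ`, where `σ < 1`: there the integrands have no poles. -/
noncomputable def ctMid (σ : ℝ) (t : ℂ) : ℂ :=
  torusAvg f q 1 t + lineAvg f q σ t +
    rho q t * (f (t⁻¹, t⁻¹) + varpi2 q t 1 1 * (f (t ^ 2 * q, t⁻¹) + f (t⁻¹, t ^ 2 * q)))

/-- The formula for the constant term in the range `1 < |t|² |q|`, `|t| |q| < 1`. -/
noncomputable def ctFar (t : ℂ) : ℂ :=
  torusAvg f q 1 t + lineAvg f q 1 t +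
    rho q t * (f (t⁻¹, t⁻¹) + varpi1 q t 1 1 * f (t * q, (t ^ 2)⁻¹ * q⁻¹) +
      varpi2 q t 1 1 * (f (t ^ 2 * q, t⁻¹) + f (t⁻¹, t ^ 2 * q)))

/-- The continued constant term: the average of `f μ` over `|X| = |Y| = ρ` for `|t| ≤ 1`, and the
formulas with residues beyond. For `ρ < 1` close to `1` the average is analytic in a neighbourhood
of the disc `|t| ≤ 1`, and for `|t| < 1` it does not depend on `ρ`. -/
noncomputable def ctCont (ρ σ : ℝ) (t : ℂ) : ℂ :=
  open Classical in
  if ‖t‖ ≤ 1 then torusAvg f q ρ t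
  else if ‖t‖ ^ 2 * ‖q‖ < 1 then ctNear f q t
  else if ‖t‖ ^ 2 * ‖q‖ = 1 then ctMid f q σ t
  else ctFar f q t

end Formulas

section Agreement

variable {f : ℂ × ℂ → ℂ} {q t : ℂ} {R σ : ℝ}

/-- For `|t|² |q| < 1`, only the pole `t² q` of `ζ¹₀` lies between `|Y| = σ` and `|Y| = 1`. -/
lemma ctNear_eq_ctMid (hq0 : q ≠ 0) (hq : ‖q‖ < 1) (hf : HolomorphicOnAnnuli R f)
    (hσ0 : 0 < σ) (h1 : 1 < ‖t‖ * σ) (h2 : ‖t‖ < R) (h3 : ‖t‖ * ‖q‖ < σ)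
    (h4 : σ < ‖t‖ ^ 2 * ‖q‖) (h5 : ‖t‖ ^ 2 * ‖q‖ < 1) : ctNear f q t = ctMid f q σ t := by
  have ht : t ≠ 0 := norm_pos_iff.1 (by nlinarith)
  have hσ1 := h4.trans h5
  have hr := residue_zeta1 hq0 hq ht (by rw [norm_mul]; linarith)
  rw [ctNear, ctMid, lineAvg, lineAvg, lineAvg1_one_eq_add hq hf hσ0 h1 h2 h3 h4 h5,
    lineAvg2_eq_one hq hf hσ0 hσ1 h1 h2 h3 h5]
  linear_combination (f (t⁻¹, t ^ 2 * q) + f (t ^ 2 * q, t⁻¹)) * hr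

/-- For `|t|² |q| > 1`, only the pole `(t² q)⁻¹` of `ζ²₀` lies between `|Y| = σ` and `|Y| = 1`. -/
lemma ctFar_eq_ctMid (hq0 : q ≠ 0) (hq : ‖q‖ < 1) (hf : HolomorphicOnAnnuli R f)
    (hσ0 : 0 < σ) (hσ1 : σ < 1) (h1 : 1 < ‖t‖ * σ) (h2 : ‖t‖ < R) (h3 : ‖t‖ * ‖q‖ < σ)
    (h4 : 1 < ‖t‖ ^ 2 * ‖q‖) (h5 : ‖t‖ ^ 2 * ‖q‖ * σ < 1) : ctFar f q t = ctMid f q σ t := by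
  have ht1 : 1 < ‖t‖ := by nlinarith
  have ht : t ≠ 0 := norm_pos_iff.1 (by nlinarith)
  have hr := residue_zeta2 hq0 hq ht (by rw [norm_mul]; linarith) fun h => by
    have : ‖t‖ ^ 3 * ‖q‖ = 1 := by rw [← norm_pow, ← norm_mul, h, norm_one]
    nlinarith
  rw [ctFar, ctMid, lineAvg, lineAvg, lineAvg1_one_eq hq hf hσ0 hσ1 h1 h2 h3 h4,
    lineAvg2_eq_one_add hq0 hq hf hσ0 hσ1 h1 h2 h3 h4 h5]
  linear_combination -(f (t * q, (t ^ 2)⁻¹ * q⁻¹)) * hr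

end Agreement

/-! ### Regularity of the continued constant term -/

section Analytic

variable {f : ℂ × ℂ → ℂ} {q t : ℂ} {R σ ρ : ℝ}

lemma analyticAt_of_differentiableAt_of_isOpen {g : ℂ → ℂ} {U : Set ℂ} (hU : IsOpen U)
    (hg : ∀ z ∈ U, DifferentiableAt ℂ g z) {z : ℂ} (hz : z ∈ U) : AnalyticAt ℂ g z :=
  DifferentiableOn.analyticAt (fun z hz => (hg z hz).differentiableWithinAt) (hU.mem_nhds hz)

lemma analyticAt_torusAvg (hq : ‖q‖ < 1) (hf : HolomorphicOnAnnuli R f) (hρ0 : 0 < ρ)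
    (hρ1 : ρ ≤ 1) (hR1 : 1 < R) (hR : R⁻¹ < ρ) (h1 : ‖t‖ * ρ < 1) (h2 : ‖t‖ * ‖q‖ < ρ ^ 2) :
    AnalyticAt ℂ (torusAvg f q ρ) t := by
  have hU : IsOpen {t : ℂ | ‖t‖ * ρ < 1 ∧ ‖t‖ * ‖q‖ < ρ ^ 2} := by
    refine IsOpen.and (isOpen_lt ?_ ?_) (isOpen_lt ?_ ?_) <;> fun_prop
  refine DifferentiableOn.analyticAt ?_ (hU.mem_nhds ⟨h1, h2⟩)
  refine differentiableOn_circleAverage_circleAverage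
    (F := fun p : ℂ × ℂ × ℂ => f (p.2.1, p.2.2) * mu q p.1 p.2.1 p.2.2) hU hρ0.le hρ0.le ?_
  rintro t ⟨h1, h2⟩ X Y hX hY
  have h3 : ‖t‖ * (ρ * ρ) < 1 := by nlinarith [norm_nonneg t, mul_nonneg (norm_nonneg t) hρ0.le]
  refine differentiableAt_torus hq hf hR1 ?_ ?_ ?_ ?_ ?_ ?_ ?_ ?_ <;> simp only [hX, hY] <;> grind

lemma analyticAt_torusAvg_one (hq : ‖q‖ < 1) (hf : HolomorphicOnAnnuli R f) (hR1 : 1 < R)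
    (h1 : 1 < ‖t‖) (h2 : ‖t‖ * ‖q‖ < 1) : AnalyticAt ℂ (torusAvg f q 1) t := by
  have hU : IsOpen {t : ℂ | 1 < ‖t‖ ∧ ‖t‖ * ‖q‖ < 1} := by
    refine IsOpen.and (isOpen_lt ?_ ?_) (isOpen_lt ?_ ?_) <;> fun_prop
  have hR2 : R⁻¹ < 1 := inv_lt_one_of_one_lt₀ hR1
  refine DifferentiableOn.analyticAt ?_ (hU.mem_nhds ⟨h1, h2⟩)
  refine differentiableOn_circleAverage_circleAverage
    (F := fun p : ℂ × ℂ × ℂ => f (p.2.1, p.2.2) * mu q p.1 p.2.1 p.2.2) hU zero_le_one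
    zero_le_one ?_
  rintro t ⟨h1, h2⟩ X Y hX hY
  refine differentiableAt_torus hq hf hR1 ?_ ?_ ?_ ?_ ?_ ?_ ?_ ?_ <;> simp only [hX, hY] <;> grind

/-- A range of parameters, for `σ ≤ 1`, in which the one-dimensional integrands have no poles on
`|Y| = σ`. -/
structure RegularLine (q : ℂ) (R σ : ℝ) (t : ℂ) : Prop where
  one_lt : 1 < ‖t‖ * σ
  lt_radius : ‖t‖ < R
  lt : ‖t‖ * ‖q‖ < σ
  ne : ‖t‖ ^ 2 * ‖q‖ ≠ σ
  ne' : ‖t‖ ^ 2 * ‖q‖ * σ ≠ 1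

lemma isOpen_regularLine : IsOpen {t : ℂ | RegularLine q R σ t} := by
  have : {t : ℂ | RegularLine q R σ t} = {t : ℂ | 1 < ‖t‖ * σ} ∩ {t : ℂ | ‖t‖ < R} ∩
      {t : ℂ | ‖t‖ * ‖q‖ < σ} ∩ {t : ℂ | ‖t‖ ^ 2 * ‖q‖ ≠ σ} ∩
      {t : ℂ | ‖t‖ ^ 2 * ‖q‖ * σ ≠ 1} := by
    ext t
    exact ⟨fun h => ⟨⟨⟨⟨h.1, h.2⟩, h.3⟩, h.4⟩, h.5⟩, fun h => ⟨h.1.1.1.1, h.1.1.1.2, h.1.1.2,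
      h.1.2, h.2⟩⟩
  rw [this]
  refine ((((isOpen_lt ?_ ?_).inter (isOpen_lt ?_ ?_)).inter (isOpen_lt ?_ ?_)).inter
    (isOpen_ne_fun ?_ ?_)).inter (isOpen_ne_fun ?_ ?_) <;> fun_prop

lemma RegularLine.analyticAt_lineAvg1 (h : RegularLine q R σ t) (hq : ‖q‖ < 1)
    (hf : HolomorphicOnAnnuli R f) (hσ0 : 0 < σ) (hσ1 : σ ≤ 1) :
    AnalyticAt ℂ (lineAvg1 f q σ) t := by
  refine DifferentiableOn.analyticAt ?_ (isOpen_regularLine.mem_nhds h)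
  refine differentiableOn_circleAverage_of_prod
    (F := fun p : ℂ × ℂ => (f (p.1⁻¹, p.2) + f (p.2, p.1⁻¹)) * core1 q p.1 p.2)
    isOpen_regularLine hσ0.le ?_
  rintro t ⟨h1, h2, h3, h4, h5⟩ Z hZ
  have ht1 : 1 < ‖t‖ := by nlinarith
  have htq : 0 ≤ ‖t‖ * ‖q‖ := by positivity
  refine differentiableAt_integrand1 hq hf ht1 h2 ?_ (by linarith) (fun h => ?_) (by nlinarith)
    (fun h => h4 ?_) (by nlinarith)
  · rw [hZ]
    exact inv_lt_of_one_lt_mul hσ0 h1 h2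
  · rw [← hZ, ← norm_mul, h, norm_one] at h1
    exact lt_irrefl _ h1
  · have : ‖t ^ 2 * q * Z⁻¹‖ = 1 := by rw [h, norm_one]
    rw [norm_mul, norm_mul, norm_inv, norm_pow, ← div_eq_mul_inv, hZ, div_eq_one_iff_eq hσ0.ne']
      at this
    exact this

lemma RegularLine.analyticAt_lineAvg2 (h : RegularLine q R σ t) (hq : ‖q‖ < 1)
    (hf : HolomorphicOnAnnuli R f) (hσ0 : 0 < σ) (hσ1 : σ ≤ 1) :
    AnalyticAt ℂ (lineAvg2 f q σ) t := by
  refine DifferentiableOn.analyticAt ?_ (isOpen_regularLine.mem_nhds h)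
  refine differentiableOn_circleAverage_of_prod
    (F := fun p : ℂ × ℂ => f (p.1⁻¹ * p.2⁻¹, p.2) * core2 q p.1 p.2)
    isOpen_regularLine hσ0.le ?_
  rintro t ⟨h1, h2, h3, h4, h5⟩ Z hZ
  have ht1 : 1 < ‖t‖ := by nlinarith
  have htq : 0 ≤ ‖t‖ * ‖q‖ := by positivity
  have htZ : 1 < ‖t * Z‖ := by rw [norm_mul, hZ]; linarith
  have htZ' : ‖t * Z‖ < R := by rw [norm_mul, hZ]; nlinarith
  obtain ⟨i1, i2⟩ := norm_inv_mem_of_norm htZ htZ'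
  rw [mul_inv] at i1 i2
  refine differentiableAt_integrand2 hq hf (norm_pos_iff.1 (by linarith)) i1 (by linarith)
    (norm_pos_iff.1 (by linarith)) ?_ (by linarith) (by linarith) (fun h => h5 ?_) ?_
  · rw [hZ]
    exact inv_lt_of_one_lt_mul hσ0 h1 h2
  · rw [← hZ, ← norm_pow, ← norm_mul, ← norm_mul, h, norm_one]
  · rw [hZ]
    nlinarith

lemma meromorphicAt_rho0 (hq : ‖q‖ < 1) (ht : t ≠ 0) : MeromorphicAt (rho0 q) t := by
  have hp := differentiable_poch hq
  have hU : IsOpen {t : ℂ | t ≠ 0} := isOpen_ne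
  have h1 : AnalyticAt ℂ (fun t => poch q t⁻¹ * poch q (t * q)) t :=
    analyticAt_of_differentiableAt_of_isOpen hU (fun z (hz : z ≠ 0) => by
      generalize poch q = p at *
      fun_prop (disch := assumption)) ht
  have h2 : AnalyticAt ℂ (fun t => poch q q * poch q (t ^ 2 * q)) t :=
    analyticAt_of_differentiableAt_of_isOpen hU (fun z (hz : z ≠ 0) => by
      generalize poch q = p at *
      fun_prop (disch := assumption)) ht
  exact h1.meromorphicAt.div h2.meromorphicAt

lemma analyticAt_rho0 (hq : ‖q‖ < 1) (ht : t ≠ 0) (h : poch q (t ^ 2 * q) ≠ 0) :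
    AnalyticAt ℂ (rho0 q) t := by
  have hp := differentiable_poch hq
  have hpq := poch_ne_zero_of_norm_lt hq hq
  have hU : IsOpen {t : ℂ | t ≠ 0} := isOpen_ne
  have h1 : AnalyticAt ℂ (fun t => poch q t⁻¹ * poch q (t * q)) t :=
    analyticAt_of_differentiableAt_of_isOpen hU (fun z (hz : z ≠ 0) => by
      generalize poch q = p at *
      fun_prop (disch := assumption)) ht
  have h2 : AnalyticAt ℂ (fun t => poch q q * poch q (t ^ 2 * q)) t :=
    analyticAt_of_differentiableAt_of_isOpen hU (fun z (hz : z ≠ 0) => by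
      generalize poch q = p at *
      fun_prop (disch := assumption)) ht
  exact h1.div h2 (mul_ne_zero hpq h)

/-- `ϱ` as a quotient of functions analytic for `t ≠ 0`. -/
lemma rho_eq_div (hq : ‖q‖ < 1) (ht : t ≠ 0) : ∃ N D : ℂ → ℂ, AnalyticAt ℂ N t ∧ AnalyticAt ℂ D t ∧
    rho q = N / D ∧ ∀ s, D s = poch q q ^ 2 * poch q (s ^ 2 * q) * poch q (s ^ 3 * q) := by
  have hp := differentiable_poch hq
  have hU : IsOpen {t : ℂ | t ≠ 0} := isOpen_ne
  refine ⟨fun t => poch q t⁻¹ * poch q (t * q) ^ 2 * poch q (t ^ 2)⁻¹,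
    fun s => poch q q ^ 2 * poch q (s ^ 2 * q) * poch q (s ^ 3 * q),
    analyticAt_of_differentiableAt_of_isOpen hU (fun z (hz : z ≠ 0) => ?_) ht,
    analyticAt_of_differentiableAt_of_isOpen hU (fun z (hz : z ≠ 0) => ?_) ht, rfl, fun _ => rfl⟩
  · have hz2 := pow_ne_zero 2 hz
    generalize poch q = p at *
    fun_prop (disch := assumption)
  · generalize poch q = p at *
    fun_prop (disch := assumption)

lemma meromorphicAt_rho (hq : ‖q‖ < 1) (ht : t ≠ 0) : MeromorphicAt (rho q) t := by
  obtain ⟨N, D, hN, hD, e, -⟩ := rho_eq_div hq ht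
  rw [e]
  exact hN.meromorphicAt.div hD.meromorphicAt

lemma analyticAt_rho (hq : ‖q‖ < 1) (ht : t ≠ 0) (h2 : poch q (t ^ 2 * q) ≠ 0)
    (h3 : poch q (t ^ 3 * q) ≠ 0) : AnalyticAt ℂ (rho q) t := by
  obtain ⟨N, D, hN, hD, e, hD0⟩ := rho_eq_div hq ht
  rw [e]
  refine hN.div hD ?_
  rw [hD0]
  exact mul_ne_zero (mul_ne_zero (pow_ne_zero 2 (poch_ne_zero_of_norm_lt hq hq)) h2) h3

lemma RegularLine.meromorphicAt_lineAvg (h : RegularLine q R σ t) (hq : ‖q‖ < 1)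
    (hf : HolomorphicOnAnnuli R f) (hσ0 : 0 < σ) (hσ1 : σ ≤ 1) :
    MeromorphicAt (lineAvg f q σ) t := by
  have ht : t ≠ 0 := norm_pos_iff.1 (by have := h.one_lt; nlinarith)
  have h0 := meromorphicAt_rho0 hq ht
  have h1 := (h.analyticAt_lineAvg1 hq hf hσ0 hσ1).meromorphicAt
  have h2 := (h.analyticAt_lineAvg2 hq hf hσ0 hσ1).meromorphicAt
  have h3 : MeromorphicAt (fun t : ℂ => t⁻¹) t := (MeromorphicAt.id t).inv
  exact (h0.mul h1).add ((h0.mul h3).mul h2)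

lemma RegularLine.analyticAt_lineAvg (h : RegularLine q R σ t) (hq : ‖q‖ < 1)
    (hf : HolomorphicOnAnnuli R f) (hσ0 : 0 < σ) (hσ1 : σ ≤ 1) (hp : poch q (t ^ 2 * q) ≠ 0) :
    AnalyticAt ℂ (lineAvg f q σ) t := by
  have ht : t ≠ 0 := norm_pos_iff.1 (by have := h.one_lt; nlinarith)
  have h0 := analyticAt_rho0 hq ht hp
  have h1 := h.analyticAt_lineAvg1 hq hf hσ0 hσ1
  have h2 := h.analyticAt_lineAvg2 hq hf hσ0 hσ1
  have h3 : AnalyticAt ℂ (fun t : ℂ => t⁻¹) t := analyticAt_id.inv ht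
  exact (h0.mul h1).add ((h0.mul h3).mul h2)

/-- The value of `f` at a point depending analytically on `t`. -/
lemma HolomorphicOnAnnuli.analyticAt_comp (hf : HolomorphicOnAnnuli R f) {g h : ℂ → ℂ}
    (hg : AnalyticAt ℂ g t) (hh : AnalyticAt ℂ h t)
    (h1 : R⁻¹ < ‖g t‖) (h2 : ‖g t‖ < R) (h3 : R⁻¹ < ‖h t‖) (h4 : ‖h t‖ < R) :
    AnalyticAt ℂ (fun t => f (g t, h t)) t := by
  rw [analyticAt_iff_eventually_differentiableAt]
  have cg := hg.continuousAt.norm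
  have ch := hh.continuousAt.norm
  filter_upwards [hg.eventually_analyticAt, hh.eventually_analyticAt, cg.eventually_const_lt h1,
    cg.eventually_lt_const h2, ch.eventually_const_lt h3, ch.eventually_lt_const h4]
    with s s1 s2 s3 s4 s5 s6
  exact hf.comp s1.differentiableAt s2.differentiableAt s3 s4 s5 s6

end Analytic

/-! ### The meromorphic continuation of the constant term -/

section Continuation

variable {f : ℂ × ℂ → ℂ} {q t : ℂ} {R σ ρ : ℝ}

lemma varpi1_one_one (q t : ℂ) :
    varpi1 q t 1 1 = t⁻¹ * ((1 - t ^ 3 * q) / (1 - t * q)) := by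
  have e : (3 : ℤ) - 2 * ((1 : ℕ) + (1 : ℕ) : ℤ) = -1 := by norm_num
  rw [varpi1, e, zpow_neg_one]
  simp

lemma varpi2_one_one (q t : ℂ) : varpi2 q t 1 1 = 1 := by
  simp [varpi2]

/-- For `|t| < 1` the contours can be moved freely between `ρ` and `1`. -/
lemma torusAvg_eq_torusAvg_one (hq : ‖q‖ < 1) (hf : HolomorphicOnAnnuli R f) (hρ0 : 0 < ρ)
    (hρ1 : ρ < 1) (hR1 : 1 < R) (hR : R⁻¹ < ρ) (hqρ : ‖q‖ ≤ ρ ^ 4) (ht : ‖t‖ < 1) :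
    torusAvg f q ρ t = torusAvg f q 1 t := by
  have hρ2 : ρ ^ 4 < ρ ^ 2 := pow_lt_pow_right_of_lt_one₀ hρ0 hρ1 (by norm_num)
  refine circleAverage_circleAverage_eq (F := fun X Y => f (X, Y) * mu q t X Y) (r := ρ) (s := 1)
    hρ0 (fun X Y h1 h2 h3 h4 => ?_) le_rfl hρ1.le le_rfl hρ1.le hρ1.le le_rfl hρ1.le le_rfl
  have ht0 := norm_nonneg t
  have hXY : ρ ^ 2 ≤ ‖X‖ * ‖Y‖ := by nlinarith
  have hXY' : ‖X‖ * ‖Y‖ ≤ 1 := by nlinarith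
  have htq : ‖t‖ * ‖q‖ ≤ ‖q‖ := by nlinarith [norm_nonneg q]
  have := differentiableAt_torus (t := t) (X := X) (Y := Y) hq hf hR1 (by linarith) h2
    (by linarith) h4 (by linarith) (by nlinarith) (by nlinarith) (by nlinarith)
  exact DifferentiableAt.comp (X, Y)
    (g := fun p : ℂ × ℂ × ℂ => f (p.2.1, p.2.2) * mu q p.1 p.2.1 p.2.2)
    (f := fun p : ℂ × ℂ => (t, p.1, p.2)) this (by fun_prop)

lemma ctCont_eventuallyEq_torusAvg (hq : ‖q‖ < 1) (hf : HolomorphicOnAnnuli R f) (hρ0 : 0 < ρ)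
    (hρ1 : ρ < 1) (hR1 : 1 < R) (hR : R⁻¹ < ρ) (hqρ : ‖q‖ ≤ ρ ^ 4) (ht : ‖t‖ ≤ 1) :
    ctCont f q ρ σ =ᶠ[𝓝 t] torusAvg f q ρ := by
  have hU : IsOpen {t : ℂ | ‖t‖ * ρ < 1} := isOpen_lt (by fun_prop) (by fun_prop)
  filter_upwards [hU.mem_nhds (show ‖t‖ * ρ < 1 by nlinarith)] with s (hs : ‖s‖ * ρ < 1)
  by_cases hs1 : ‖s‖ ≤ 1
  · simp only [ctCont, hs1, if_true]
  have h1 : 1 < ‖s‖ := not_le.1 hs1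
  have hρ2 : 0 < ρ ^ 2 := by positivity
  have hsρ : (‖s‖ * ρ) ^ 2 < 1 := by nlinarith [mul_nonneg (norm_nonneg s) hρ0.le]
  have h2 : ‖s‖ ^ 2 * ‖q‖ < ρ ^ 2 :=
    calc ‖s‖ ^ 2 * ‖q‖ ≤ ‖s‖ ^ 2 * ρ ^ 4 := by gcongr
      _ = (‖s‖ * ρ) ^ 2 * ρ ^ 2 := by ring
      _ < ρ ^ 2 := by nlinarith
  have h3 : ‖s‖ * ‖q‖ ≤ ‖s‖ ^ 2 * ‖q‖ := by
    have := norm_nonneg q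
    gcongr
    nlinarith
  have h4 : ‖s‖ ^ 2 * ‖q‖ < 1 := by nlinarith
  simp only [ctCont, hs1, if_false, h4, if_true]
  exact (torusAvg_eq_add_lineAvg hq hf hρ0 hR hR1 h1 hs (by linarith) (by nlinarith)).symm

lemma ctCont_eventuallyEq_ctNear (h1 : 1 < ‖t‖) (h2 : ‖t‖ ^ 2 * ‖q‖ < 1) :
    ctCont f q ρ σ =ᶠ[𝓝 t] ctNear f q := by
  have hU : IsOpen {t : ℂ | 1 < ‖t‖ ∧ ‖t‖ ^ 2 * ‖q‖ < 1} := by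
    refine IsOpen.and (isOpen_lt ?_ ?_) (isOpen_lt ?_ ?_) <;> fun_prop
  filter_upwards [hU.mem_nhds ⟨h1, h2⟩] with s hs
  simp only [ctCont, not_le.2 hs.1, if_false, hs.2, if_true]

lemma one_lt_norm_of_one_le (hq : ‖q‖ < 1) (h : 1 ≤ ‖t‖ ^ 2 * ‖q‖) : 1 < ‖t‖ := by
  by_contra! h1
  have : ‖t‖ ^ 2 ≤ 1 := pow_le_one₀ (norm_nonneg t) h1
  nlinarith [norm_nonneg q]

lemma ctCont_eventuallyEq_ctFar (hq : ‖q‖ < 1) (h2 : 1 < ‖t‖ ^ 2 * ‖q‖) :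
    ctCont f q ρ σ =ᶠ[𝓝 t] ctFar f q := by
  have hU : IsOpen {t : ℂ | 1 < ‖t‖ ^ 2 * ‖q‖} := isOpen_lt (by fun_prop) (by fun_prop)
  filter_upwards [hU.mem_nhds h2] with s (hs : 1 < ‖s‖ ^ 2 * ‖q‖)
  have h1 := one_lt_norm_of_one_le hq hs.le
  simp only [ctCont, not_le.2 h1, not_lt.2 hs.le, hs.ne', if_false]

/-- Near the circle `|t|² |q| = 1` the three formulas agree. The other two conclusions put `t` in
the range where `ctMid` is regular. -/
lemma ctCont_eventuallyEq_ctMid (hq0 : q ≠ 0) (hq : ‖q‖ < 1) (hf : HolomorphicOnAnnuli R f)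
    (hσ0 : 0 < σ) (hσ1 : σ < 1) (hσ : ‖q‖ < σ ^ 2) (h1 : ‖t‖ < R) (h2 : ‖t‖ ^ 2 * ‖q‖ = 1) :
    ctCont f q ρ σ =ᶠ[𝓝 t] ctMid f q σ ∧ 1 < ‖t‖ * σ ∧ ‖t‖ * ‖q‖ < σ := by
  have hq0' : 0 < ‖q‖ := norm_pos_iff.2 hq0
  have a1 : 1 < ‖t‖ * σ := by
    by_contra! h
    have := norm_nonneg t
    have : (‖t‖ * σ) ^ 2 ≤ 1 := pow_le_one₀ (by positivity) h
    have : 0 < ‖t‖ ^ 2 := by nlinarith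
    nlinarith
  have a2 : ‖t‖ * ‖q‖ < σ := by
    by_contra! h
    have h3 : σ ^ 2 ≤ (‖t‖ * ‖q‖) ^ 2 := by gcongr
    rw [show (‖t‖ * ‖q‖) ^ 2 = (‖t‖ ^ 2 * ‖q‖) * ‖q‖ by ring, h2] at h3
    linarith
  refine ⟨?_, a1, a2⟩
  have hU : IsOpen {t : ℂ | (1 < ‖t‖ * σ ∧ ‖t‖ < R) ∧ ‖t‖ * ‖q‖ < σ ∧ σ < ‖t‖ ^ 2 * ‖q‖ ∧
      ‖t‖ ^ 2 * ‖q‖ * σ < 1} := by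
    refine IsOpen.and (IsOpen.and (isOpen_lt ?_ ?_) (isOpen_lt ?_ ?_))
      (IsOpen.and (isOpen_lt ?_ ?_) (IsOpen.and (isOpen_lt ?_ ?_) (isOpen_lt ?_ ?_))) <;> fun_prop
  filter_upwards [hU.mem_nhds ⟨⟨a1, h1⟩, a2, by rw [h2]; exact hσ1, by rw [h2, one_mul]; exact hσ1⟩]
    with s hs
  obtain ⟨⟨s1, s2⟩, s3, s4, s5⟩ := hs
  have s6 : 1 < ‖s‖ := by nlinarith [norm_nonneg s]
  rcases lt_trichotomy (‖s‖ ^ 2 * ‖q‖) 1 with h | h | h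
  · simp only [ctCont, not_le.2 s6, if_false, h, if_true]
    exact ctNear_eq_ctMid hq0 hq hf hσ0 s1 s2 s3 s4 h
  · simp only [ctCont, not_le.2 s6, if_false, h, lt_irrefl, if_true]
  · simp only [ctCont, not_le.2 s6, if_false, not_lt.2 h.le, h.ne']
    exact ctFar_eq_ctMid hq0 hq hf hσ0 hσ1 s1 s2 s3 h s5

/-- In its range, the only possible singularities of `ctNear` are the zeros of the binomial
`1 - t³ q` of the denominator of `ϱ`. -/
lemma ctNear_regular (hq : ‖q‖ < 1) (hf : HolomorphicOnAnnuli R f) (h1 : 1 < ‖t‖) (h2 : ‖t‖ < R)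
    (h3 : ‖t‖ ^ 2 * ‖q‖ < 1) :
    MeromorphicAt (ctNear f q) t ∧ (t ^ 3 * q ≠ 1 → AnalyticAt ℂ (ctNear f q) t) := by
  have ht : t ≠ 0 := norm_pos_iff.1 (by linarith)
  have hR1 : 1 < R := h1.trans h2
  have hq' := norm_nonneg q
  have htq : ‖t‖ * ‖q‖ < 1 := by nlinarith
  have hti : AnalyticAt ℂ (fun t : ℂ => t⁻¹) t := analyticAt_id.inv ht
  obtain ⟨i1, i2⟩ := norm_inv_mem_of_norm h1 h2
  have hff : AnalyticAt ℂ (fun t => f (t⁻¹, t⁻¹)) t :=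
    hf.analyticAt_comp hti hti i1 (by linarith) i1 (by linarith)
  have hT := analyticAt_torusAvg_one hq hf hR1 h1 htq
  have hL : RegularLine q R 1 t := ⟨by linarith, h2, htq, h3.ne, by rw [mul_one]; exact h3.ne⟩
  refine ⟨(hT.meromorphicAt.add (hL.meromorphicAt_lineAvg hq hf one_pos le_rfl)).add
    ((meromorphicAt_rho hq ht).mul hff.meromorphicAt), fun h => ?_⟩
  have n2 : poch q (t ^ 2 * q) ≠ 0 := poch_ne_zero_of_norm_lt hq (by rwa [norm_mul, norm_pow])
  have n3 : poch q (t ^ 3 * q) ≠ 0 := by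
    refine poch_ne_zero_of_ne_one hq h ?_
    rw [norm_mul, norm_mul, norm_pow, show ‖q‖ * (‖t‖ ^ 3 * ‖q‖) =
      (‖t‖ ^ 2 * ‖q‖) * (‖t‖ * ‖q‖) by ring]
    have : 0 ≤ ‖t‖ * ‖q‖ := by positivity
    nlinarith
  exact (hT.add (hL.analyticAt_lineAvg hq hf one_pos le_rfl n2)).add
    ((analyticAt_rho hq ht n2 n3).mul hff)

/-- On the circle `|t|² |q| = 1`, the only possible singularities of `ctMid` are the zeros of the
binomial `1 - t² q` of the denominators of `ϱ` and `ϱ₀`. -/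
lemma ctMid_regular (hq : ‖q‖ < 1) (hf : HolomorphicOnAnnuli R f)
    (hσ0 : 0 < σ) (hσ1 : σ < 1) (h1 : 1 < ‖t‖ * σ) (h2 : ‖t‖ < R)
    (h3 : ‖t‖ * ‖q‖ < σ) (h4 : ‖t‖ ^ 2 * ‖q‖ = 1) :
    MeromorphicAt (ctMid f q σ) t ∧ (t ^ 2 * q ≠ 1 → AnalyticAt ℂ (ctMid f q σ) t) := by
  have ht1 : 1 < ‖t‖ := by nlinarith
  have ht : t ≠ 0 := norm_pos_iff.1 (by linarith)
  have hR1 : 1 < R := ht1.trans h2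
  have htq : ‖t‖ * ‖q‖ < 1 := by linarith
  have hti : AnalyticAt ℂ (fun t : ℂ => t⁻¹) t := analyticAt_id.inv ht
  have ht2 : AnalyticAt ℂ (fun t : ℂ => t ^ 2 * q) t := (analyticAt_id.pow 2).mul analyticAt_const
  obtain ⟨i1, i2⟩ := norm_inv_mem_of_norm ht1 h2
  have hn : ‖t ^ 2 * q‖ = 1 := by rw [norm_mul, norm_pow, h4]
  have hff : AnalyticAt ℂ (fun t => f (t⁻¹, t⁻¹)) t :=
    hf.analyticAt_comp hti hti i1 (by linarith) i1 (by linarith)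
  have hf1 : AnalyticAt ℂ (fun t => f (t ^ 2 * q, t⁻¹)) t :=
    hf.analyticAt_comp ht2 hti (by linarith) (by linarith) i1 (by linarith)
  have hf2 : AnalyticAt ℂ (fun t => f (t⁻¹, t ^ 2 * q)) t :=
    hf.analyticAt_comp hti ht2 i1 (by linarith) (by linarith) (by linarith)
  have hG := hff.add (hf1.add hf2)
  have hT := analyticAt_torusAvg_one hq hf hR1 ht1 htq
  have hL : RegularLine q R σ t := ⟨h1, h2, h3, by rw [h4]; exact hσ1.ne',
    by rw [h4, one_mul]; exact hσ1.ne⟩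
  have e : ctMid f q σ = fun t => torusAvg f q 1 t + lineAvg f q σ t +
      rho q t * (f (t⁻¹, t⁻¹) + (f (t ^ 2 * q, t⁻¹) + f (t⁻¹, t ^ 2 * q))) := by
    funext t
    rw [ctMid, varpi2_one_one, one_mul]
  rw [e]
  refine ⟨(hT.meromorphicAt.add (hL.meromorphicAt_lineAvg hq hf hσ0 hσ1.le)).add
    ((meromorphicAt_rho hq ht).mul hG.meromorphicAt), fun h => ?_⟩
  have n2 : poch q (t ^ 2 * q) ≠ 0 := poch_ne_zero_of_ne_one hq h (by rw [norm_mul, hn]; linarith)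
  have n3 : poch q (t ^ 3 * q) ≠ 0 := by
    refine poch_ne_zero_of_ne_one hq (fun h' => ?_) ?_
    · have : ‖t ^ 3 * q‖ = 1 := by rw [h', norm_one]
      rw [norm_mul, norm_pow, pow_succ, mul_right_comm, h4, one_mul] at this
      linarith
    · rw [norm_mul, norm_mul, norm_pow, show ‖q‖ * (‖t‖ ^ 3 * ‖q‖) =
        (‖t‖ ^ 2 * ‖q‖) * (‖t‖ * ‖q‖) by ring, h4, one_mul]
      exact htq
  exact (hT.add (hL.analyticAt_lineAvg hq hf hσ0 hσ1.le n2)).add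
    ((analyticAt_rho hq ht n2 n3).mul hG)

/-- In its range, the only possible singularities of `ctFar` are the zeros of the binomial
`1 - t³ q²` of the denominator of `ϱ`. -/
lemma ctFar_regular (hq : ‖q‖ < 1) (hf : HolomorphicOnAnnuli R f) (hRq : R * ‖q‖ ≤ 1)
    (h2 : ‖t‖ < R) (h4 : 1 < ‖t‖ ^ 2 * ‖q‖) :
    MeromorphicAt (ctFar f q) t ∧ (t ^ 3 * q ^ 2 ≠ 1 → AnalyticAt ℂ (ctFar f q) t) := by
  have ht1 : 1 < ‖t‖ := one_lt_norm_of_one_le hq h4.le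
  have ht : t ≠ 0 := norm_pos_iff.1 (by linarith)
  have hR1 : 1 < R := ht1.trans h2
  have hq' : 0 < ‖q‖ := by
    rcases (norm_nonneg q).eq_or_lt with h | h
    · rw [← h] at h4
      linarith
    · exact h
  have hq0 : q ≠ 0 := norm_pos_iff.1 hq'
  have htq : ‖t‖ * ‖q‖ < 1 := by nlinarith
  have hti : AnalyticAt ℂ (fun t : ℂ => t⁻¹) t := analyticAt_id.inv ht
  have ht2 : AnalyticAt ℂ (fun t : ℂ => t ^ 2 * q) t := (analyticAt_id.pow 2).mul analyticAt_const
  have ht3 : AnalyticAt ℂ (fun t : ℂ => t * q) t := analyticAt_id.mul analyticAt_const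
  have ht4 : AnalyticAt ℂ (fun t : ℂ => (t ^ 2)⁻¹ * q⁻¹) t :=
    ((analyticAt_id.pow 2).inv (pow_ne_zero 2 ht)).mul analyticAt_const
  obtain ⟨i1, i2⟩ := norm_inv_mem_of_norm ht1 h2
  have hn : ‖t ^ 2 * q‖ = ‖t‖ ^ 2 * ‖q‖ := by rw [norm_mul, norm_pow]
  have hn' : ‖t ^ 2 * q‖ < R := by rw [hn]; nlinarith
  have hR2 : R⁻¹ < 1 := inv_lt_one_of_one_lt₀ hR1
  obtain ⟨j1, j2⟩ := norm_inv_mem_of_norm (by rw [hn]; exact h4) hn'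
  rw [mul_inv] at j1 j2
  have hm : ‖t * q‖ = ‖t‖ * ‖q‖ := norm_mul _ _
  have hm1 : R⁻¹ < ‖t * q‖ := by
    rw [hm, inv_lt_iff_one_lt_mul₀ (by linarith)]
    nlinarith
  have hff : AnalyticAt ℂ (fun t => f (t⁻¹, t⁻¹)) t :=
    hf.analyticAt_comp hti hti i1 (by linarith) i1 (by linarith)
  have hf1 : AnalyticAt ℂ (fun t => f (t ^ 2 * q, t⁻¹)) t :=
    hf.analyticAt_comp ht2 hti (by linarith) (by linarith) i1 (by linarith)
  have hf2 : AnalyticAt ℂ (fun t => f (t⁻¹, t ^ 2 * q)) t :=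
    hf.analyticAt_comp hti ht2 i1 (by linarith) (by linarith) (by linarith)
  have hf3 : AnalyticAt ℂ (fun t => f (t * q, (t ^ 2)⁻¹ * q⁻¹)) t :=
    hf.analyticAt_comp ht3 ht4 hm1 (by linarith) j1 (by linarith)
  have n1 : 1 - t * q ≠ 0 := fun h => by
    rw [← hm, ← sub_eq_zero.1 h, norm_one] at htq
    exact lt_irrefl _ htq
  have hw : AnalyticAt ℂ (fun t : ℂ => t⁻¹ * ((1 - t ^ 3 * q) / (1 - t * q))) t :=
    hti.mul ((analyticAt_const.sub ((analyticAt_id.pow 3).mul analyticAt_const)).div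
      (analyticAt_const.sub ht3) n1)
  have hG := (hff.add (hw.mul hf3)).add (hf1.add hf2)
  have hT := analyticAt_torusAvg_one hq hf hR1 ht1 htq
  have hL : RegularLine q R 1 t := ⟨by linarith, h2, htq, h4.ne', by rw [mul_one]; exact h4.ne'⟩
  have e : ctFar f q = fun t => torusAvg f q 1 t + lineAvg f q 1 t +
      rho q t * (f (t⁻¹, t⁻¹) + t⁻¹ * ((1 - t ^ 3 * q) / (1 - t * q)) *
        f (t * q, (t ^ 2)⁻¹ * q⁻¹) + (f (t ^ 2 * q, t⁻¹) + f (t⁻¹, t ^ 2 * q))) := by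
    funext t
    rw [ctFar, varpi2_one_one, one_mul, varpi1_one_one]
  rw [e]
  refine ⟨(hT.meromorphicAt.add (hL.meromorphicAt_lineAvg hq hf one_pos le_rfl)).add
    ((meromorphicAt_rho hq ht).mul hG.meromorphicAt), fun h => ?_⟩
  have htq2 : (‖t‖ * ‖q‖) ^ 2 < 1 := by
    have : 0 ≤ ‖t‖ * ‖q‖ := by positivity
    nlinarith
  have n2 : poch q (t ^ 2 * q) ≠ 0 := by
    refine poch_ne_zero_of_ne_one hq (fun h => ?_) ?_
    · rw [h, norm_one] at hn
      linarith
    · rw [norm_mul, hn]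
      linarith
  have n3 : poch q (t ^ 3 * q) ≠ 0 := by
    rw [poch_eq_one_sub_mul hq]
    refine mul_ne_zero (fun h' => ?_) (poch_ne_zero_of_ne_one hq (fun h' => h ?_) ?_)
    · have : ‖t ^ 3 * q‖ = 1 := by rw [← sub_eq_zero.1 h', norm_one]
      rw [norm_mul, norm_pow] at this
      nlinarith
    · rw [← h']
      ring
    · rw [norm_mul, norm_mul, norm_mul, norm_pow, show ‖q‖ * (‖q‖ * (‖t‖ ^ 3 * ‖q‖)) =
        (‖t‖ * ‖q‖) ^ 2 * (‖t‖ * ‖q‖) by ring]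
      have : 0 ≤ ‖t‖ * ‖q‖ := by positivity
      nlinarith
  exact (hT.add (hL.analyticAt_lineAvg hq hf one_pos le_rfl n2)).add
    ((analyticAt_rho hq ht n2 n3).mul hG)

/-- The meromorphic continuation of the constant term to `|t| < R`, and its values: `ctCont` is
meromorphic, and its normal form has the same values at the points where it is analytic. -/
theorem exists_continuation (hq0 : q ≠ 0) (hq : ‖q‖ < 1) (hf : HolomorphicOnAnnuli R f)
    (hR1 : 1 < R) (hRq : R * ‖q‖ ≤ 1) (hρ0 : 0 < ρ) (hρ1 : ρ < 1) (hR : R⁻¹ < ρ)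
    (hqρ : ‖q‖ ≤ ρ ^ 4) (hσ0 : 0 < σ) (hσ1 : σ < 1) (hσ : ‖q‖ < σ ^ 2) :
    ∃ C : ℂ → ℂ, MeromorphicNFOn C {t | ‖t‖ < R} ∧
      (∀ t, ‖t‖ < 1 → C t = torusAvg f q 1 t) ∧
      (∀ t, 1 < ‖t‖ → ‖t‖ < R → ‖t‖ ^ 2 * ‖q‖ < 1 → t ^ 3 * q ≠ 1 → C t = ctNear f q t) ∧
      (∀ t, ‖t‖ < R → ‖t‖ ^ 2 * ‖q‖ = 1 → t ^ 2 * q ≠ 1 → C t = ctMid f q σ t) ∧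
      (∀ t, ‖t‖ < R → 1 < ‖t‖ ^ 2 * ‖q‖ → t ^ 3 * q ^ 2 ≠ 1 → C t = ctFar f q t) := by
  have hT : ∀ t : ℂ, ‖t‖ ≤ 1 → AnalyticAt ℂ (torusAvg f q ρ) t := fun t ht => by
    have : ρ ^ 4 < ρ ^ 2 := pow_lt_pow_right_of_lt_one₀ hρ0 hρ1 (by norm_num)
    exact analyticAt_torusAvg hq hf hρ0 hρ1.le hR1 hR (by nlinarith)
      (by nlinarith [norm_nonneg q])
  have hm : MeromorphicOn (ctCont f q ρ σ) {t | ‖t‖ < R} := by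
    intro t (ht : ‖t‖ < R)
    by_cases h1 : ‖t‖ ≤ 1
    · exact (hT t h1).meromorphicAt.congr ((ctCont_eventuallyEq_torusAvg hq hf hρ0 hρ1 hR1 hR hqρ
        h1).symm.filter_mono nhdsWithin_le_nhds)
    rcases lt_trichotomy (‖t‖ ^ 2 * ‖q‖) 1 with h | h | h
    · exact (ctNear_regular hq hf (not_le.1 h1) ht h).1.congr
        ((ctCont_eventuallyEq_ctNear (not_le.1 h1) h).symm.filter_mono nhdsWithin_le_nhds)
    · obtain ⟨e, a1, a2⟩ := ctCont_eventuallyEq_ctMid (ρ := ρ) hq0 hq hf hσ0 hσ1 hσ ht h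
      exact (ctMid_regular hq hf hσ0 hσ1 a1 ht a2 h).1.congr
        (e.symm.filter_mono nhdsWithin_le_nhds)
    · exact (ctFar_regular hq hf hRq ht h).1.congr
        ((ctCont_eventuallyEq_ctFar hq h).symm.filter_mono nhdsWithin_le_nhds)
  -- the normal form does not change the value at a point of analyticity
  have key : ∀ {t : ℂ} {g : ℂ → ℂ}, ‖t‖ < R → ctCont f q ρ σ =ᶠ[𝓝 t] g → AnalyticAt ℂ g t →
      toMeromorphicNFOn (ctCont f q ρ σ) {t | ‖t‖ < R} t = g t := by
    intro t g ht e hg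
    rw [toMeromorphicNFOn_eq_toMeromorphicNFAt hm ht,
      toMeromorphicNFAt_eq_self.2 (hg.congr e.symm).meromorphicNFAt]
    exact e.eq_of_nhds
  refine ⟨toMeromorphicNFOn (ctCont f q ρ σ) {t | ‖t‖ < R}, meromorphicNFOn_toMeromorphicNFOn _ _,
    fun t ht => ?_, fun t h1 h2 h3 h4 => ?_, fun t h1 h2 h3 => ?_, fun t h1 h2 h3 => ?_⟩
  · rw [key (by linarith) (ctCont_eventuallyEq_torusAvg hq hf hρ0 hρ1 hR1 hR hqρ ht.le)
      (hT t ht.le)]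
    exact torusAvg_eq_torusAvg_one hq hf hρ0 hρ1 hR1 hR hqρ ht
  · exact key h2 (ctCont_eventuallyEq_ctNear h1 h3) ((ctNear_regular hq hf h1 h2 h3).2 h4)
  · obtain ⟨e, a1, a2⟩ := ctCont_eventuallyEq_ctMid (ρ := ρ) hq0 hq hf hσ0 hσ1 hσ h1 h2
    exact key h1 e ((ctMid_regular hq hf hσ0 hσ1 a1 h1 a2 h2).2 h3)
  · exact key h1 (ctCont_eventuallyEq_ctFar hq h2) ((ctFar_regular hq hf hRq h1 h2).2 h3)

end Continuation

/-! ### Uniqueness of the continuation -/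

/-- The identity theorem for meromorphic functions in normal form on a disc. -/
lemma MeromorphicNFOn.eqOn_of_eqOn_ball {C D : ℂ → ℂ} {R r : ℝ} (hr : 0 < r) (hrR : r ≤ R)
    (hC : MeromorphicNFOn C {t | ‖t‖ < R}) (hD : MeromorphicNFOn D {t | ‖t‖ < R})
    (h : ∀ t, ‖t‖ < r → C t = D t) {t : ℂ} (ht : ‖t‖ < R) : C t = D t := by
  have hU : {t : ℂ | ‖t‖ < R} = ball (0 : ℂ) R := by ext t; simp
  have hCD : MeromorphicOn (C - D) {t | ‖t‖ < R} := hC.meromorphicOn.sub hD.meromorphicOn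
  have h0 : meromorphicOrderAt (C - D) 0 = ⊤ := by
    rw [meromorphicOrderAt_eq_top_iff]
    refine Filter.Eventually.filter_mono nhdsWithin_le_nhds ?_
    filter_upwards [ball_mem_nhds (0 : ℂ) hr] with z hz
    rw [Pi.sub_apply, h z (mem_ball_zero_iff.1 hz), sub_self]
  have h1 : meromorphicOrderAt (C - D) t = ⊤ := by
    by_contra hne
    refine hCD.meromorphicOrderAt_ne_top_of_isPreconnected ?_ ht
      (show ‖(0 : ℂ)‖ < R by rw [norm_zero]; linarith) hne h0
    rw [hU]
    exact (convex_ball 0 R).isPreconnected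
  rw [meromorphicOrderAt_eq_top_iff] at h1
  have h2 : C =ᶠ[𝓝[≠] t] D := h1.mono fun z hz => sub_eq_zero.1 hz
  exact (((hC ht).eventuallyEq_nhdsNE_iff_eventuallyEq_nhds (hD ht)).1 h2).eq_of_nhds

/-! ### Constant terms of Laurent expansions on the torus -/

lemma norm_circleAverage_le {g : ℂ → ℂ} {ρ M : ℝ} (h0 : 0 ≤ ρ)
    (hg : ∀ z, ‖z‖ = ρ → ‖g z‖ ≤ M) : ‖circleAverage g 0 ρ‖ ≤ M := by
  have h := intervalIntegral.norm_integral_le_of_norm_le_const (a := 0) (b := 2 * π)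
    (f := fun θ => g (circleMap 0 ρ θ)) (C := M) fun θ _ =>
      hg _ (mem_sphere_zero_iff_norm.1 (circleMap_mem_sphere _ h0 _))
  rw [circleAverage, norm_smul, norm_inv, Real.norm_eq_abs, abs_of_pos two_pi_pos]
  rw [sub_zero, abs_of_pos two_pi_pos] at h
  rw [inv_mul_le_iff₀ two_pi_pos]
  linarith

lemma circleAverage_zpow {m : ℤ} (hm : m ≠ 0) : circleAverage (fun z : ℂ => z ^ m) 0 1 = 0 := by
  rw [circleAverage_eq_circleIntegral one_ne_zero]
  have : (∮ z in C(0, 1), (z - 0)⁻¹ • z ^ m) = ∮ z in C(0, 1), (z - 0) ^ (m - 1) := by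
    refine circleIntegral.integral_congr zero_le_one fun z hz => ?_
    have hz0 : z ≠ 0 := by
      rintro rfl
      simp at hz
    simp only [sub_zero, smul_eq_mul]
    rw [zpow_sub_one₀ hz0, mul_comm]
  rw [this, circleIntegral.integral_sub_zpow_of_ne (by omega), smul_zero]

/-- Termwise averaging of a dominated series over the unit circle. -/
lemma hasSum_circleAverage {ι : Type*} [Countable ι] {F : ι → ℂ → ℂ} {G : ℂ → ℂ} {u : ι → ℝ}
    (hu : Summable u) (hF : ∀ i z, ‖z‖ = 1 → ContinuousAt (F i) z)
    (hFu : ∀ i z, ‖z‖ = 1 → ‖F i z‖ ≤ u i) (hG : ∀ z, ‖z‖ = 1 → HasSum (fun i => F i z) (G z)) :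
    HasSum (fun i => circleAverage (F i) 0 1) (circleAverage G 0 1) := by
  have hn : ∀ θ : ℝ, ‖circleMap 0 1 θ‖ = 1 := fun θ =>
    mem_sphere_zero_iff_norm.1 (circleMap_mem_sphere _ zero_le_one _)
  refine HasSum.const_smul _ (intervalIntegral.hasSum_integral_of_dominated_convergence
    (fun i _ => u i) (fun i => ?_) (fun i => ae_of_all _ fun θ _ => hFu i _ (hn θ))
    (ae_of_all _ fun _ _ => hu) (by simp) (ae_of_all _ fun θ _ => hG _ (hn θ)))
  have : Continuous fun θ => F i (circleMap 0 1 θ) := continuous_iff_continuousAt.2 fun θ =>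
    ContinuousAt.comp (g := F i) (hF i _ (hn θ)) (continuous_circleMap 0 1).continuousAt
  exact this.aestronglyMeasurable

/-- A constant term is the average over the unit torus; in particular it is unique. -/
lemma eq_circleAverage_of_isConstantTerm {g : ℂ × ℂ → ℂ} {c : ℂ} (h : IsConstantTerm g c) :
    c = circleAverage (fun Y => circleAverage (fun X => g (X, Y)) 0 1) 0 1 := by
  obtain ⟨b, hb, rfl⟩ := h
  have hs : Summable fun n => ‖b n‖ := by
    have := (hb 1 1 norm_one norm_one).summable
    simp only [one_zpow, mul_one] at this
    exact this.norm
  have hc : ∀ (m : ℤ) (z : ℂ), ‖z‖ = 1 → ContinuousAt (fun z : ℂ => z ^ m) z := fun m z hz =>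
    continuousAt_zpow₀ z m (.inl (norm_pos_iff.1 (by linarith)))
  have h1 : ∀ Y, ‖Y‖ = 1 → HasSum
      (fun n : ℤ × ℤ => circleAverage (fun X => b n * X ^ n.1 * Y ^ n.2) 0 1)
      (circleAverage (fun X => g (X, Y)) 0 1) := fun Y hY =>
    hasSum_circleAverage hs
      (fun n X hX => (continuousAt_const.mul (hc n.1 X hX)).mul continuousAt_const)
      (fun n X hX => by simp [norm_zpow, hX, hY]) fun X hX => hb X Y hX hY
  have e1 : ∀ (n : ℤ × ℤ) (Y : ℂ), circleAverage (fun X => b n * X ^ n.1 * Y ^ n.2) 0 1 =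
      if n.1 = 0 then b n * Y ^ n.2 else 0 := by
    intro n Y
    have : (fun X : ℂ => b n * X ^ n.1 * Y ^ n.2) = fun X => (b n * Y ^ n.2) • X ^ n.1 := by
      funext X
      rw [smul_eq_mul]
      ring
    rw [this, circleAverage_fun_smul]
    split_ifs with h
    · simp [h, circleAverage_const]
    · rw [circleAverage_zpow h, smul_zero]
  simp_rw [e1] at h1
  have h2 := hasSum_circleAverage hs (fun n Y hY => ?_) (fun n Y hY => ?_) h1
  · have e2 : ∀ n : ℤ × ℤ, n ≠ (0, 0) →
        circleAverage (fun Y => if n.1 = 0 then b n * Y ^ n.2 else 0) 0 1 = 0 := by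
      rintro ⟨m, n⟩ h
      by_cases hm : m = 0
      · have hn : n ≠ 0 := fun hn => h (by rw [hm, hn])
        simp only [hm, if_true]
        simp_rw [← smul_eq_mul]
        rw [circleAverage_fun_smul, circleAverage_zpow hn, smul_zero]
      · simp [hm, circleAverage_const]
    have h3 := hasSum_single (f := fun n : ℤ × ℤ =>
      circleAverage (fun Y => if n.1 = 0 then b n * Y ^ n.2 else 0) 0 1) (0, 0) e2
    rw [h2.unique h3]
    simp [circleAverage_const]
  · split_ifs
    · exact continuousAt_const.mul (hc n.2 Y hY)
    · exact continuousAt_const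
  · split_ifs
    · simp [norm_zpow, hY]
    · simp

/-- A continuous function on the unit circle whose Fourier coefficients are summable is the sum of
its Fourier series. -/
lemma hasSum_circleAverage_mul_zpow {h : ℂ → ℂ} (hc : ContinuousOn h (sphere 0 1))
    (hs : Summable fun n : ℤ => circleAverage (fun z => h z * z ^ (-n)) 0 1) {z : ℂ}
    (hz : ‖z‖ = 1) :
    HasSum (fun n : ℤ => circleAverage (fun z => h z * z ^ (-n)) 0 1 * z ^ n) (h z) := by
  have : Fact (0 < 2 * π) := ⟨two_pi_pos⟩
  let F : C(AddCircle (2 * π), ℂ) := ⟨fun x => h (AddCircle.toCircle x),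
    hc.comp_continuous (by fun_prop) fun x => by
      rw [mem_sphere_zero_iff_norm, Circle.norm_coe]⟩
  have hF : ∀ θ : ℝ, F (θ : AddCircle (2 * π)) = h (circleMap 0 1 θ) := by
    intro θ
    change h (AddCircle.toCircle (θ : AddCircle (2 * π))) = _
    rw [AddCircle.toCircle_apply_mk, Circle.coe_exp]
    congr 1
    rw [circleMap, zero_add, ofReal_one, one_mul]
    congr 2
    push_cast
    field_simp
  have hfour : ∀ (n : ℤ) (θ : ℝ), fourier n (θ : AddCircle (2 * π)) = (circleMap 0 1 θ) ^ n := by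
    intro n θ
    rw [fourier_coe_apply, circleMap, zero_add, ofReal_one, one_mul, ← Complex.exp_int_mul]
    congr 1
    have : (π : ℂ) ≠ 0 := ofReal_ne_zero.2 pi_ne_zero
    push_cast
    field_simp
  have hcoef : ∀ n, fourierCoeff F n = circleAverage (fun z => h z * z ^ (-n)) 0 1 := by
    intro n
    rw [fourierCoeff_eq_intervalIntegral F n 0, circleAverage, zero_add, one_div]
    congr 1
    refine intervalIntegral.integral_congr fun θ _ => ?_
    simp only [hfour, hF, smul_eq_mul]
    ring
  have hs' : Summable (fourierCoeff F) := by
    refine hs.congr fun n => ?_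
    rw [hcoef]
  obtain ⟨θ, rfl⟩ : ∃ θ : ℝ, circleMap 0 1 θ = z := by
    have : z ∈ sphere (0 : ℂ) |1| := by simp [hz]
    rw [← range_circleMap] at this
    exact this
  have := has_pointwise_sum_fourier_series_of_summable hs' (θ : AddCircle (2 * π))
  rw [hF] at this
  refine this.congr_fun fun n => ?_
  rw [hcoef, hfour, smul_eq_mul]

/-- A function holomorphic near the unit torus has a Laurent expansion there, with the average over
the torus as its constant term. The expansion is the Fourier series in `Y` and then in `X`. -/
lemma isConstantTerm_circleAverage {g : ℂ × ℂ → ℂ} {ρ : ℝ} (hρ : 1 < ρ)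
    (hg : ∀ X Y, ρ⁻¹ ≤ ‖X‖ → ‖X‖ ≤ ρ → ρ⁻¹ ≤ ‖Y‖ → ‖Y‖ ≤ ρ → DifferentiableAt ℂ g (X, Y)) :
    IsConstantTerm g (circleAverage (fun Y => circleAverage (fun X => g (X, Y)) 0 1) 0 1) := by
  have hρ0 : 0 < ρ := by linarith
  have hρi : 0 < ρ⁻¹ := by positivity
  have hρi1 : ρ⁻¹ < 1 := inv_lt_one_of_one_lt₀ hρ
  let b : ℤ × ℤ → ℂ := fun n =>
    circleAverage (fun Y => circleAverage (fun X => g (X, Y) * X ^ (-n.1)) 0 1 * Y ^ (-n.2)) 0 1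
  have hne : ∀ z : ℂ, ρ⁻¹ ≤ ‖z‖ → z ≠ 0 := fun z hz => norm_pos_iff.1 (hρi.trans_le hz)
  -- the coefficients decay, as the contours can be moved to `|X| = ρ ^ (± 1)`, `|Y| = ρ ^ (± 1)`
  have hdecay : ∃ M : ℝ, ∀ n, ‖b n‖ ≤ M * (ρ⁻¹ ^ n.1.natAbs * ρ⁻¹ ^ n.2.natAbs) := by
    have hK : IsCompact {z : ℂ | ρ⁻¹ ≤ ‖z‖ ∧ ‖z‖ ≤ ρ} := by
      refine (isCompact_closedBall (0 : ℂ) ρ).of_isClosed_subset ?_ fun z hz => by simpa using hz.2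
      have h1 : IsClosed {z : ℂ | ρ⁻¹ ≤ ‖z‖} := isClosed_le (by fun_prop) (by fun_prop)
      have h2 : IsClosed {z : ℂ | ‖z‖ ≤ ρ} := isClosed_le (by fun_prop) (by fun_prop)
      exact h1.inter h2
    obtain ⟨M, hM⟩ := (hK.prod hK).bddAbove_image (f := fun p => ‖g p‖) fun p hp =>
      (hg p.1 p.2 hp.1.1 hp.1.2 hp.2.1 hp.2.2).continuousAt.norm.continuousWithinAt
    have hM' : ∀ X Y, ρ⁻¹ ≤ ‖X‖ → ‖X‖ ≤ ρ → ρ⁻¹ ≤ ‖Y‖ → ‖Y‖ ≤ ρ → ‖g (X, Y)‖ ≤ M :=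
      fun X Y h1 h2 h3 h4 => hM ⟨(X, Y), ⟨⟨h1, h2⟩, ⟨h3, h4⟩⟩, rfl⟩
    -- the radius which makes `|X ^ (-m)|` small
    have hrad : ∀ m : ℤ, ∃ σ : ℝ, ρ⁻¹ ≤ σ ∧ σ ≤ ρ ∧ σ ^ (-m) = ρ⁻¹ ^ m.natAbs := by
      intro m
      rcases le_total 0 m with hm | hm
      · refine ⟨ρ, by linarith, le_rfl, ?_⟩
        rw [← zpow_natCast, Int.natAbs_of_nonneg hm, inv_zpow', zpow_neg]
      · refine ⟨ρ⁻¹, le_rfl, by linarith, ?_⟩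
        rw [← zpow_natCast, Int.ofNat_natAbs_of_nonpos hm]
    refine ⟨M, fun n => ?_⟩
    obtain ⟨σ₁, h1, h1', e1⟩ := hrad n.1
    obtain ⟨σ₂, h2, h2', e2⟩ := hrad n.2
    have hb : b n = circleAverage (fun Y => circleAverage
        (fun X => g (X, Y) * X ^ (-n.1) * Y ^ (-n.2)) 0 1) 0 1 := by
      simp only [b]
      congr 1
      funext Y
      rw [mul_comm, ← smul_eq_mul, ← circleAverage_fun_smul]
      congr 1
      funext X
      rw [smul_eq_mul, mul_comm]
    rw [hb, circleAverage_circleAverage_eq (F := fun X Y => g (X, Y) * X ^ (-n.1) * Y ^ (-n.2))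
      (r := ρ⁻¹) (s := ρ) (τ₁ := σ₁) (τ₂ := σ₂) hρi (fun X Y a1 a2 a3 a4 => ?_) hρi1.le hρ.le
      hρi1.le hρ.le h1 h1' h2 h2']
    · refine norm_circleAverage_le (by linarith) fun Y hY =>
        norm_circleAverage_le (by linarith) fun X hX => ?_
      rw [norm_mul, norm_mul, norm_zpow, norm_zpow, hX, hY, e1, e2, mul_assoc]
      gcongr
      exact hM' X Y (hX ▸ h1) (hX ▸ h1') (hY ▸ h2) (hY ▸ h2')
    · have d1 : DifferentiableAt ℂ (fun p : ℂ × ℂ => p.1 ^ (-n.1)) (X, Y) :=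
        DifferentiableAt.comp (X, Y) (g := fun z : ℂ => z ^ (-n.1)) (f := Prod.fst)
          (differentiableAt_zpow.2 (.inl (hne X a1))) (by fun_prop)
      have d2 : DifferentiableAt ℂ (fun p : ℂ × ℂ => p.2 ^ (-n.2)) (X, Y) :=
        DifferentiableAt.comp (X, Y) (g := fun z : ℂ => z ^ (-n.2)) (f := Prod.snd)
          (differentiableAt_zpow.2 (.inl (hne Y a3))) (by fun_prop)
      exact ((hg X Y a1 a2 a3 a4).mul d1).mul d2
  have hsum : Summable b := by
    obtain ⟨M, hM⟩ := hdecay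
    have hgeo : Summable fun m : ℤ => ρ⁻¹ ^ m.natAbs := by
      have := summable_geometric_of_lt_one hρi.le hρi1
      refine Summable.of_nat_of_neg ?_ ?_ <;> simpa using this
    exact Summable.of_norm_bounded ((hgeo.mul_of_nonneg hgeo (fun _ => by positivity)
      fun _ => by positivity).mul_left M) hM
  have hgc : ∀ X Y, ‖X‖ = 1 → ‖Y‖ = 1 → ContinuousAt g (X, Y) := fun X Y hX hY =>
    (hg X Y (by linarith) (by linarith) (by linarith) (by linarith)).continuousAt
  refine ⟨b, fun X Y hX hY => ?_, by simp [b]⟩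
  let c : ℤ → ℂ := fun m => circleAverage (fun X => g (X, Y) * X ^ (-m)) 0 1
  have hterm : ∀ X : ℂ, ‖X‖ = 1 → Summable fun n : ℤ × ℤ => b n * X ^ n.1 * Y ^ n.2 := by
    intro X hX
    refine Summable.of_norm (hsum.norm.congr fun n => ?_)
    simp [norm_zpow, hX, hY]
  have hfib : ∀ X : ℂ, ‖X‖ = 1 → ∀ m : ℤ,
      HasSum (fun n : ℤ => b (m, n) * X ^ m * Y ^ n) (c m * X ^ m) := by
    intro X hX m
    have hcont : ContinuousOn (fun Y => circleAverage (fun X => g (X, Y) * X ^ (-m)) 0 1)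
        (sphere 0 1) := by
      refine continuousOn_circleAverage zero_le_one ?_
      rintro ⟨Y, X⟩ ⟨hY, hX⟩
      rw [mem_sphere_zero_iff_norm] at hX hY
      have d1 : ContinuousAt (fun p : ℂ × ℂ => p.2 ^ (-m)) (Y, X) :=
        ContinuousAt.comp (x := (Y, X)) (g := fun z : ℂ => z ^ (-m)) (f := Prod.snd)
          (continuousAt_zpow₀ X _ (.inl (norm_pos_iff.1 (by simp only at hX; linarith))))
          (by fun_prop)
      have d2 : ContinuousAt (fun p : ℂ × ℂ => g (p.2, p.1)) (Y, X) :=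
        ContinuousAt.comp (x := (Y, X)) (g := g) (f := Prod.swap) (hgc X Y hX hY)
          continuous_swap.continuousAt
      exact (d2.mul d1).continuousWithinAt
    have hs : Summable fun n => b (m, n) :=
      hsum.comp_injective (i := fun n : ℤ => (m, n)) fun n n' h => (Prod.ext_iff.1 h).2
    have := (hasSum_circleAverage_mul_zpow hcont hs hY).mul_left (X ^ m)
    rw [mul_comm (X ^ m)] at this
    refine this.congr_fun fun n => ?_
    ring
  have hprod : ∀ X : ℂ, ‖X‖ = 1 →
      HasSum (fun m => c m * X ^ m) (∑' n : ℤ × ℤ, b n * X ^ n.1 * Y ^ n.2) := fun X hX =>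
    (hterm X hX).hasSum.prod_fiberwise (hfib X hX)
  have hcs : Summable c := by
    have := (hprod 1 norm_one).summable
    simpa using this
  have hgX : ContinuousOn (fun X => g (X, Y)) (sphere 0 1) := fun X hX =>
    (ContinuousAt.comp (x := X) (g := g) (f := fun X => (X, Y))
      (hgc X Y (mem_sphere_zero_iff_norm.1 hX) hY) (by fun_prop)).continuousWithinAt
  rw [(hasSum_circleAverage_mul_zpow hgX hcs hX).unique (hprod X hX)]
  exact (hterm X hX).hasSum

/-! ### Integrable one-dimensional integrands on the line `Re k = -1/2` -/

/-- If `h z / (z - c)` is integrable on the unit circle, with `|c| = 1` and `h` holomorphic, then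
`h c = 0`, the singularity at `c` is removable, and the contour can be moved. -/
lemma circleAverage_div_sub_eq_of_circleIntegrable {h : ℂ → ℂ} {c : ℂ} {σ : ℝ} (hσ0 : 0 < σ)
    (hσ1 : σ < 1) (hc : ‖c‖ = 1) (hh : ∀ z, σ ≤ ‖z‖ → ‖z‖ ≤ 1 → DifferentiableAt ℂ h z)
    (hev : ∀ᶠ z in 𝓝 c, DifferentiableAt ℂ h z)
    (hint : CircleIntegrable (fun z => h z / (z - c)) 0 1) :
    circleAverage (fun z => h z / (z - c)) 0 1 = circleAverage (fun z => h z / (z - c)) 0 σ := by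
  have hds : ∀ z, σ ≤ ‖z‖ → ‖z‖ ≤ 1 → DifferentiableAt ℂ (dslope h c) z := by
    intro z h1 h2
    by_cases hz : z = c
    · rw [hz]
      exact ((Complex.differentiableOn_dslope (s := {z | DifferentiableAt ℂ h z}) hev).2
        fun z hz => hz.differentiableWithinAt).differentiableAt hev
    · exact (differentiableAt_dslope_of_ne hz).2 (hh z h1 h2)
  have hcd : ∀ S : Set ℂ, {c}ᶜ ∈ codiscreteWithin S := fun S => by
    rw [mem_codiscreteWithin_iff_forall_mem_nhdsNE]
    intro x _
    refine mem_of_superset ?_ subset_union_left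
    by_cases hx : x = c
    · rw [hx]
      exact self_mem_nhdsWithin
    · exact mem_nhdsWithin_of_mem_nhds (isOpen_compl_singleton.mem_nhds hx)
  have hpt : ∀ z, z ≠ c → h z / (z - c) = dslope h c z + h c * (z - c)⁻¹ := by
    intro z hz
    have := sub_ne_zero.2 hz
    rw [dslope_of_ne _ hz, slope_def_field]
    field_simp
    ring
  have hi : CircleIntegrable (dslope h c) 0 1 := circleIntegrable_of_continuousAt zero_le_one
    fun z hz => (hds z (by linarith) hz.le).continuousAt
  -- otherwise `1 / (z - c)` would be integrable on the unit circle
  have hc0 : h c = 0 := by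
    by_contra hne
    have h1 : CircleIntegrable (fun z => (h c)⁻¹ • (h z / (z - c) - dslope h c z)) 0 1 :=
      (hint.sub hi).const_smul
    have h2 : CircleIntegrable (fun z => (z - c)⁻¹) 0 1 := by
      refine h1.congr_codiscreteWithin ?_
      filter_upwards [hcd _] with z hz
      rw [hpt z hz, smul_eq_mul]
      field_simp
      ring
    rw [circleIntegrable_sub_inv_iff] at h2
    simp [hc] at h2
  have e1 : circleAverage (fun z => h z / (z - c)) 0 1 = circleAverage (dslope h c) 0 1 := by
    refine circleAverage_congr_codiscreteWithin ?_ one_ne_zero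
    filter_upwards [hcd _] with z hz
    rw [hpt z hz, hc0, zero_mul, add_zero]
  have e2 : circleAverage (fun z => h z / (z - c)) 0 σ = circleAverage (dslope h c) 0 σ := by
    refine circleAverage_congr_of_norm hσ0.le fun z hz => ?_
    rw [hpt z (fun h => by rw [h, hc] at hz; linarith), hc0, zero_mul, add_zero]
  rw [e1, e2, circleAverage_eq_of_differentiableAt hσ0 hσ1.le hds]

section Integrable

variable {f : ℂ × ℂ → ℂ} {q t : ℂ} {R σ : ℝ}

lemma eventually_range (hR1 : ‖t‖ < R) (hσ1 : σ < 1) (h3 : ‖t‖ * ‖q‖ < 1) {c : ℂ} (hc : ‖c‖ = 1) :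
    ∀ᶠ z in 𝓝 c, σ ≤ ‖z‖ ∧ ‖t‖ * ‖z‖ < R ∧ ‖t‖ * ‖q‖ * ‖z‖ < 1 := by
  have hU : IsOpen {z : ℂ | σ < ‖z‖ ∧ ‖t‖ * ‖z‖ < R ∧ ‖t‖ * ‖q‖ * ‖z‖ < 1} := by
    refine IsOpen.and (isOpen_lt ?_ ?_) (IsOpen.and (isOpen_lt ?_ ?_) (isOpen_lt ?_ ?_)) <;>
      fun_prop
  filter_upwards [hU.mem_nhds (show _ ∧ _ ∧ _ by rw [hc]; grind)] with z hz
  exact ⟨hz.1.le, hz.2⟩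

lemma lineAvg1_one_eq_of_circleIntegrable (hq : ‖q‖ < 1) (hf : HolomorphicOnAnnuli R f)
    (hσ0 : 0 < σ) (hσ1 : σ < 1) (h1 : 1 < ‖t‖ * σ) (h2 : ‖t‖ < R) (h3 : ‖t‖ * ‖q‖ < σ)
    (h4 : ‖t‖ ^ 2 * ‖q‖ = 1)
    (hint : CircleIntegrable (fun Y => (f (t⁻¹, Y) + f (Y, t⁻¹)) * core1 q t Y) 0 1) :
    lineAvg1 f q 1 t = lineAvg1 f q σ t := by
  have hc : ‖t ^ 2 * q‖ = 1 := by rw [norm_mul, norm_pow, h4]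
  let g : ℂ → ℂ := fun Y => (f (t⁻¹, Y) + f (Y, t⁻¹)) * core1Red' q t Y
  have hg := fun Z hZ1 hZ2 hZ3 => differentiableAt_core1Red'_mul (Z := Z) hq hf hσ0 hσ1 h1 h2 h3
    hZ1 hZ2 hZ3
  have e : ∀ Y : ℂ, Y ≠ 0 → (f (t⁻¹, Y) + f (Y, t⁻¹)) * core1 q t Y =
      g Y * Y / (Y - t ^ 2 * q) := fun Y hY => by
    rw [core1_eq_core1Red'_div hq, ← mul_div_assoc,
      show 1 - t ^ 2 * q * Y⁻¹ = (Y - t ^ 2 * q) / Y by field_simp, div_div_eq_mul_div]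
  have e' : ∀ σ : ℝ, 0 < σ → lineAvg1 f q σ t =
      circleAverage (fun Y => g Y * Y / (Y - t ^ 2 * q)) 0 σ := fun σ hσ =>
    circleAverage_congr_of_norm hσ.le fun Y hY => e Y (norm_pos_iff.1 (by linarith))
  rw [e' 1 one_pos, e' σ hσ0]
  refine circleAverage_div_sub_eq_of_circleIntegrable (h := fun Y => g Y * Y) hσ0 hσ1 hc
    (fun Z hZ1 hZ2 => ?_) ?_ ?_
  · obtain ⟨r1, r2⟩ := range_of_norm_le_one (q := q) h2 (by linarith) hZ2
    exact (hg Z hZ1 r1 r2).mul differentiableAt_id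
  · filter_upwards [eventually_range (q := q) h2 hσ1 (by linarith) hc] with Z hZ
    exact (hg Z hZ.1 hZ.2.1 hZ.2.2).mul differentiableAt_id
  · refine (circleIntegrable_congr fun Y hY => ?_).1 hint
    rw [abs_one, mem_sphere_zero_iff_norm] at hY
    exact e Y (norm_pos_iff.1 (by linarith))

lemma lineAvg2_one_eq_of_circleIntegrable (hq : ‖q‖ < 1) (hf : HolomorphicOnAnnuli R f)
    (hσ0 : 0 < σ) (hσ1 : σ < 1) (h1 : 1 < ‖t‖ * σ) (h2 : ‖t‖ < R) (h3 : ‖t‖ * ‖q‖ < σ)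
    (h4 : ‖t‖ ^ 2 * ‖q‖ = 1)
    (hint : CircleIntegrable (fun Y => f (t⁻¹ * Y⁻¹, Y) * core2 q t Y) 0 1) :
    lineAvg2 f q 1 t = lineAvg2 f q σ t := by
  have hn : ‖t ^ 2 * q‖ = 1 := by rw [norm_mul, norm_pow, h4]
  have hw : t ^ 2 * q ≠ 0 := norm_pos_iff.1 (by linarith)
  have hc : ‖(t ^ 2 * q)⁻¹‖ = 1 := by rw [norm_inv, hn, inv_one]
  let g : ℂ → ℂ := fun Y => f (t⁻¹ * Y⁻¹, Y) * core2Red q t Y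
  have hg := fun Z hZ1 hZ2 hZ3 => differentiableAt_core2Red_mul (Z := Z) hq hf hσ0 hσ1 h1 h2 h3
    hZ1 hZ2 hZ3
  have e : (fun Y : ℂ => f (t⁻¹ * Y⁻¹, Y) * core2 q t Y) =
      fun Y => -(t ^ 2 * q)⁻¹ * g Y / (Y - (t ^ 2 * q)⁻¹) := by
    funext Y
    have e1 : 1 - t ^ 2 * q * Y = -(t ^ 2 * q) * (Y - (t ^ 2 * q)⁻¹) := by
      rw [mul_sub, neg_mul, neg_mul, mul_inv_cancel₀ hw]
      ring
    rw [core2_eq_core2Red_div hq, ← mul_div_assoc, e1, ← div_div, ← inv_neg]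
    congr 1
    rw [div_eq_inv_mul]
  unfold lineAvg2
  rw [e] at hint ⊢
  refine circleAverage_div_sub_eq_of_circleIntegrable (h := fun Y => -(t ^ 2 * q)⁻¹ * g Y) hσ0 hσ1
    hc (fun Z hZ1 hZ2 => ?_) ?_ hint
  · obtain ⟨r1, r2⟩ := range_of_norm_le_one (q := q) h2 (by linarith) hZ2
    exact (hg Z hZ1 r1 r2).const_mul _
  · filter_upwards [eventually_range (q := q) h2 hσ1 (by linarith) hc] with Z hZ
    exact (hg Z hZ.1 hZ.2.1 hZ.2.2).const_mul _

/-- For `|t|² |q| = 1`, integrability on `|Y| = 1` forces the singularities there to be removable,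
so that the contour can be moved to `|Y| = σ`. -/
lemma lineAvg_one_eq_of_circleIntegrable (hq : ‖q‖ < 1) (hf : HolomorphicOnAnnuli R f)
    (hσ0 : 0 < σ) (hσ1 : σ < 1) (h1 : 1 < ‖t‖ * σ) (h2 : ‖t‖ < R) (h3 : ‖t‖ * ‖q‖ < σ)
    (h4 : ‖t‖ ^ 2 * ‖q‖ = 1)
    (hi1 : CircleIntegrable (fun Y => (f (t⁻¹, Y) + f (Y, t⁻¹)) * zeta1 q t Y) 0 1)
    (hi2 : CircleIntegrable (fun Y => f (t⁻¹ * Y⁻¹, Y) * zeta2 q t Y) 0 1) :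
    lineAvg f q 1 t = lineAvg f q σ t := by
  -- if `ϱ₀ = 0`, which includes the case of a vanishing denominator, both sides are zero
  by_cases h0 : rho0 q t = 0
  · simp [lineAvg, h0]
  have ht : t ≠ 0 := norm_pos_iff.1 (by nlinarith)
  have hi1' : CircleIntegrable (fun Y => (f (t⁻¹, Y) + f (Y, t⁻¹)) * core1 q t Y) 0 1 := by
    have : CircleIntegrable (fun Y => (rho0 q t)⁻¹ •
      ((f (t⁻¹, Y) + f (Y, t⁻¹)) * zeta1 q t Y)) 0 1 := hi1.const_smul
    refine (circleIntegrable_congr fun Y _ => ?_).1 this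
    simp only [zeta1_eq, smul_eq_mul]
    field_simp
  have hi2' : CircleIntegrable (fun Y => f (t⁻¹ * Y⁻¹, Y) * core2 q t Y) 0 1 := by
    have : CircleIntegrable (fun Y => ((rho0 q t)⁻¹ * t) •
      (f (t⁻¹ * Y⁻¹, Y) * zeta2 q t Y)) 0 1 := hi2.const_smul
    refine (circleIntegrable_congr fun Y _ => ?_).1 this
    simp only [zeta2_eq, smul_eq_mul]
    generalize f (t⁻¹ * Y⁻¹, Y) = z
    field_simp
  rw [lineAvg, lineAvg, lineAvg1_one_eq_of_circleIntegrable hq hf hσ0 hσ1 h1 h2 h3 h4 hi1',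
    lineAvg2_one_eq_of_circleIntegrable hq hf hσ0 hσ1 h1 h2 h3 h4 hi2']

end Integrable

/-! ### The integrals in the exponential coordinates -/

section Coordinates

variable {a : ℝ}

lemma norm_qpow (a : ℝ) (x : ℂ) : ‖qpow a x‖ = Real.exp (-x.re / a) := by
  rw [qpow, Complex.norm_exp, div_ofReal_re, neg_re]

lemma qpow_neg (a : ℝ) (x : ℂ) : qpow a (-x) = (qpow a x)⁻¹ := by
  rw [qpow, qpow, ← Complex.exp_neg]
  congr 1
  ring

/-- The vertical line `Re y = v` is mapped to a circle, which is run through clockwise. -/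
lemma qpow_line (ha : 0 < a) (v s : ℝ) :
    qpow a (v + s * I) = circleMap 0 (Real.exp (-v / a)) (s * -a⁻¹) := by
  rw [qpow, circleMap, zero_add, ofReal_exp, ← Complex.exp_add]
  congr 1
  have : (a : ℂ) ≠ 0 := ofReal_ne_zero.2 ha.ne'
  push_cast
  field_simp
  ring

lemma lineInt_eq_circleAverage (ha : 0 < a) (v : ℝ) (G : ℂ → ℂ) :
    lineInt a v (fun y => G (qpow a y)) =
      (2 * (π : ℂ) * I * (a : ℂ)) * circleAverage G 0 (Real.exp (-v / a)) := by
  unfold lineInt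
  simp_rw [qpow_line ha]
  have hc : -a⁻¹ ≠ 0 := neg_ne_zero.2 (inv_ne_zero ha.ne')
  rw [intervalIntegral.integral_comp_mul_right
    (fun θ => G (circleMap 0 (Real.exp (-v / a)) θ) * I) hc,
    show -(π * a) * -a⁻¹ = π by field_simp, show π * a * -a⁻¹ = -π by field_simp,
    intervalIntegral.integral_symm, inv_neg, inv_inv, neg_smul_neg]
  have hper : Function.Periodic (fun θ => G (circleMap 0 (Real.exp (-v / a)) θ) * I) (2 * π) :=
    fun θ => by simp only [periodic_circleMap 0 _ θ]
  have h := hper.intervalIntegral_add_eq (-π) 0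
  rw [show -π + 2 * π = π by ring, zero_add] at h
  rw [h, intervalIntegral.integral_mul_const, circleAverage, real_smul, real_smul]
  have : (π : ℂ) ≠ 0 := ofReal_ne_zero.2 pi_ne_zero
  push_cast
  field_simp

lemma circleIntegrable_of_intervalIntegrable (ha : 0 < a) {G : ℂ → ℂ}
    (h : IntervalIntegrable (fun s : ℝ => G (qpow a ((s : ℂ) * I))) volume (-(π * a)) (π * a)) :
    CircleIntegrable G 0 1 := by
  have e : ∀ s : ℝ, qpow a ((s : ℂ) * I) = circleMap 0 1 (s * -a⁻¹) := fun s => by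
    have := qpow_line ha 0 s
    rwa [neg_zero, zero_div, Real.exp_zero, ofReal_zero, zero_add] at this
  simp_rw [e] at h
  have h1 := (h.comp_mul_right (c := -a)).symm
  rw [show -(π * a) / -a = π by field_simp, show π * a / -a = -π by field_simp] at h1
  have e2 : ∀ θ : ℝ, θ * -a * -a⁻¹ = θ := fun θ => by field_simp
  simp_rw [e2] at h1
  have hper : Function.Periodic (fun θ => G (circleMap 0 1 θ)) (2 * π) :=
    fun θ => by simp only [periodic_circleMap 0 _ θ]
  exact hper.intervalIntegrable (t := -π) two_pi_pos.ne'
    (by rwa [show -π + 2 * π = π by ring]) _ _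

lemma int0_eq (ha : 0 < a) (t : ℂ) (f : ℂ × ℂ → ℂ) : int0 a t f = torusAvg f (qpow a 1) 1 t := by
  have h1 : ∀ Y, lineInt a 0 (fun x => f (qpow a x, Y) * mu (qpow a 1) t (qpow a x) Y) =
      (2 * (π : ℂ) * I * (a : ℂ)) •
        circleAverage (fun X => f (X, Y) * mu (qpow a 1) t X Y) 0 1 := fun Y => by
    rw [lineInt_eq_circleAverage ha 0 fun X => f (X, Y) * mu (qpow a 1) t X Y, neg_zero, zero_div,
      Real.exp_zero, smul_eq_mul]
  unfold int0
  simp_rw [h1]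
  rw [lineInt_eq_circleAverage ha 0 fun Y => (2 * (π : ℂ) * I * (a : ℂ)) •
        circleAverage (fun X => f (X, Y) * mu (qpow a 1) t X Y) 0 1, neg_zero, zero_div,
      Real.exp_zero, circleAverage_fun_smul, smul_eq_mul, torusAvg]
  have h2 : (a : ℂ) ≠ 0 := ofReal_ne_zero.2 ha.ne'
  have h3 : (π : ℂ) ≠ 0 := ofReal_ne_zero.2 pi_ne_zero
  field_simp

lemma int1_eq (ha : 0 < a) (v : ℝ) (t : ℂ) (f : ℂ × ℂ → ℂ) :
    int1 a v t f = lineAvg f (qpow a 1) (Real.exp (-v / a)) t := by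
  have h2 : (a : ℂ) ≠ 0 := ofReal_ne_zero.2 ha.ne'
  have h3 : (π : ℂ) ≠ 0 := ofReal_ne_zero.2 pi_ne_zero
  have e1 : lineInt a v (integrand1 a t f) = (2 * (π : ℂ) * I * (a : ℂ)) *
      (rho0 (qpow a 1) t * lineAvg1 f (qpow a 1) (Real.exp (-v / a)) t) := by
    rw [lineAvg1, ← smul_eq_mul (rho0 _ _), ← circleAverage_fun_smul,
      ← lineInt_eq_circleAverage ha v]
    congr 1
    funext y
    rw [integrand1, zeta1_eq, smul_eq_mul]
    ring
  have e2 : lineInt a v (integrand2 a t f) = (2 * (π : ℂ) * I * (a : ℂ)) *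
      (rho0 (qpow a 1) t * t⁻¹ * lineAvg2 f (qpow a 1) (Real.exp (-v / a)) t) := by
    rw [lineAvg2, ← smul_eq_mul (rho0 _ _ * _), ← circleAverage_fun_smul,
      ← lineInt_eq_circleAverage ha v]
    congr 1
    funext y
    rw [integrand2, zeta2_eq, smul_eq_mul, qpow_neg]
    ring
  rw [int1, e1, e2, lineAvg]
  field_simp

end Coordinates

/-! ### The formulas for the constant term -/

/-- For `|t| < 1` the function `f μ` is holomorphic near the unit torus, and its constant term is
the average over it. -/
lemma isConstantTerm_torusAvg {f : ℂ × ℂ → ℂ} {q t : ℂ} {R : ℝ} (hq : ‖q‖ < 1)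
    (hf : HolomorphicOnAnnuli R f) (hR1 : 1 < R) (ht : ‖t‖ < 1) :
    IsConstantTerm (fun p : ℂ × ℂ => f p * mu q t p.1 p.2) (torusAvg f q 1 t) := by
  obtain ⟨ρ, ⟨hρR, hρt⟩, hρ⟩ : ∃ ρ : ℝ, (ρ < R ∧ ‖t‖ * ρ ^ 2 < 1) ∧ 1 < ρ := by
    have hU : IsOpen {x : ℝ | x < R ∧ ‖t‖ * x ^ 2 < 1} := by
      refine IsOpen.and (isOpen_lt ?_ ?_) (isOpen_lt ?_ ?_) <;> fun_prop
    have h1 : ∀ᶠ x in 𝓝[>] (1 : ℝ), x < R ∧ ‖t‖ * x ^ 2 < 1 :=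
      nhdsWithin_le_nhds (hU.mem_nhds ⟨hR1, by simpa using ht⟩)
    exact (h1.and self_mem_nhdsWithin).exists
  have hρ0 : 0 < ρ := by linarith
  have hRi : R⁻¹ < ρ⁻¹ := inv_strictAnti₀ hρ0 hρR
  have ht0 := norm_nonneg t
  have hρ2 : 1 < ρ ^ 2 := by nlinarith
  have hroot : ∀ A : ℂ, (ρ ^ 2)⁻¹ ≤ ‖A‖ → ‖A‖ ≤ ρ ^ 2 → RegularAt q t A := by
    intro A h1 h2
    have h3 : 0 < ‖A‖ := lt_of_lt_of_le (by positivity) h1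
    have h4 : ‖t‖ < (ρ ^ 2)⁻¹ := by
      rw [← one_div, lt_div_iff₀ (by positivity)]
      exact hρt
    have h5 : ‖t‖ * ‖A‖ < 1 := (mul_le_mul_of_nonneg_left h2 ht0).trans_lt hρt
    have h6 : ‖t‖ * ‖q‖ ≤ ‖t‖ := by nlinarith
    exact .of_norm h3 h5.ne (by nlinarith) (by linarith)
  refine isConstantTerm_circleAverage (g := fun p => f p * mu q t p.1 p.2) hρ
    fun X Y h1 h2 h3 h4 => ?_
  have hle : (ρ ^ 2)⁻¹ ≤ ρ⁻¹ := inv_anti₀ hρ0 (by nlinarith)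
  have hle' : ρ ≤ ρ ^ 2 := by nlinarith
  have hi : 0 < ρ⁻¹ := by positivity
  have := differentiableAt_mul_mu (t := t) hq
    (hf X Y (by linarith) (by linarith) (by linarith) (by linarith))
    (hroot X (by linarith) (by linarith)) (hroot Y (by linarith) (by linarith))
    (hroot (X * Y) (by
      rw [norm_mul, sq, mul_inv]
      gcongr) (by
      rw [norm_mul, sq]
      gcongr))
  exact DifferentiableAt.comp (X, Y)
    (g := fun p : ℂ × ℂ × ℂ => f (p.2.1, p.2.2) * mu q p.1 p.2.1 p.2.2)
    (f := fun p : ℂ × ℂ => (t, p.1, p.2)) this (by fun_prop)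

/-- The continued constant term exists, and its values for `|t| > 1` are given by the integrals and
residues; the contour `Re y = ε` serves the line `Re k = -1/2`. -/
lemma exists_isCt {a : ℝ} (ha : 0 < a) {r : ℝ} (hr0 : 0 < r) (hr1 : r ≤ 1)
    {f : ℂ × ℂ → ℂ} (hf : AnalyticOnNhd ℂ f (annulus a r)) {ε : ℝ} (hε0 : 0 < ε) (hε1 : ε < 1 / 2) :
    ∃ C : ℂ → ℂ, IsCt a r f C ∧ ∀ k : ℂ, -r < k.re → k.re < 0 →
      (-(1 / 2) < k.re → qpow a k ^ 3 * qpow a 1 ≠ 1 →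
        C (qpow a k) = ctNear f (qpow a 1) (qpow a k)) ∧
      (k.re < -(1 / 2) → qpow a k ^ 3 * qpow a 1 ^ 2 ≠ 1 →
        C (qpow a k) = ctFar f (qpow a 1) (qpow a k)) ∧
      (k.re = -(1 / 2) → qpow a k ^ 2 * qpow a 1 ≠ 1 →
        C (qpow a k) = ctMid f (qpow a 1) (Real.exp (-ε / a)) (qpow a k) ∧
        (CircleIntegrable (fun Y =>
          (f ((qpow a k)⁻¹, Y) + f (Y, (qpow a k)⁻¹)) * zeta1 (qpow a 1) (qpow a k) Y) 0 1 →
        CircleIntegrable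
          (fun Y => f ((qpow a k)⁻¹ * Y⁻¹, Y) * zeta2 (qpow a 1) (qpow a k) Y) 0 1 →
        lineAvg f (qpow a 1) 1 (qpow a k) =
          lineAvg f (qpow a 1) (Real.exp (-ε / a)) (qpow a k))) := by
  have hlt : ∀ {x y : ℝ}, x < y → Real.exp (x / a) < Real.exp (y / a) := fun h =>
    Real.exp_lt_exp.2 (div_lt_div_of_pos_right h ha)
  have hle : ∀ {x y : ℝ}, x ≤ y → Real.exp (x / a) ≤ Real.exp (y / a) := fun h =>
    Real.exp_le_exp.2 (div_le_div_of_nonneg_right h ha.le)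
  have hone : Real.exp (0 / a) = 1 := by rw [zero_div, Real.exp_zero]
  have hmul : ∀ x y : ℝ, Real.exp (x / a) * Real.exp (y / a) = Real.exp ((x + y) / a) :=
    fun x y => by rw [← Real.exp_add, add_div]
  have hpow : ∀ (x : ℝ) (n : ℕ), Real.exp (x / a) ^ n = Real.exp (n * x / a) := fun x n => by
    rw [← Real.exp_nat_mul, mul_div_assoc]
  have hinv : (Real.exp (r / a))⁻¹ = Real.exp (-r / a) := by rw [← Real.exp_neg, neg_div]
  have hf' : HolomorphicOnAnnuli (Real.exp (r / a)) f := fun X Y h1 h2 h3 h4 => by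
    rw [hinv, neg_div] at h1 h3
    exact (hf (X, Y) ⟨h1, h2, h3, h4⟩).differentiableAt
  have hqn : ‖qpow a 1‖ = Real.exp (-1 / a) := by rw [norm_qpow, one_re]
  have hq0 : qpow a 1 ≠ 0 := Complex.exp_ne_zero _
  have hq : ‖qpow a 1‖ < 1 := by
    rw [hqn, ← hone]
    exact hlt (by norm_num)
  have hR1 : 1 < Real.exp (r / a) := by
    rw [← hone]
    exact hlt hr0
  have hσ1 : Real.exp (-ε / a) < 1 := by
    rw [← hone]
    exact hlt (by linarith)
  -- `r ≤ 1` gives `q ≤ q ^ r = ρ ^ 4` for `ρ = q ^ (r / 4)`, and `ε < 1/2` gives `q < σ ^ 2` for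
  -- `σ = q ^ ε`
  obtain ⟨C, hC, c0, c1, c2, c3⟩ := exists_continuation (f := f) (ρ := Real.exp (-(r / 4) / a))
    (σ := Real.exp (-ε / a)) hq0 hq hf' hR1
    (by rw [hqn, hmul, ← hone]; exact hle (by linarith)) (Real.exp_pos _)
    (by rw [← hone]; exact hlt (by linarith)) (by rw [hinv]; exact hlt (by linarith))
    (by rw [hqn, hpow]; exact hle (by push_cast; linarith)) (Real.exp_pos _) hσ1
    (by rw [hqn, hpow]; exact hlt (by push_cast; linarith))
  refine ⟨C, ⟨hC, fun t ht => ?_⟩, fun k hk1 hk2 => ?_⟩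
  · rw [c0 t ht]
    exact isConstantTerm_torusAvg hq hf' hR1 ht
  have hk : ‖qpow a k‖ = Real.exp (-k.re / a) := norm_qpow a k
  have ht1 : 1 < ‖qpow a k‖ := by
    rw [hk, ← hone]
    exact hlt (by linarith)
  have htR : ‖qpow a k‖ < Real.exp (r / a) := by
    rw [hk]
    exact hlt (by linarith)
  have ht2 : ‖qpow a k‖ ^ 2 * ‖qpow a 1‖ = Real.exp ((-2 * k.re - 1) / a) := by
    rw [hk, hqn, hpow, hmul]
    congr 2
    push_cast
    ring
  refine ⟨fun h1 h2 => c1 _ ht1 htR ?_ h2, fun h1 h2 => c3 _ htR ?_ h2, fun h1 h2 => ?_⟩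
  · rw [ht2, ← hone]
    exact hlt (by linarith)
  · rw [ht2, ← hone]
    exact hlt (by linarith)
  · have h3 : ‖qpow a k‖ ^ 2 * ‖qpow a 1‖ = 1 := by
      rw [ht2, ← hone]
      congr 2
      linarith
    refine ⟨c2 _ htR h3 h2, lineAvg_one_eq_of_circleIntegrable hq hf' (Real.exp_pos _) hσ1 ?_ htR ?_
      h3⟩
    · rw [hk, hmul, ← hone]
      exact hlt (by linarith)
    · rw [hk, hqn, hmul]
      exact hlt (by linarith)

theorem mainTheorem10 (a : ℝ) (ha : 0 < a) (r : ℝ) (hr0 : 0 < r) (hr1 : r ≤ 1)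
    (f : ℂ × ℂ → ℂ) (hf : AnalyticOnNhd ℂ f (A2.annulus a r)) :
    (∃ C : ℂ → ℂ, A2.IsCt a r f C) ∧
    ∀ C : ℂ → ℂ, A2.IsCt a r f C →
      ∀ k q t : ℂ, -r < k.re → k.re < 0 → q = A2.qpow a 1 → t = A2.qpow a k →
        -- the range `0 > Re k > -1/2`
        (-(1 / 2) < k.re → t ^ 3 * q ≠ 1 →
          C t = A2.int0 a t f + A2.int1 a 0 t f + A2.rho q t * f (t⁻¹, t⁻¹)) ∧
        -- the range `-1/2 > Re k > -1`
        (k.re < -(1 / 2) → t ^ 3 * q ^ 2 ≠ 1 →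
          C t = A2.int0 a t f + A2.int1 a 0 t f +
            A2.rho q t * (f (t⁻¹, t⁻¹) +
              A2.varpi1 q t 1 1 * f (t * q, (t ^ 2)⁻¹ * q⁻¹) +
              A2.varpi2 q t 1 1 * (f (t ^ 2 * q, t⁻¹) + f (t⁻¹, t ^ 2 * q)))) ∧
        -- the line `Re k = -1/2`, where the one-dimensional integrands have poles at `Re y = 0`:
        -- the contour passes to the right of them, or the integrals are assumed to converge
        (k.re = -(1 / 2) → t ^ 2 * q ≠ 1 →
          (∀ ε : ℝ, 0 < ε → ε < 1 / 2 →
            C t = A2.int0 a t f + A2.int1 a ε t f +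
              A2.rho q t * (f (t⁻¹, t⁻¹) +
                A2.varpi2 q t 1 1 * (f (t ^ 2 * q, t⁻¹) + f (t⁻¹, t ^ 2 * q)))) ∧
          (IntervalIntegrable (fun s : ℝ => A2.integrand1 a t f ((s : ℂ) * Complex.I))
              MeasureTheory.volume (-(Real.pi * a)) (Real.pi * a) →
            IntervalIntegrable (fun s : ℝ => A2.integrand2 a t f ((s : ℂ) * Complex.I))
              MeasureTheory.volume (-(Real.pi * a)) (Real.pi * a) →
            C t = A2.int0 a t f + A2.int1 a 0 t f +
              A2.rho q t * (f (t⁻¹, t⁻¹) +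
                A2.varpi2 q t 1 1 * (f (t ^ 2 * q, t⁻¹) + f (t⁻¹, t ^ 2 * q))))) := by
  obtain ⟨C₀, hC₀, -⟩ := exists_isCt ha hr0 hr1 hf (ε := 1 / 4) (by norm_num) (by norm_num)
  refine ⟨⟨C₀, hC₀⟩, fun C hC k q t hk1 hk2 hq ht => ?_⟩
  subst hq ht
  have htR : ‖qpow a k‖ < Real.exp (r / a) := by
    rw [norm_qpow]
    exact Real.exp_lt_exp.2 (div_lt_div_of_pos_right (by linarith) ha)
  have hR1 : 1 < Real.exp (r / a) := Real.one_lt_exp_iff.2 (div_pos hr0 ha)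
  have huniq : ∀ {D : ℂ → ℂ}, IsCt a r f D → C (qpow a k) = D (qpow a k) := fun hD =>
    MeromorphicNFOn.eqOn_of_eqOn_ball one_pos hR1.le hC.1 hD.1
      (fun s hs => (eq_circleAverage_of_isConstantTerm (hC.2 s hs)).trans
        (eq_circleAverage_of_isConstantTerm (hD.2 s hs)).symm) htR
  have h0 : Real.exp (-0 / a) = 1 := by rw [neg_zero, zero_div, Real.exp_zero]
  obtain ⟨D, hD, hv⟩ := exists_isCt ha hr0 hr1 hf (ε := 1 / 4) (by norm_num) (by norm_num)
  obtain ⟨v1, v2, v3⟩ := hv k hk1 hk2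
  simp only [int0_eq ha, int1_eq ha, h0]
  refine ⟨fun h1 h2 => (huniq hD).trans (v1 h1 h2), fun h1 h2 => (huniq hD).trans (v2 h1 h2),
    fun h1 h2 => ⟨fun ε hε0 hε1 => ?_, fun hi1 hi2 => ?_⟩⟩
  · obtain ⟨E, hE, hw⟩ := exists_isCt ha hr0 hr1 hf hε0 hε1
    exact (huniq hE).trans ((hw k hk1 hk2).2.2 h1 h2).1
  · obtain ⟨w1, w2⟩ := v3 h1 h2
    rw [huniq hD, w1, ctMid, w2]
    · exact circleIntegrable_of_intervalIntegrable ha (G := fun Y =>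
        (f ((qpow a k)⁻¹, Y) + f (Y, (qpow a k)⁻¹)) * zeta1 (qpow a 1) (qpow a k) Y) hi1
    · refine circleIntegrable_of_intervalIntegrable ha (G := fun Y =>
        f ((qpow a k)⁻¹ * Y⁻¹, Y) * zeta2 (qpow a 1) (qpow a k) Y) ?_
      simpa only [integrand2, qpow_neg] using hi2
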